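/- Let $k$ be a finite field of characteristic $\neq 2$, let $F=k(\varpi)$, and let $r\ge 0$. Let $S$ be a finite (possibly empty) set of places of $F$, i.e. of closed points of $\mathbb P^1_k$. For a place $v$ let $F_v$ be the completion, $\mathcal O_v$ its valuation ring, $k_v$ its residue field, identified with the algebraic closure of $k$ in $F_v$. Let $\mathcal O(S)$ be the ring of rational functions whose poles lie in $S$. **Lines.** Let $K\in\{k,k_v\}$. Write $\bigwedge W$ for the top exterior power of a finite-dimensional $K$-space $W$. For $\mathcal O_v$-lattices $A,B$ in $F_v^m$ put $(A|B)_K=(\bigwedge A/A\cap B)^*\otimes\bigwedge B/A\cap B$; for any lattice $L\subseteq A\cap B$ it is identified with $(\bigwedge A/L)^*\otimes\bigwedge B/L$, where $a^*\otimes b$ corresponds to $(\tilde a\wedge l)^*\otimes(\tilde b\wedge l)$ for any non-zero $l\in\bigwedge (A\cap B)/L$. Composition gives contractions $(A|B)_K\otimes(B|C)_K\to(A|C)_K$. For $g\in GL_m(F_v)$ let $D_g=(\mathcal O_v^m|g\mathcal O_v^m)_K$; the maps $D_g\otimes D_{g'}\to(\mathcal O_v^m|g\mathcal O_v^m)_K\otimes(g\mathcal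 O_v^m|gg'\mathcal O_v^m)_K\to D_{gg'}$ make the pairs $(g,x)$, $0\ne x\in D_g$, a central extension of $GL_m(F_v)$ by $K^\times$. **Local metaplectic group.** For $g\in GL_r(F_v)$ put $\Delta_{g}=D_{\det g}\otimes D_g^{-1}$. Let $\widetilde{GL}_{r,K}(F_v)$ be the group of pairs $(g,\delta)$, $0\neq\delta\in\Delta_g$, namely the Baer difference of the pull-back by $\det$ of the above extension for $m=1$ and of the one for $m=r$. Over $GL_r(\mathcal O_v)$ it has the splitting $\mathrm{triv}$ given by the canonical identification $\Delta_g=K$. **The section $\delta$.** (i) If $n$ is upper triangular unipotent, choose a lattice $M\subseteq\mathcal O_v^r$ with $nM=M$, and let $\mathfrak d_n\in D_n$ be the isomorphism $\bigwedge\mathcal O_v^r/M\to\bigwedge n\mathcal O_v^r/M$ induced by $n$; put $\delta_n=1\otimes\mathfrak d_n^{-1}$. (ii) Let $t=\mathrm{diag}(t_1,\dots,t_r)$, and let $w$ be a permutation matrix. Choose an even $\mathfrak n$ with $\mathfrak p_v^{\mathfrak n}\subseteq\mathcal O_v\cap t_i\mathcal O_v$ for all $i$; the maps $\omega_1\otimes\cdots\otimes\omega_r\mapsto\omega_1\wedge\cdots\wedge\omega_r$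 on $\bigotimes_i\bigwedge \mathcal O_v/\mathfrak p_v^{\mathfrak n}$ and on $\bigotimes_i\bigwedge t_i\mathcal O_v/\mathfrak p_v^{\mathfrak n}$ give an isomorphism $D_t\simeq D_{t_1}\otimes\cdots\otimes D_{t_r}$. Then $\delta_{tw}\in\Delta_{tw}=\mathrm{Hom}(D_{tw},D_{\det (tw)})$ is the composition of $D_{tw}=D_t\simeq D_{t_1}\otimes\cdots\otimes D_{t_r}$, of $y_1\otimes\cdots\otimes y_r\mapsto y_r\cdots y_1\in D_{\det t}=D_{\det(tw)}$, and of multiplication by $(-1)^{\sum_i(r-i)\deg_K(t_i)}$, where $\deg_K(t_i)=v(t_i)[k_v:K]$. (iii) For a Bruhat decomposition $g=ntwn'$, put $(g,\delta_g)=(n,\delta_n)(tw,\delta_{tw})(n',\delta_{n'})$. For $h\in GL_r(\mathcal O_v)$ let $\underline\kappa'_v(h)\in k_v^\times$ be defined, taking $K=k_v$, by $\mathrm{triv}(h)=\underline\kappa'_v(h)\cdot(h,\delta_h)$, and let $\underline\kappa_v(h)=N_{k_v/k}(\underline\kappa'_v(h))\in k^\times$. **Adelic group.** Let $\prod'_{v\notin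 S}GL_r(F_v)$ be the restricted product with respect to the subgroups $GL_r(\mathcal O_v)$, and $\prod'_{v\notin S}\widetilde{GL}_{r,k_v}(F_v)$ the restricted product with respect to the subgroups $\mathrm{triv}(GL_r(\mathcal O_v))$. Let $\widetilde G_r(\mathbb A^S)$ be the push-out of the latter along $\prod'_{v\notin S}k_v^\times\to k^\times$, $(x_v)\mapsto\prod_vN_{k_v/k}(x_v)$. **$S$-global group.** For $g\in GL_r(F)$ let $\Delta^S_g=\bigotimes_{v\notin S}\Delta_{g,v}$, where $\Delta_{g,v}$ is the $k$-line $\Delta_g$ at $v$ formed with $K=k$, canonically identified with $k$ for almost all $v$. Let $\widetilde G_r^S(F)$ be the group of pairs $(g,\delta)$ with $g\in GL_r(F)$, $0\neq\delta\in\Delta^S_g$, multiplied place by place. It has a splitting $\underline\kappa_S^*$ over $GL_r(\mathcal O(S))$ given by the identifications $\Delta_{h,v}=k$, and a set-theoretic section $s(g)=(g,\bigotimes_v\delta_{g,v})$, where $\delta_{g,v}\in\Delta_{g,v}$ is defined by (i)–(iii) with $K=k$, from a Bruhat decomposition of $g$ over $F$. Define $\underline\kappa_S(h)\in k^\times$,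 for $h\in GL_r(\mathcal O(S))$, by $\underline\kappa_S^*(h)=\underline\kappa_S(h)\cdot s(h)$. **Proposition.** (1) The elements $\delta_g$, local for $K=k_v$ ($v\notin S$) and global, exist and do not depend on the choices, so that $\underline\kappa'_v$ and $\underline\kappa_S$ are well defined. The two rows of $$\begin{array}{ccccccccc}1&\to&k^\times&\to&\widetilde G_r^S(F)&\to&GL_r(F)&\to&1\\&&\|&&\downarrow{\scriptstyle\Phi}&&\downarrow\\1&\to&k^\times&\to&\widetilde G_r(\mathbb A^S)&\to&\prod'_{v\notin S}GL_r(F_v)&\to&1\end{array}$$ are central extensions, and there is a homomorphism $\Phi$ making the diagram commutative and the right-hand square cartesian: for all $g\in GL_r(F)$ and $y\in\widetilde G_r(\mathbb A^S)$ with the same image in $\prod'_{v\notin S}GL_r(F_v)$, there is a unique $x\in\widetilde G_r^S(F)$ above $g$ with $\Phi(x)=y$. Moreover, $\Phi$ sends $s(g)$ to the class of $((g_v,\delta_{g_v}))_v$ (with $K=k_v$) for every $g\in GL_r(F)$, and $\underline\kappa_S^*(h)$ to the class of $(\mathrm{triv}(h_v))_v$ for every $h\in GL_r(\mathcal O(S))$.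 (2) For every $h\in GL_r(\mathcal O(S))$, one has $\underline\kappa_v(h_v)=1$ for almost all $v\notin S$, and $$\underline\kappa_S(h)=\prod_{v\notin S}\underline\kappa_v(h_v).$$ -/

import Mathlib

noncomputable section

namespace Metaplectic

open Module

section DeterminantLines

variable {K : Type*} [Field K]

/-- The top exterior power `⋀ W = ⋀^(dim W) W` of a finite-dimensional vector space. -/
abbrev TopExt (K W : Type*) [Field K] [AddCommGroup W] [Module K W] :
    Submodule K (ExteriorAlgebra K W) :=
  ⋀[K]^(finrank K W) W

section Wedge

variable {W Q U : Type*} [AddCommGroup W] [Module K W] [AddCommGroup Q] [Module K Q]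
  [AddCommGroup U] [Module K U]

theorem ι_mul_eq (w : W) (z : ExteriorAlgebra K W) :
    ExteriorAlgebra.ι K w * z = CliffordAlgebra.involute z * ExteriorAlgebra.ι K w := by
  induction z using CliffordAlgebra.left_induction with
  | algebraMap r => simp [Algebra.commutes]
  | add x y hx hy => simp [mul_add, add_mul, hx, hy]
  | ι_mul x m hx =>
    have h : ExteriorAlgebra.ι K w * CliffordAlgebra.ι _ m =
        -(CliffordAlgebra.ι _ m * ExteriorAlgebra.ι K w) :=
      eq_neg_of_add_eq_zero_left (ExteriorAlgebra.ι_add_mul_swap (R := K) w m)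
    rw [← mul_assoc, h, map_mul, CliffordAlgebra.involute_ι, neg_mul, neg_mul, mul_assoc, hx]
    simp [mul_assoc]

theorem ιMulti_basis_ne_zero {n : ℕ} (b : Basis (Fin n) K W) :
    ExteriorAlgebra.ιMulti K n b ≠ 0 := by
  intro h
  have h1 : exteriorPower.ιMulti K n b = 0 := Subtype.ext h
  have h2 := exteriorPower.alternatingMapLinearEquiv_apply_ιMulti b.det b
  rw [h1, map_zero, Basis.det_self] at h2
  exact zero_ne_one h2

theorem finrank_topExt [FiniteDimensional K W] : finrank K (TopExt K W) = 1 := by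
  rw [exteriorPower.finrank_eq, Nat.choose_self]

theorem exists_topExt_ne_zero (K W : Type*) [Field K] [AddCommGroup W] [Module K W]
    [FiniteDimensional K W] : ∃ a : TopExt K W, a ≠ 0 :=
  finrank_pos_iff_exists_ne_zero.1 (by rw [finrank_topExt]; exact one_pos)

theorem topExt_smul_eq [FiniteDimensional K W] {a : TopExt K W} (ha : a ≠ 0) (b : TopExt K W) :
    ∃ c : K, c • a = b :=
  (finrank_eq_one_iff_of_nonzero' a ha).1 finrank_topExt b

theorem ι_mul_topExt [FiniteDimensional K W] (w : W) (a : TopExt K W) :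
    ExteriorAlgebra.ι K w * (a : ExteriorAlgebra K W) = 0 := by
  have h0 : finrank K (⋀[K]^(1 + finrank K W) W) = 0 := by
    rw [exteriorPower.finrank_eq, Nat.choose_eq_zero_of_lt (by omega)]
  have hm : ExteriorAlgebra.ι K w * (a : ExteriorAlgebra K W) ∈ ⋀[K]^(1 + finrank K W) W :=
    SetLike.GradedMul.mul_mem
      (by rw [pow_one]; exact LinearMap.mem_range_self _ w) a.2
  have := finrank_zero_iff.1 h0
  exact congrArg Subtype.val (Subsingleton.elim (⟨_, hm⟩ : ⋀[K]^(1 + finrank K W) W) 0)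

theorem map_mem_exteriorPower (f : Q →ₗ[K] W) {n : ℕ} {a : ExteriorAlgebra K Q}
    (ha : a ∈ ⋀[K]^n Q) : ExteriorAlgebra.map f a ∈ ⋀[K]^n W := by
  have h := Submodule.mem_map_of_mem (f := (ExteriorAlgebra.map f).toLinearMap) ha
  rw [Submodule.map_pow, ExteriorAlgebra.ι_range_map_map] at h
  refine (pow_le_pow_left' (?_ : (f.range.map (ExteriorAlgebra.ι K)) ≤ _) n) h
  rintro _ ⟨w, -, rfl⟩
  exact LinearMap.mem_range_self _ w

/-- For `W = Q ⊕ U` and a basis vector `l` of `⋀ U`, the isomorphism `⋀ Q ≃ ⋀ W`,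
`a ↦ a ∧ l`. -/
theorem exists_wedgeEquiv [FiniteDimensional K W] (f : Q →ₗ[K] W) (i : U →ₗ[K] W)
    (hfi : Function.Bijective (f.coprod i)) (l : TopExt K U) (hl : l ≠ 0) :
    ∃ σ : TopExt K Q ≃ₗ[K] TopExt K W, ∀ a : TopExt K Q,
      (σ a : ExteriorAlgebra K W) = ExteriorAlgebra.map f (a : ExteriorAlgebra K Q) *
        ExteriorAlgebra.map i (l : ExteriorAlgebra K U) := by
  let e := LinearEquiv.ofBijective _ hfi
  have : FiniteDimensional K (Q × U) := e.symm.finiteDimensional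
  have : FiniteDimensional K Q :=
    Module.Finite.of_surjective _ (LinearMap.fst_surjective (R := K) (M := Q) (M₂ := U))
  have : FiniteDimensional K U :=
    Module.Finite.of_surjective _ (LinearMap.snd_surjective (R := K) (M := Q) (M₂ := U))
  have h : finrank K W = finrank K Q + finrank K U := by
    rw [← e.finrank_eq, finrank_prod]
  let τ : TopExt K Q →ₗ[K] TopExt K W :=
    { toFun := fun a => ⟨ExteriorAlgebra.map f (a : ExteriorAlgebra K Q) *
        ExteriorAlgebra.map i (l : ExteriorAlgebra K U), by
          unfold TopExt
          rw [h]
          exact SetLike.GradedMul.mul_mem (map_mem_exteriorPower f a.2)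
            (map_mem_exteriorPower i l.2)⟩
      map_add' := fun a b => Subtype.ext (by simp [add_mul])
      map_smul' := fun c a => Subtype.ext (by simp) }
  have hτ : Function.Injective τ := by
    let bQ := finBasis K Q
    let bU := finBasis K U
    let ωQ : TopExt K Q := exteriorPower.ιMulti K _ bQ
    let ωU : TopExt K U := exteriorPower.ιMulti K _ bU
    have hωQ : ωQ ≠ 0 := fun h => ιMulti_basis_ne_zero bQ (congrArg Subtype.val h)
    have hωU : ωU ≠ 0 := fun h => ιMulti_basis_ne_zero bU (congrArg Subtype.val h)
    rw [injective_iff_map_eq_zero]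
    intro a ha
    obtain ⟨c, rfl⟩ := topExt_smul_eq hωQ a
    obtain ⟨d, rfl⟩ := topExt_smul_eq hωU l
    have hd : d ≠ 0 := by rintro rfl; simp at hl
    let b : Basis (Fin (finrank K Q + finrank K U)) K W :=
      ((bQ.prod bU).map e).reindex finSumFinEquiv
    have hb : (b : _ → W) = Fin.append (f ∘ bQ) (i ∘ bU) := by
      funext j
      refine Fin.addCases (fun j => ?_) (fun j => ?_) j <;> simp [b, e]
    have h2 := congrArg Subtype.val ha
    simp only [τ, LinearMap.coe_mk, AddHom.coe_mk, Submodule.coe_smul, map_smul, ωQ, ωU,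
      exteriorPower.ιMulti_apply_coe, ExteriorAlgebra.map_apply_ιMulti, mul_smul_comm,
      ExteriorAlgebra.ιMulti_mul_ιMulti, ← hb, Submodule.coe_zero] at h2
    rcases smul_eq_zero.1 h2 with h3 | h3
    · rw [h3, zero_smul]
    · rcases smul_eq_zero.1 h3 with h4 | h4
      · exact absurd h4 hd
      · exact absurd h4 (ιMulti_basis_ne_zero b)
  refine ⟨LinearEquiv.ofInjectiveOfFinrankEq τ hτ ?_, fun a => rfl⟩
  rw [finrank_topExt, finrank_topExt]

theorem map_mul_map_congr [FiniteDimensional K U] {X : Type*} [AddCommGroup X] [Module K X]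
    (f f' : X →ₗ[K] W) (i : U →ₗ[K] W) (h : ∀ x, ∃ u, f x - f' x = i u)
    (x : ExteriorAlgebra K X) (l : TopExt K U) :
    ExteriorAlgebra.map f x * ExteriorAlgebra.map i (l : ExteriorAlgebra K U) =
      ExteriorAlgebra.map f' x * ExteriorAlgebra.map i (l : ExteriorAlgebra K U) := by
  induction x using CliffordAlgebra.left_induction with
  | algebraMap r => simp
  | add x y hx hy => simp only [map_add, add_mul, hx, hy]
  | ι_mul x m hx =>
    change ExteriorAlgebra.map f (ExteriorAlgebra.ι K m * x) * _ =
      ExteriorAlgebra.map f' (ExteriorAlgebra.ι K m * x) * _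
    obtain ⟨u, hu⟩ := h m
    rw [map_mul, map_mul, ExteriorAlgebra.map_apply_ι, ExteriorAlgebra.map_apply_ι, mul_assoc,
      mul_assoc, ← hx, ← sub_eq_zero, ← sub_mul, ← map_sub, hu, ← mul_assoc, ι_mul_eq, mul_assoc,
      ← ExteriorAlgebra.map_apply_ι, ← map_mul, ι_mul_topExt, map_zero, mul_zero]

end Wedge

variable {V : Type*} [AddCommGroup V] [Module K V]

/-- `A / (A ∩ L)`, realised as the image of `A` in `V / L`. -/
abbrev Quo (A L : Submodule K V) : Submodule K (V ⧸ L) := A.map L.mkQ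

/-- For `L ⊆ A ∩ B`, the non-zero elements of the line `(⋀ A/L)^* ⊗ ⋀ B/L`, i.e. the
isomorphisms from the line `⋀ A/L` to the line `⋀ B/L`. -/
abbrev DetIso (A B L : Submodule K V) : Type _ :=
  TopExt K (Quo A L) ≃ₗ[K] TopExt K (Quo B L)

/-- The inclusion of `⋀ A/L` in the exterior algebra of `V / L`. -/
def inc {A L : Submodule K V} (a : TopExt K (Quo A L)) : ExteriorAlgebra K (V ⧸ L) :=
  ExteriorAlgebra.map (Quo A L).subtype (a : ExteriorAlgebra K (Quo A L))

theorem inc_injective {A L : Submodule K V} :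
    Function.Injective (inc : TopExt K (Quo A L) → ExteriorAlgebra K (V ⧸ L)) := fun _ _ h =>
  Subtype.ext (ExteriorAlgebra.map_injective_field (Submodule.ker_subtype _) h)

theorem inc_smul {A L : Submodule K V} (c : K) (a : TopExt K (Quo A L)) :
    inc (c • a) = c • inc a := by
  simp [inc]

/-- `s : V / L → V / L'` lifts the map `V / L → V / gL` induced by `g`, where `L' ⊆ gL`. -/
def IsLift (g : V ≃ₗ[K] V) (L L' : Submodule K V) (s : (V ⧸ L) →ₗ[K] (V ⧸ L')) : Prop :=
  ∀ v, s (L.mkQ v) - L'.mkQ (g v) ∈ Quo (L.map (g : V →ₗ[K] V)) L'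

theorem exists_isLift (g : V ≃ₗ[K] V) {L L' : Submodule K V}
    (h : L' ≤ L.map (g : V →ₗ[K] V)) : ∃ s, IsLift g L L' s := by
  let M := L.map (g : V →ₗ[K] V)
  let p : (V ⧸ L') →ₗ[K] (V ⧸ M) := Submodule.factor h
  obtain ⟨σ, hσ⟩ := p.exists_rightInverse_of_surjective
    (LinearMap.range_eq_top.2 (Submodule.factor_surjective h))
  let q : (V ⧸ L) →ₗ[K] (V ⧸ M) := L.mapQ M (g : V →ₗ[K] V) (Submodule.le_comap_map _ _)
  refine ⟨σ ∘ₗ q, fun v => ?_⟩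
  obtain ⟨w, hw⟩ := L'.mkQ_surjective ((σ ∘ₗ q) (L.mkQ v) - L'.mkQ (g v))
  rw [← hw]
  refine Submodule.mem_map_of_mem ?_
  have h1 : p (L'.mkQ w) = 0 := by
    rw [hw, map_sub, LinearMap.comp_apply, ← LinearMap.comp_apply, hσ]
    simp [p, q, M]
  have h2 : M.mkQ w = 0 := by simpa [p] using h1
  rwa [← LinearMap.mem_ker, Submodule.ker_mkQ] at h2

/-- The conditions under which `g` carries `⋀ A/L` to `⋀ A'/L'`, where `A' = gA` and
`L' ⊆ gL`, up to a factor depending on a basis vector of `⋀ gL/L'`. -/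
structure PushOK (g : V ≃ₗ[K] V) (A L A' L' : Submodule K V) : Prop where
  map_eq : A.map (g : V →ₗ[K] V) = A'
  le : L ≤ A
  le_map : L' ≤ L.map (g : V →ₗ[K] V)
  fin : FiniteDimensional K (Quo A' L')

theorem PushOK.map_le {g : V ≃ₗ[K] V} {A L A' L' : Submodule K V} (h : PushOK g A L A' L') :
    L.map (g : V →ₗ[K] V) ≤ A' := h.map_eq ▸ Submodule.map_mono h.le

theorem PushOK.quo_le {g : V ≃ₗ[K] V} {A L A' L' : Submodule K V} (h : PushOK g A L A' L') :
    Quo (L.map (g : V →ₗ[K] V)) L' ≤ Quo A' L' := Submodule.map_mono h.map_le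

theorem PushOK.fin_map {g : V ≃ₗ[K] V} {A L A' L' : Submodule K V} (h : PushOK g A L A' L') :
    FiniteDimensional K (Quo (L.map (g : V →ₗ[K] V)) L') :=
  have := h.fin
  Submodule.finiteDimensional_of_le h.quo_le

theorem exists_sigma {g : V ≃ₗ[K] V} {A L A' L' : Submodule K V} (h : PushOK g A L A' L')
    {s : (V ⧸ L) →ₗ[K] (V ⧸ L')} (hs : IsLift g L L' s)
    {l : TopExt K (Quo (L.map (g : V →ₗ[K] V)) L')} (hl : l ≠ 0) :
    ∃ σ : TopExt K (Quo A L) ≃ₗ[K] TopExt K (Quo A' L'), ∀ a,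
      inc (σ a) = ExteriorAlgebra.map s (inc a) * inc l := by
  have := h.fin
  have hsA : ∀ x ∈ Quo A L, s x ∈ Quo A' L' := by
    rintro _ ⟨v, hv, rfl⟩
    have h1 : L'.mkQ (g v) ∈ Quo A' L' :=
      Submodule.mem_map_of_mem (h.map_eq ▸ Submodule.mem_map_of_mem hv)
    simpa using add_mem (h.quo_le (hs v)) h1
  let f : Quo A L →ₗ[K] Quo A' L' := s.restrict hsA
  let i : Quo (L.map (g : V →ₗ[K] V)) L' →ₗ[K] Quo A' L' := Submodule.inclusion h.quo_le
  have hb : Function.Bijective (f.coprod i) := by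
    constructor
    · rw [injective_iff_map_eq_zero]
      rintro ⟨⟨_, v, hv, rfl⟩, u⟩ h0
      have h1 : s (L.mkQ v) + (u : V ⧸ L') = 0 := by
        simpa [f, i] using congrArg Subtype.val h0
      have h2 : L'.mkQ (g v) ∈ Quo (L.map (g : V →ₗ[K] V)) L' := by
        have := neg_mem (add_mem (hs v) u.2)
        rwa [sub_add_eq_add_sub, h1, zero_sub, neg_neg] at this
      obtain ⟨w, hw, hw2⟩ := h2
      have h3 : g v ∈ L.map (g : V →ₗ[K] V) := by
        have h4 : w - g v ∈ L' := by
          rw [← L'.ker_mkQ, LinearMap.mem_ker, map_sub, hw2, sub_self]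
        have := sub_mem hw (h.le_map h4)
        rwa [sub_sub_cancel] at this
      have h5 : v ∈ L := by
        obtain ⟨w', hw', h6⟩ := h3
        rwa [← g.injective h6]
      have h6 : L.mkQ v = 0 := by rwa [← LinearMap.mem_ker, Submodule.ker_mkQ]
      rw [h6, map_zero, zero_add] at h1
      exact Prod.ext (Subtype.ext h6) (Subtype.ext h1)
    · rintro ⟨_, w, hw, rfl⟩
      rw [SetLike.mem_coe, ← h.map_eq] at hw
      obtain ⟨v, hv, rfl⟩ := hw
      refine ⟨⟨⟨L.mkQ v, Submodule.mem_map_of_mem hv⟩, ⟨_, neg_mem (hs v)⟩⟩, Subtype.ext ?_⟩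
      simp [f, i]
  obtain ⟨σ, hσ⟩ := exists_wedgeEquiv f i hb l hl
  refine ⟨σ, fun a => ?_⟩
  have e1 : (Quo A' L').subtype ∘ₗ f = s ∘ₗ (Quo A L).subtype := rfl
  have e2 : (Quo A' L').subtype ∘ₗ i = (Quo (L.map (g : V →ₗ[K] V)) L').subtype := rfl
  rw [inc, hσ, map_mul, ← AlgHom.comp_apply, ← AlgHom.comp_apply,
    ExteriorAlgebra.map_comp_map, ExteriorAlgebra.map_comp_map, e1, e2,
    ← ExteriorAlgebra.map_comp_map, AlgHom.comp_apply]
  rfl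

/-- `x'` is the image of `x` under the isomorphism
`(⋀ A/L)^* ⊗ ⋀ B/L ≃ (⋀ A'/L')^* ⊗ ⋀ B'/L'` induced by `g`, where `A' = gA`, `B' = gB` and
`L' ⊆ gL`: it sends `a^* ⊗ b` to `(ga ∧ l)^* ⊗ (gb ∧ l)`, for any basis vector `l` of
`⋀ gL/L'`. For `g = 1` this is the passage to a smaller common sublattice. -/
def IsPush (g : V ≃ₗ[K] V) {A B L A' B' L' : Submodule K V}
    (x : DetIso A B L) (x' : DetIso A' B' L') : Prop :=
  ∃ s, IsLift g L L' s ∧ ∃ l : TopExt K (Quo (L.map (g : V →ₗ[K] V)) L'), l ≠ 0 ∧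
    ∀ a a', inc a' = ExteriorAlgebra.map s (inc a) * inc l →
      inc (x' a') = ExteriorAlgebra.map s (inc (x a)) * inc l

section Push

variable {g g₂ : V ≃ₗ[K] V} {A B C L A' B' C' L' A'' B'' L'' : Submodule K V}

theorem IsPush.forall {x : DetIso A B L} {x' : DetIso A' B' L'} (h : IsPush g x x')
    [FiniteDimensional K (Quo (L.map (g : V →ₗ[K] V)) L')]
    {s : (V ⧸ L) →ₗ[K] (V ⧸ L')} (hs : IsLift g L L' s)
    {l : TopExt K (Quo (L.map (g : V →ₗ[K] V)) L')} (hl : l ≠ 0) {a : TopExt K (Quo A L)}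
    {a' : TopExt K (Quo A' L')} (ha : inc a' = ExteriorAlgebra.map s (inc a) * inc l) :
    inc (x' a') = ExteriorAlgebra.map s (inc (x a)) * inc l := by
  obtain ⟨t, ht, m, hm, H⟩ := h
  obtain ⟨c, rfl⟩ := topExt_smul_eq hm l
  have hc : c ≠ 0 := by rintro rfl; simp at hl
  have key : ∀ z, ExteriorAlgebra.map s z * inc m = ExteriorAlgebra.map t z * inc m := by
    intro z
    refine map_mul_map_congr s t _ (fun z => ?_) z m
    obtain ⟨v, rfl⟩ := L.mkQ_surjective z
    exact ⟨⟨_, sub_mem (hs v) (ht v)⟩, by simp⟩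
  rw [inc_smul, mul_smul_comm, key] at ha ⊢
  have h1 := H a (c⁻¹ • a') (by rw [inc_smul, ha, smul_smul, inv_mul_cancel₀ hc, one_smul])
  rw [map_smul, inc_smul] at h1
  rw [← h1, smul_smul, mul_inv_cancel₀ hc, one_smul]

theorem exists_isPush (hA : PushOK g A L A' L') (hB : PushOK g B L B' L') (x : DetIso A B L) :
    ∃ x' : DetIso A' B' L', IsPush g x x' := by
  have := hA.fin_map
  obtain ⟨s, hs⟩ := exists_isLift g hA.le_map
  obtain ⟨l, hl⟩ := exists_topExt_ne_zero K (Quo (L.map (g : V →ₗ[K] V)) L')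
  obtain ⟨σ, hσ⟩ := exists_sigma hA hs hl
  obtain ⟨τ, hτ⟩ := exists_sigma hB hs hl
  refine ⟨(σ.symm.trans x).trans τ, s, hs, l, hl, fun a a' h => ?_⟩
  rw [← hσ] at h
  rw [inc_injective h]
  simp [hτ]

theorem exists_isPush_left (hA : PushOK g A L A' L') (hB : PushOK g B L B' L')
    (x' : DetIso A' B' L') : ∃ x : DetIso A B L, IsPush g x x' := by
  have := hA.fin_map
  obtain ⟨s, hs⟩ := exists_isLift g hA.le_map
  obtain ⟨l, hl⟩ := exists_topExt_ne_zero K (Quo (L.map (g : V →ₗ[K] V)) L')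
  obtain ⟨σ, hσ⟩ := exists_sigma hA hs hl
  obtain ⟨τ, hτ⟩ := exists_sigma hB hs hl
  refine ⟨(σ.trans x').trans τ.symm, s, hs, l, hl, fun a a' h => ?_⟩
  rw [← hσ] at h
  rw [inc_injective h, ← hτ]
  simp

theorem IsPush.eq_right (hA : PushOK g A L A' L') {x : DetIso A B L} {x' y' : DetIso A' B' L'}
    (h : IsPush g x x') (h' : IsPush g x y') : x' = y' := by
  have := hA.fin_map
  obtain ⟨s, hs⟩ := exists_isLift g hA.le_map
  obtain ⟨l, hl⟩ := exists_topExt_ne_zero K (Quo (L.map (g : V →ₗ[K] V)) L')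
  obtain ⟨σ, hσ⟩ := exists_sigma hA hs hl
  refine LinearEquiv.ext fun a' => inc_injective ?_
  obtain ⟨a, rfl⟩ := σ.surjective a'
  rw [h.forall hs hl (hσ a), h'.forall hs hl (hσ a)]

theorem IsPush.eq_left (hA : PushOK g A L A' L') (hB : PushOK g B L B' L')
    {x y : DetIso A B L} {x' : DetIso A' B' L'}
    (h : IsPush g x x') (h' : IsPush g y x') : x = y := by
  have := hA.fin_map
  obtain ⟨s, hs⟩ := exists_isLift g hA.le_map
  obtain ⟨l, hl⟩ := exists_topExt_ne_zero K (Quo (L.map (g : V →ₗ[K] V)) L')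
  obtain ⟨σ, hσ⟩ := exists_sigma hA hs hl
  obtain ⟨τ, hτ⟩ := exists_sigma hB hs hl
  refine LinearEquiv.ext fun a => τ.injective (inc_injective ?_)
  rw [hτ, hτ, ← h.forall hs hl (hσ a), ← h'.forall hs hl (hσ a)]

theorem IsPush.trans {x : DetIso A B L} {y : DetIso B C L} {x' : DetIso A' B' L'}
    {y' : DetIso B' C' L'} (hA : PushOK g A L A' L')
    (hx : IsPush g x x') (hy : IsPush g y y') :
    IsPush g (x.trans y) (x'.trans y') := by
  have := hA.fin_map
  obtain ⟨s, hs⟩ := exists_isLift g hA.le_map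
  obtain ⟨l, hl⟩ := exists_topExt_ne_zero K (Quo (L.map (g : V →ₗ[K] V)) L')
  exact ⟨s, hs, l, hl, fun a a' h => hy.forall hs hl (hx.forall hs hl h)⟩

theorem IsPush.symm {x : DetIso A B L} {x' : DetIso A' B' L'}
    (hA : PushOK g A L A' L') (hx : IsPush g x x') : IsPush g x.symm x'.symm := by
  have := hA.fin_map
  obtain ⟨s, hs⟩ := exists_isLift g hA.le_map
  obtain ⟨l, hl⟩ := exists_topExt_ne_zero K (Quo (L.map (g : V →ₗ[K] V)) L')
  obtain ⟨σ, hσ⟩ := exists_sigma hA hs hl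
  refine ⟨s, hs, l, hl, fun b b' h => ?_⟩
  have h1 := hx.forall hs hl (hσ (x.symm b))
  rw [LinearEquiv.apply_symm_apply, ← h] at h1
  rw [← inc_injective h1, LinearEquiv.symm_apply_apply, hσ]

theorem map_mul_eq (L : Submodule K V) :
    L.map ((g₂ * g : V ≃ₗ[K] V) : V →ₗ[K] V) =
      (L.map (g : V →ₗ[K] V)).map (g₂ : V →ₗ[K] V) := by
  rw [← Submodule.map_comp]; rfl

theorem IsPush.comp {x : DetIso A B L} {x' : DetIso A' B' L'} {x'' : DetIso A'' B'' L''}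
    (hA : PushOK g A L A' L') (hA' : PushOK g₂ A' L' A'' L'')
    (h : IsPush g x x') (h' : IsPush g₂ x' x'') : IsPush (g₂ * g) x x'' := by
  have := hA.fin_map
  have := hA'.fin_map
  obtain ⟨s, hs⟩ := exists_isLift g hA.le_map
  obtain ⟨l, hl⟩ := exists_topExt_ne_zero K (Quo (L.map (g : V →ₗ[K] V)) L')
  obtain ⟨s₂, hs₂⟩ := exists_isLift g₂ hA'.le_map
  obtain ⟨l₂, hl₂⟩ := exists_topExt_ne_zero K (Quo (L'.map (g₂ : V →ₗ[K] V)) L'')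
  obtain ⟨σ, hσ⟩ := exists_sigma hA hs hl
  have hle : Quo (L.map ((g₂ * g : V ≃ₗ[K] V) : V →ₗ[K] V)) L'' ≤ Quo A'' L'' := by
    rw [map_mul_eq, ← hA'.map_eq]
    exact Submodule.map_mono (Submodule.map_mono hA.map_le)
  have hok : PushOK g₂ (L.map (g : V →ₗ[K] V)) L'
      (L.map ((g₂ * g : V ≃ₗ[K] V) : V →ₗ[K] V)) L'' :=
    ⟨(map_mul_eq L).symm, hA.le_map, hA'.le_map,
      have := hA'.fin
      Submodule.finiteDimensional_of_le hle⟩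
  obtain ⟨τ, hτ⟩ := exists_sigma hok hs₂ hl₂
  refine ⟨s₂ ∘ₗ s, fun v => ?_, τ l, fun h0 => hl (τ.map_eq_zero_iff.1 h0), fun a a'' ha => ?_⟩
  · have h1 := hok.quo_le (hs₂ (g v))
    obtain ⟨w, hw, hw2⟩ := hs v
    have h2 : s₂ (L'.mkQ w) ∈ Quo (L.map ((g₂ * g : V ≃ₗ[K] V) : V →ₗ[K] V)) L'' := by
      have h3 : L''.mkQ (g₂ w) ∈ Quo (L.map ((g₂ * g : V ≃ₗ[K] V) : V →ₗ[K] V)) L'' := by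
        rw [map_mul_eq]
        exact Submodule.mem_map_of_mem (Submodule.mem_map_of_mem hw)
      simpa using add_mem (hok.quo_le (hs₂ w)) h3
    rw [hw2, map_sub] at h2
    simpa using add_mem h2 h1
  · rw [← ExteriorAlgebra.map_comp_map, AlgHom.comp_apply, hτ, ← mul_assoc, ← map_mul,
      ← hσ] at ha
    rw [h'.forall hs₂ hl₂ ha, h.forall hs hl (hσ a), map_mul, hτ,
      ← ExteriorAlgebra.map_comp_map, AlgHom.comp_apply, mul_assoc]

/-- The canonical basis vector of `(⋀ A/L)^* ⊗ ⋀ B/L` when `A = B`. -/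
def DetIso.ofEq (h : A = B) : DetIso A B L := h ▸ LinearEquiv.refl K _

theorem DetIso.inc_ofEq (h : A = B) (a : TopExt K (Quo A L)) :
    inc (DetIso.ofEq h a) = inc a := by
  subst h; rfl

theorem isPush_ofEq (hA : PushOK g A L A' L') (h : A = B) (h' : A' = B') :
    IsPush g (DetIso.ofEq h : DetIso A B L) (DetIso.ofEq h' : DetIso A' B' L') := by
  have := hA.fin_map
  obtain ⟨s, hs⟩ := exists_isLift g hA.le_map
  obtain ⟨l, hl⟩ := exists_topExt_ne_zero K (Quo (L.map (g : V →ₗ[K] V)) L')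
  exact ⟨s, hs, l, hl, fun a a' h => by rwa [DetIso.inc_ofEq, DetIso.inc_ofEq]⟩

theorem isPush_smul (hA : PushOK g A L A' L') (c : Kˣ) :
    IsPush g (LinearEquiv.smulOfUnit c : DetIso A A L)
      (LinearEquiv.smulOfUnit c : DetIso A' A' L') := by
  have := hA.fin_map
  obtain ⟨s, hs⟩ := exists_isLift g hA.le_map
  obtain ⟨l, hl⟩ := exists_topExt_ne_zero K (Quo (L.map (g : V →ₗ[K] V)) L')
  refine ⟨s, hs, l, hl, fun a a' h => ?_⟩
  change inc ((c : K) • a') = _ * _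
  rw [inc_smul, h]
  change _ = ExteriorAlgebra.map s (inc ((c : K) • a)) * inc l
  rw [inc_smul, map_smul, smul_mul_assoc]

end Push

/-! ### Commensurable subspaces -/

/-- `A` and `B` are commensurable: `A / (A ∩ B)` and `B / (A ∩ B)` are finite-dimensional. -/
def Commens (A B : Submodule K V) : Prop :=
  FiniteDimensional K (Quo A (A ⊓ B)) ∧ FiniteDimensional K (Quo B (A ⊓ B))

theorem fin_quo_iff {A L : Submodule K V} :
    FiniteDimensional K (Quo A L) ↔ ∃ N : Submodule K V, N.FG ∧ A ≤ L ⊔ N := by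
  constructor
  · intro h
    obtain ⟨σ, hσ⟩ := L.mkQ.exists_rightInverse_of_surjective L.range_mkQ
    refine ⟨(Quo A L).map σ, (Module.Finite.iff_fg.1 h).map σ, fun a ha => ?_⟩
    rw [← sub_add_cancel a (σ (L.mkQ a))]
    refine Submodule.add_mem_sup ?_ (Submodule.mem_map_of_mem (Submodule.mem_map_of_mem ha))
    have h1 : L.mkQ (σ (L.mkQ a)) = L.mkQ a := LinearMap.congr_fun hσ (L.mkQ a)
    have h2 : a - σ (L.mkQ a) ∈ L.mkQ.ker := by rw [LinearMap.mem_ker, map_sub, h1, sub_self]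
    rwa [Submodule.ker_mkQ] at h2
  · rintro ⟨N, hN, h⟩
    have h1 : Quo A L ≤ N.map L.mkQ := by
      refine (Submodule.map_mono h).trans ?_
      rw [Submodule.map_sup, Submodule.mkQ_map_self, bot_sup_eq]
    have := Module.Finite.iff_fg.2 (hN.map L.mkQ)
    exact Submodule.finiteDimensional_of_le h1

theorem fin_quo_trans {A B C : Submodule K V} (h : FiniteDimensional K (Quo A B))
    (h' : FiniteDimensional K (Quo B C)) : FiniteDimensional K (Quo A C) := by
  rw [fin_quo_iff] at h h' ⊢
  obtain ⟨N, hN, h⟩ := h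
  obtain ⟨N', hN', h'⟩ := h'
  exact ⟨N' ⊔ N, hN'.sup hN, h.trans (by rw [← sup_assoc]; exact sup_le_sup_right h' N)⟩

theorem fin_quo_mono {A A' L L' : Submodule K V} (hA : A' ≤ A) (hL : L ≤ L')
    (h : FiniteDimensional K (Quo A L)) : FiniteDimensional K (Quo A' L') := by
  rw [fin_quo_iff] at h ⊢
  obtain ⟨N, hN, h⟩ := h
  exact ⟨N, hN, hA.trans (h.trans (sup_le_sup_right hL N))⟩

theorem fin_quo_map {A L : Submodule K V} (g : V →ₗ[K] V) (h : FiniteDimensional K (Quo A L)) :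
    FiniteDimensional K (Quo (A.map g) (L.map g)) := by
  rw [fin_quo_iff] at h ⊢
  obtain ⟨N, hN, h⟩ := h
  exact ⟨N.map g, hN.map g, (Submodule.map_mono h).trans (Submodule.map_sup _ _ _).le⟩

theorem fin_quo_inf {A L M : Submodule K V} (h : FiniteDimensional K (Quo A L))
    (h' : FiniteDimensional K (Quo A M)) : FiniteDimensional K (Quo A (L ⊓ M)) := by
  let f : (V ⧸ (L ⊓ M)) →ₗ[K] (V ⧸ L) × (V ⧸ M) :=
    (Submodule.factor inf_le_left).prod (Submodule.factor inf_le_right)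
  have hf : Function.Injective f := by
    rw [injective_iff_map_eq_zero]
    intro x hx
    obtain ⟨v, rfl⟩ := (L ⊓ M).mkQ_surjective x
    have h1 : v ∈ L := by simpa [f] using congrArg Prod.fst hx
    have h2 : v ∈ M := by simpa [f] using congrArg Prod.snd hx
    rw [← LinearMap.mem_ker, Submodule.ker_mkQ]
    exact ⟨h1, h2⟩
  have hle : (Quo A (L ⊓ M)).map f ≤ (Quo A L).prod (Quo A M) := by
    rintro _ ⟨_, ⟨v, hv, rfl⟩, rfl⟩
    exact ⟨Submodule.mem_map_of_mem hv, Submodule.mem_map_of_mem hv⟩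
  have h3 : ((Quo A L).prod (Quo A M)).FG :=
    (Module.Finite.iff_fg.1 h).prod (Module.Finite.iff_fg.1 h')
  have h4 : FiniteDimensional K ((Quo A L).prod (Quo A M)) := Module.Finite.iff_fg.2 h3
  have h5 := Submodule.finiteDimensional_of_le hle
  exact Module.Finite.of_injective (f.submoduleMap (Quo A (L ⊓ M)))
    (fun x y hxy => Subtype.ext (hf (congrArg Subtype.val hxy)))

theorem fin_quo_self (A : Submodule K V) : FiniteDimensional K (Quo A A) :=
  fin_quo_iff.2 ⟨⊥, Submodule.fg_bot, le_sup_left⟩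

theorem commens_iff {A B : Submodule K V} :
    Commens A B ↔ FiniteDimensional K (Quo A B) ∧ FiniteDimensional K (Quo B A) :=
  ⟨fun h => ⟨fin_quo_mono le_rfl inf_le_right h.1, fin_quo_mono le_rfl inf_le_left h.2⟩,
    fun h => ⟨fin_quo_inf (fin_quo_self A) h.1, fin_quo_inf h.2 (fin_quo_self B)⟩⟩

theorem Commens.refl (A : Submodule K V) : Commens A A :=
  commens_iff.2 ⟨fin_quo_self A, fin_quo_self A⟩

theorem Commens.symm {A B : Submodule K V} (h : Commens A B) : Commens B A :=
  commens_iff.2 (commens_iff.1 h).symm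

theorem Commens.trans {A B C : Submodule K V} (h : Commens A B) (h' : Commens B C) :
    Commens A C := by
  rw [commens_iff] at *
  exact ⟨fin_quo_trans h.1 h'.1, fin_quo_trans h'.2 h.2⟩

theorem Commens.map {A B : Submodule K V} (h : Commens A B) (g : V →ₗ[K] V) :
    Commens (A.map g) (B.map g) := by
  rw [commens_iff] at *
  exact ⟨fin_quo_map g h.1, fin_quo_map g h.2⟩

theorem Commens.inf {A B C : Submodule K V} (h : Commens A B) (h' : Commens A C) :
    Commens A (B ⊓ C) := by
  rw [commens_iff] at *
  exact ⟨fin_quo_inf h.1 h'.1, fin_quo_mono inf_le_left le_rfl h.2⟩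

theorem Commens.fin {A B : Submodule K V} (h : Commens A B) : FiniteDimensional K (Quo A B) :=
  (commens_iff.1 h).1

/-! ### The extension of Arbarello, De Concini and Kac -/

/-- Pairs `(f, x)`, where `f` is an automorphism of `V` such that `fA` is commensurable to `A`
and `x` is a non-zero element of the line
`(A | fA) = (⋀ A / (A ∩ fA))^* ⊗ ⋀ (fA / (A ∩ fA))`. -/
structure Ack (A : Submodule K V) where
  f : V ≃ₗ[K] V
  comm : Commens A (A.map (f : V →ₗ[K] V))
  x : DetIso A (A.map (f : V →ₗ[K] V)) (A ⊓ A.map (f : V →ₗ[K] V))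

namespace Ack

variable {A : Submodule K V}

theorem pushOK_left (u : Ack A) {g : V ≃ₗ[K] V} {B L : Submodule K V}
    (hB : A.map (g : V →ₗ[K] V) = B) (hL : L ≤ B)
    (hL' : L ≤ A.map ((g * u.f : V ≃ₗ[K] V) : V →ₗ[K] V)) (hc : Commens B L) :
    PushOK g A (A ⊓ A.map (u.f : V →ₗ[K] V)) B L where
  map_eq := hB
  le := inf_le_left
  le_map := by
    rw [Submodule.map_inf _ g.injective, ← map_mul_eq, hB]
    exact le_inf hL hL'
  fin := hc.fin

theorem pushOK_right (u : Ack A) {g : V ≃ₗ[K] V} {C L : Submodule K V}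
    (hC : A.map ((g * u.f : V ≃ₗ[K] V) : V →ₗ[K] V) = C) (hL : L ≤ A.map (g : V →ₗ[K] V))
    (hL' : L ≤ C) (hc : Commens C L) :
    PushOK g (A.map (u.f : V →ₗ[K] V)) (A ⊓ A.map (u.f : V →ₗ[K] V)) C L where
  map_eq := by rw [← map_mul_eq, hC]
  le := inf_le_right
  le_map := by
    rw [Submodule.map_inf _ g.injective, ← map_mul_eq, hC]
    exact le_inf hL hL'
  fin := hc.fin

theorem exists_push (u : Ack A) (g : V ≃ₗ[K] V) {B C L : Submodule K V}
    (hB : A.map (g : V →ₗ[K] V) = B) (hC : A.map ((g * u.f : V ≃ₗ[K] V) : V →ₗ[K] V) = C)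
    (hL : L ≤ B) (hL' : L ≤ C) (hc : Commens B L) (hc' : Commens C L) :
    ∃ x : DetIso B C L, IsPush g u.x x :=
  exists_isPush (u.pushOK_left hB hL (hC ▸ hL') hc) (u.pushOK_right hC (hB ▸ hL) hL' hc') _

theorem ext_push {u v : Ack A} (hf : u.f = v.f) {B L : Submodule K V} (x : DetIso A B L)
    (hB : A.map (u.f : V →ₗ[K] V) = B) (hL : L ≤ A) (hL' : L ≤ B) (hc : Commens A L)
    (hc' : Commens B L) (hu : IsPush 1 u.x x) (hv : IsPush 1 v.x x) : u = v := by
  obtain ⟨f, h1, x1⟩ := u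
  obtain ⟨f', h2, x2⟩ := v
  obtain rfl : f = f' := hf
  have h1A : A.map ((1 : V ≃ₗ[K] V) : V →ₗ[K] V) = A := Submodule.map_id A
  have := IsPush.eq_left (pushOK_left ⟨f, h1, x1⟩ h1A hL (by rw [one_mul, hB]; exact hL') hc)
    (pushOK_right ⟨f, h1, x1⟩ (by rw [one_mul, hB]) (by rw [h1A]; exact hL) hL' hc') hu hv
  subst this
  rfl

theorem commens_mul (u v : Ack A) :
    Commens A (A.map ((u.f * v.f : V ≃ₗ[K] V) : V →ₗ[K] V)) := by
  rw [map_mul_eq]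
  exact u.comm.trans (v.comm.map _)

theorem exists_mul (u v : Ack A) :
    ∃ z : DetIso A (A.map ((u.f * v.f : V ≃ₗ[K] V) : V →ₗ[K] V))
        (A ⊓ A.map ((u.f * v.f : V ≃ₗ[K] V) : V →ₗ[K] V)),
      ∃ (x : DetIso A (A.map (u.f : V →ₗ[K] V)) (A ⊓ A.map (u.f : V →ₗ[K] V) ⊓
          A.map ((u.f * v.f : V ≃ₗ[K] V) : V →ₗ[K] V)))
        (y : DetIso (A.map (u.f : V →ₗ[K] V))
          (A.map ((u.f * v.f : V ≃ₗ[K] V) : V →ₗ[K] V)) (A ⊓ A.map (u.f : V →ₗ[K] V) ⊓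
          A.map ((u.f * v.f : V ≃ₗ[K] V) : V →ₗ[K] V))),
        IsPush 1 u.x x ∧ IsPush u.f v.x y ∧ IsPush 1 z (x.trans y) := by
  have h1A : A.map ((1 : V ≃ₗ[K] V) : V →ₗ[K] V) = A := Submodule.map_id A
  have hA : Commens A (A ⊓ A.map (u.f : V →ₗ[K] V) ⊓
      A.map ((u.f * v.f : V ≃ₗ[K] V) : V →ₗ[K] V)) :=
    ((Commens.refl A).inf u.comm).inf (commens_mul u v)
  have l1 : (A ⊓ A.map (u.f : V →ₗ[K] V) ⊓
      A.map ((u.f * v.f : V ≃ₗ[K] V) : V →ₗ[K] V)) ≤ A := inf_le_left.trans inf_le_left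
  have l2 : (A ⊓ A.map (u.f : V →ₗ[K] V) ⊓
      A.map ((u.f * v.f : V ≃ₗ[K] V) : V →ₗ[K] V)) ≤ A.map (u.f : V →ₗ[K] V) :=
    inf_le_left.trans inf_le_right
  obtain ⟨x, hx⟩ := u.exists_push 1 h1A (by rw [one_mul]) l1 l2 hA (u.comm.symm.trans hA)
  obtain ⟨y, hy⟩ := v.exists_push u.f rfl rfl l2 inf_le_right (u.comm.symm.trans hA)
    ((commens_mul u v).symm.trans hA)
  obtain ⟨z, hz⟩ := exists_isPush_left (g := 1) (A := A)
    (B := A.map ((u.f * v.f : V ≃ₗ[K] V) : V →ₗ[K] V))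
    (L := A ⊓ A.map ((u.f * v.f : V ≃ₗ[K] V) : V →ₗ[K] V))
    ⟨h1A, inf_le_left, (le_inf l1 inf_le_right).trans (Submodule.map_id _).ge, hA.fin⟩
    ⟨Submodule.map_id _, inf_le_right, (le_inf l1 inf_le_right).trans (Submodule.map_id _).ge,
      ((commens_mul u v).symm.trans hA).fin⟩ (x.trans y)
  exact ⟨z, x, y, hx, hy, hz⟩

/-- The product of `(f, x)` and `(h, y)` is `(f h, x · f y)`, where `x · f y` is the image of
`x ⊗ f y` under the contraction `(A | fA) ⊗ (fA | fhA) → (A | fhA)`. The contraction is computed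
in a common sublattice `L` of `A`, `fA` and `fhA`, as the composition of `x : ⋀ A/L → ⋀ fA/L` and
`f y : ⋀ fA/L → ⋀ fhA/L`. -/
instance : Mul (Ack A) where
  mul u v := ⟨u.f * v.f, commens_mul u v, (exists_mul u v).choose⟩

theorem mul_f (u v : Ack A) : (u * v).f = u.f * v.f := rfl

theorem mul_push (u v : Ack A) {g : V ≃ₗ[K] V} {B C D L : Submodule K V}
    {x : DetIso B C L} {y : DetIso C D L} (hB : A.map (g : V →ₗ[K] V) = B)
    (hC : A.map ((g * u.f : V ≃ₗ[K] V) : V →ₗ[K] V) = C)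
    (hD : A.map ((g * u.f * v.f : V ≃ₗ[K] V) : V →ₗ[K] V) = D)
    (lB : L ≤ B) (lC : L ≤ C) (lD : L ≤ D) (hc : Commens B L)
    (hx : IsPush g u.x x) (hy : IsPush (g * u.f) v.x y) : IsPush g (u * v).x (x.trans y) := by
  have h1A : A.map ((1 : V ≃ₗ[K] V) : V →ₗ[K] V) = A := Submodule.map_id A
  let L0 := A ⊓ A.map (u.f : V →ₗ[K] V) ⊓ A.map ((u.f * v.f : V ≃ₗ[K] V) : V →ₗ[K] V)
  have hL0 : L0 = A ⊓ A.map (u.f : V →ₗ[K] V) ⊓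
    A.map ((u.f * v.f : V ≃ₗ[K] V) : V →ₗ[K] V) := rfl
  obtain ⟨x0, y0, hx0, hy0, hz0⟩ := (exists_mul u v).choose_spec
  have hA : Commens A L0 := ((Commens.refl A).inf u.comm).inf (commens_mul u v)
  have l1 : L0 ≤ A := inf_le_left.trans inf_le_left
  have l2 : L0 ≤ A.map (u.f : V →ₗ[K] V) := inf_le_left.trans inf_le_right
  have l3 : L0 ≤ A.map ((u.f * v.f : V ≃ₗ[K] V) : V →ₗ[K] V) := inf_le_right
  have hCB : Commens C B := by
    rw [← hB, ← hC, map_mul_eq]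
    exact (u.comm.map _).symm
  have hDB : Commens D B := by
    rw [← hB, ← hD, mul_assoc, map_mul_eq]
    exact ((commens_mul u v).map _).symm
  have hl : L ≤ L0.map (g : V →ₗ[K] V) := by
    rw [hL0, Submodule.map_inf _ g.injective, Submodule.map_inf _ g.injective, ← map_mul_eq,
      ← map_mul_eq, ← mul_assoc, hB, hC, hD]
    exact le_inf (le_inf lB lC) lD
  have p1 : PushOK g A L0 B L := ⟨hB, l1, hl, hc.fin⟩
  have p2 : PushOK g (A.map (u.f : V →ₗ[K] V)) L0 C L :=
    ⟨by rw [← map_mul_eq, hC], l2, hl, (hCB.trans hc).fin⟩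
  have p3 : PushOK g (A.map ((u.f * v.f : V ≃ₗ[K] V) : V →ₗ[K] V)) L0 D L :=
    ⟨by rw [← map_mul_eq, ← mul_assoc, hD], l3, hl, (hDB.trans hc).fin⟩
  obtain ⟨x1, hx1⟩ := exists_isPush p1 p2 x0
  obtain ⟨y1, hy1⟩ := exists_isPush p2 p3 y0
  have q1 : PushOK 1 A (A ⊓ A.map (u.f : V →ₗ[K] V)) A L0 :=
    u.pushOK_left h1A l1 (by rw [one_mul]; exact l2) hA
  have e1 : x1 = x := by
    have := IsPush.comp q1 p1 hx0 hx1
    rw [mul_one] at this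
    exact IsPush.eq_right (u.pushOK_left hB lB (hC ▸ lC) hc) this hx
  have q2 : PushOK u.f A (A ⊓ A.map (v.f : V →ₗ[K] V)) (A.map (u.f : V →ₗ[K] V)) L0 :=
    v.pushOK_left rfl l2 l3 (u.comm.symm.trans hA)
  have e2 : y1 = y := IsPush.eq_right (v.pushOK_left hC lC (hD ▸ lD) (hCB.trans hc))
    (IsPush.comp q2 p2 hy0 hy1) hy
  subst e1 e2
  have q3 : PushOK 1 A (A ⊓ A.map ((u.f * v.f : V ≃ₗ[K] V) : V →ₗ[K] V)) A L0 :=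
    (u * v).pushOK_left h1A l1 (by rw [one_mul]; exact l3) hA
  have := IsPush.comp q3 p1 hz0 (IsPush.trans p1 hx1 hy1)
  rwa [mul_one] at this

/-- The canonical element over an automorphism `f` with `fA = A`. -/
def triv (f : V ≃ₗ[K] V) (h : A.map (f : V →ₗ[K] V) = A) : Ack A :=
  ⟨f, h.symm ▸ Commens.refl A, DetIso.ofEq h.symm⟩

theorem map_one_eq (B : Submodule K V) :
    B.map ((1 : V ≃ₗ[K] V) : V →ₗ[K] V) = B := Submodule.map_id B

theorem triv_push (f : V ≃ₗ[K] V) (h : A.map (f : V →ₗ[K] V) = A) {g : V ≃ₗ[K] V}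
    {B C L : Submodule K V} (hB : A.map (g : V →ₗ[K] V) = B) (hBC : B = C) (hL : L ≤ B)
    (hc : Commens B L) : IsPush g (triv f h).x (DetIso.ofEq hBC : DetIso B C L) :=
  isPush_ofEq ((triv f h).pushOK_left hB hL
    (by rw [map_mul_eq]; change L ≤ (A.map (f : V →ₗ[K] V)).map _; rwa [h, hB]) hc) _ _

instance : One (Ack A) where
  one := triv 1 (map_one_eq A)

theorem one_f : (1 : Ack A).f = 1 := rfl

theorem exists_inv (u : Ack A) :
    ∃ x : DetIso A (A.map ((u.f⁻¹ : V ≃ₗ[K] V) : V →ₗ[K] V))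
        (A ⊓ A.map ((u.f⁻¹ : V ≃ₗ[K] V) : V →ₗ[K] V)), IsPush u.f⁻¹ u.x.symm x := by
  have h : (A.map (u.f : V →ₗ[K] V)).map ((u.f⁻¹ : V ≃ₗ[K] V) : V →ₗ[K] V) = A := by
    rw [← map_mul_eq, inv_mul_cancel, map_one_eq]
  have hc : Commens A (A.map ((u.f⁻¹ : V ≃ₗ[K] V) : V →ₗ[K] V)) := by
    have := u.comm.map ((u.f⁻¹ : V ≃ₗ[K] V) : V →ₗ[K] V)
    rw [h] at this
    exact this.symm
  have hl : A ⊓ A.map ((u.f⁻¹ : V ≃ₗ[K] V) : V →ₗ[K] V) ≤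
      (A ⊓ A.map (u.f : V →ₗ[K] V)).map ((u.f⁻¹ : V ≃ₗ[K] V) : V →ₗ[K] V) := by
    rw [Submodule.map_inf _ (u.f⁻¹).injective, h, inf_comm]
  exact exists_isPush ⟨h, inf_le_right, hl, hc.1⟩ ⟨rfl, inf_le_left, hl, hc.2⟩ _

/-- The inverse of `(f, x)` is `(f⁻¹, f⁻¹ x⁻¹)`, where `x⁻¹ ∈ (fA | A)` is the dual of `x`. -/
instance : Inv (Ack A) where
  inv u := ⟨u.f⁻¹, by
    have h := u.comm.map ((u.f⁻¹ : V ≃ₗ[K] V) : V →ₗ[K] V)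
    rw [← map_mul_eq, inv_mul_cancel, map_one_eq] at h
    exact h.symm, (exists_inv u).choose⟩

theorem inv_f (u : Ack A) : (u⁻¹).f = u.f⁻¹ := rfl

theorem mul_assoc' (u v w : Ack A) : u * v * w = u * (v * w) := by
  set B := A.map (u.f : V →ₗ[K] V) with hB
  set C := A.map ((u.f * v.f : V ≃ₗ[K] V) : V →ₗ[K] V) with hC
  set D := A.map ((u.f * v.f * w.f : V ≃ₗ[K] V) : V →ₗ[K] V) with hD
  set L := A ⊓ B ⊓ C ⊓ D with hL
  have lA : L ≤ A := (inf_le_left.trans inf_le_left).trans inf_le_left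
  have lB : L ≤ B := (inf_le_left.trans inf_le_left).trans inf_le_right
  have lC : L ≤ C := inf_le_left.trans inf_le_right
  have lD : L ≤ D := inf_le_right
  have cB : Commens A B := u.comm
  have cC : Commens A C := commens_mul u v
  have cD : Commens A D := commens_mul (u * v) w
  have cL : Commens A L := (((Commens.refl A).inf cB).inf cC).inf cD
  obtain ⟨x, hx⟩ := u.exists_push 1 (map_one_eq A) (by rw [one_mul]) lA lB cL
    (cB.symm.trans cL)
  obtain ⟨y, hy⟩ := v.exists_push u.f rfl rfl lB lC (cB.symm.trans cL) (cC.symm.trans cL)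
  obtain ⟨z, hz⟩ := w.exists_push (u.f * v.f) rfl rfl lC lD (cC.symm.trans cL)
    (cD.symm.trans cL)
  have h1 : IsPush 1 (u * v).x (x.trans y) :=
    mul_push u v (map_one_eq A) (by rw [one_mul]) (by rw [one_mul]) lA lB lC cL hx
      (by rwa [one_mul])
  have h2 : IsPush 1 (u * v * w).x ((x.trans y).trans z) :=
    mul_push (u * v) w (map_one_eq A) (by rw [one_mul]; rfl) (by rw [one_mul]; rfl) lA lC lD cL
      h1 (by rwa [one_mul])
  have h3 : IsPush u.f (v * w).x (y.trans z) :=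
    mul_push v w rfl rfl rfl lB lC lD (cB.symm.trans cL) hy hz
  have h4 : IsPush 1 (u * (v * w)).x (x.trans (y.trans z)) :=
    mul_push u (v * w) (map_one_eq A) (by rw [one_mul])
      (by rw [one_mul, mul_f, ← mul_assoc]) lA lB lD cL hx (by rwa [one_mul])
  exact ext_push (mul_assoc _ _ _) _ rfl lA lD cL (cD.symm.trans cL) h2 h4

theorem one_mul' (u : Ack A) : 1 * u = u := by
  have cL : Commens A (A ⊓ A.map (u.f : V →ₗ[K] V)) := (Commens.refl A).inf u.comm
  obtain ⟨x, hx⟩ := u.exists_push 1 (map_one_eq A) (by rw [one_mul])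
    (inf_le_left : A ⊓ A.map (u.f : V →ₗ[K] V) ≤ A) inf_le_right cL (u.comm.symm.trans cL)
  have h1 : IsPush 1 (1 : Ack A).x (DetIso.ofEq rfl : DetIso A A (A ⊓ A.map (u.f : V →ₗ[K] V))) :=
    triv_push 1 _ (map_one_eq A) rfl inf_le_left cL
  have h2 : IsPush 1 (1 * u).x ((DetIso.ofEq rfl : DetIso A A _).trans x) :=
    mul_push 1 u (map_one_eq A) (map_one_eq A) (by rw [one_f, one_mul, one_mul]) inf_le_left
      inf_le_left inf_le_right cL h1 hx
  exact ext_push (one_mul _) x (by rw [mul_f, one_f, one_mul]) inf_le_left inf_le_right cL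
    (u.comm.symm.trans cL) h2 hx

theorem inv_mul' (u : Ack A) : u⁻¹ * u = 1 := by
  set B := A.map ((u.f⁻¹ : V ≃ₗ[K] V) : V →ₗ[K] V) with hB
  have cB : Commens A B := (u⁻¹).comm
  have cL : Commens A (A ⊓ B) := (Commens.refl A).inf cB
  have hu : A.map ((u.f⁻¹ * u.f : V ≃ₗ[K] V) : V →ₗ[K] V) = A := by
    rw [inv_mul_cancel, map_one_eq]
  obtain ⟨p, hp⟩ := (u⁻¹).exists_push 1 (map_one_eq A) (by rw [one_mul, inv_f])
    (inf_le_left : A ⊓ B ≤ A) inf_le_right cL (cB.symm.trans cL)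
  obtain ⟨q, hq⟩ := u.exists_push u.f⁻¹ rfl hu (inf_le_right : A ⊓ B ≤ B) inf_le_left
    (cB.symm.trans cL) cL
  have ok : PushOK u.f⁻¹ A (A ⊓ A.map (u.f : V →ₗ[K] V)) B (A ⊓ B) :=
    u.pushOK_left rfl inf_le_right (by rw [hu]; exact inf_le_left) (cB.symm.trans cL)
  have ok' : PushOK u.f⁻¹ (A.map (u.f : V →ₗ[K] V)) (A ⊓ A.map (u.f : V →ₗ[K] V)) A (A ⊓ B) :=
    u.pushOK_right hu inf_le_right inf_le_left cL
  have h1 : IsPush (1 * u.f⁻¹) u.x.symm p :=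
    IsPush.comp (L' := A ⊓ B) (A' := A) ok'
      ⟨map_one_eq A, inf_le_left, (map_one_eq _).ge, cL.fin⟩ (exists_inv u).choose_spec hp
  rw [one_mul] at h1
  have h2 : p = q.symm := IsPush.eq_right ok' h1 (IsPush.symm ok hq)
  subst h2
  have h3 : IsPush 1 (u⁻¹ * u).x (q.symm.trans q) :=
    mul_push u⁻¹ u (map_one_eq A) (by rw [one_mul, inv_f]) (by rw [one_mul, inv_f, hu])
      inf_le_left inf_le_right inf_le_left cL hp (by rwa [one_mul, inv_f])
  have h4 : IsPush 1 (1 : Ack A).x (q.symm.trans q) := by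
    rw [LinearEquiv.symm_trans_self]
    exact triv_push 1 _ (map_one_eq A) rfl inf_le_left cL
  exact ext_push (inv_mul_cancel _) _ (by rw [mul_f, inv_f, hu]) inf_le_left inf_le_left cL cL
    h3 h4

instance : Group (Ack A) :=
  Group.ofLeftAxioms mul_assoc' one_mul' inv_mul'

/-- The projection `(f, x) ↦ f`. -/
def proj : Ack A →* (V ≃ₗ[K] V) where
  toFun := f
  map_one' := rfl
  map_mul' _ _ := rfl

theorem triv_mul (f f' : V ≃ₗ[K] V) (h : A.map (f : V →ₗ[K] V) = A)
    (h' : A.map (f' : V →ₗ[K] V) = A) (h'' : A.map ((f * f' : V ≃ₗ[K] V) : V →ₗ[K] V) = A) :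
    triv (f * f') h'' = triv f h * triv f' h' := by
  refine ext_push rfl (B := A) (L := A) (DetIso.ofEq rfl) h'' le_rfl le_rfl (Commens.refl A)
    (Commens.refl A) (triv_push _ _ (map_one_eq A) rfl le_rfl (Commens.refl A)) ?_
  exact mul_push (x := DetIso.ofEq rfl) (y := DetIso.ofEq rfl) _ _ (map_one_eq A)
    (by rw [one_mul]; exact h) (by rw [one_mul]; exact h'') le_rfl le_rfl le_rfl (Commens.refl A)
    (triv_push _ _ (map_one_eq A) rfl le_rfl (Commens.refl A))
    (triv_push _ _ (by rw [one_mul]; exact h) rfl le_rfl (Commens.refl A))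

/-- The element `c` of the line `(A | A) = K`, over the identity. -/
def scal (c : Kˣ) : Ack A :=
  ⟨1, (map_one_eq A).symm ▸ Commens.refl A,
    (LinearEquiv.smulOfUnit c : DetIso A A _).trans (DetIso.ofEq (map_one_eq A).symm)⟩

theorem scal_push (c : Kˣ) {g : V ≃ₗ[K] V} {B L : Submodule K V}
    (hB : A.map (g : V →ₗ[K] V) = B) (hL : L ≤ B) (hc : Commens B L) :
    IsPush g (scal c : Ack A).x (LinearEquiv.smulOfUnit c : DetIso B B L) := by
  have ok := (scal c : Ack A).pushOK_left (g := g) hB hL (by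
    change L ≤ A.map ((g * 1 : V ≃ₗ[K] V) : V →ₗ[K] V)
    rwa [mul_one, hB]) hc
  exact IsPush.trans (y' := DetIso.ofEq rfl) ok (isPush_smul ok c) (isPush_ofEq ok _ _)

theorem scal_mul_eq (c : Kˣ) (u : Ack A) :
    ∃ (x : DetIso A (A.map (u.f : V →ₗ[K] V)) (A ⊓ A.map (u.f : V →ₗ[K] V))),
      IsPush 1 u.x x ∧ IsPush 1 (scal c * u).x ((LinearEquiv.smulOfUnit c).trans x) ∧
        IsPush 1 (u * scal c).x (x.trans (LinearEquiv.smulOfUnit c)) := by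
  have cL : Commens A (A ⊓ A.map (u.f : V →ₗ[K] V)) := (Commens.refl A).inf u.comm
  obtain ⟨x, hx⟩ := u.exists_push 1 (map_one_eq A) (by rw [one_mul])
    (inf_le_left : A ⊓ A.map (u.f : V →ₗ[K] V) ≤ A) inf_le_right cL (u.comm.symm.trans cL)
  refine ⟨x, hx, ?_, ?_⟩
  · exact mul_push _ u (map_one_eq A) (map_one_eq A) rfl inf_le_left inf_le_left inf_le_right cL
      (scal_push c (map_one_eq A) inf_le_left cL) hx
  · exact mul_push u _ (map_one_eq A) rfl rfl inf_le_left inf_le_right inf_le_right cL hx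
      (scal_push c rfl inf_le_right (u.comm.symm.trans cL))

theorem scal_comm (c : Kˣ) (u : Ack A) : scal c * u = u * scal c := by
  have cL : Commens A (A ⊓ A.map (u.f : V →ₗ[K] V)) := (Commens.refl A).inf u.comm
  obtain ⟨x, hx, h1, h2⟩ := scal_mul_eq c u
  have e : (LinearEquiv.smulOfUnit c).trans x = x.trans (LinearEquiv.smulOfUnit c) :=
    LinearEquiv.ext fun a => x.map_smul (c : K) a
  rw [e] at h1
  exact ext_push ((one_mul _).trans (mul_one _).symm) _ rfl inf_le_left inf_le_right cL
    (u.comm.symm.trans cL) h1 h2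

/-- The inclusion `Kˣ → Ack A`, with central image. -/
def scalHom : Kˣ →* Ack A where
  toFun := scal
  map_one' := by
    refine ext_push rfl (B := A) (L := A) (DetIso.ofEq rfl) (map_one_eq A) le_rfl le_rfl
      (Commens.refl A) (Commens.refl A) ?_
      (triv_push _ _ (map_one_eq A) rfl le_rfl (Commens.refl A))
    have := scal_push (1 : Kˣ) (map_one_eq A) le_rfl (Commens.refl A)
    rwa [show (LinearEquiv.smulOfUnit (1 : Kˣ) : DetIso A A A) = DetIso.ofEq rfl from
      LinearEquiv.ext fun a => one_smul K a] at this
  map_mul' c d := by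
    refine ext_push (mul_one _).symm (B := A) (L := A) (LinearEquiv.smulOfUnit (c * d))
      (map_one_eq A) le_rfl le_rfl (Commens.refl A) (Commens.refl A)
      (scal_push _ (map_one_eq A) le_rfl (Commens.refl A)) ?_
    have := mul_push (scal c) (scal d) (map_one_eq A) (map_one_eq A) (map_one_eq A) le_rfl le_rfl
      le_rfl (Commens.refl A) (scal_push c (map_one_eq A) le_rfl (Commens.refl A))
      (scal_push d (map_one_eq A) le_rfl (Commens.refl A))
    rwa [show (LinearEquiv.smulOfUnit c : DetIso A A A).trans (LinearEquiv.smulOfUnit d) =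
      LinearEquiv.smulOfUnit (c * d) from LinearEquiv.ext fun a => by
        change (d : K) • (c : K) • a = ((c * d : Kˣ) : K) • a
        rw [smul_smul, Units.val_mul, mul_comm]] at this

theorem triv_one {f : V ≃ₗ[K] V} (h : A.map (f : V →ₗ[K] V) = A) (hf : f = 1) :
    triv f h = 1 := by
  subst hf; rfl

theorem triv_mul' {f f' f'' : V ≃ₗ[K] V} (h : A.map (f : V →ₗ[K] V) = A)
    (h' : A.map (f' : V →ₗ[K] V) = A) (h'' : A.map (f'' : V →ₗ[K] V) = A) (e : f'' = f * f') :
    triv f'' h'' = triv f h * triv f' h' := by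
  subst e
  exact triv_mul f f' h h' h''

/-- `u` is the canonical element over an automorphism `f` with `fA = A`. -/
def IsTriv (u : Ack A) : Prop :=
  ∃ h : A.map (u.f : V →ₗ[K] V) = A, u = triv u.f h

end Ack

end DeterminantLines

/-! ### Lattices over a discretely valued field -/

section Local

open WithZero Matrix

variable (K : Type*) [Field K] {F : Type*} [Field F] [Algebra K F] (v : Valuation F ℤᵐ⁰) (r : ℕ)

/-- The valuation `v` is trivial on the field of constants `K`. -/
class IntegralConstants : Prop where
  le_one : ∀ c : K, v (algebraMap K F c) ≤ 1

variable [IntegralConstants K v]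

/-- The fractional ideal `𝔭^n` of the valuation ring `𝒪`, as a `K`-subspace of `F`. -/
def lat1 (n : ℤ) : Submodule K F where
  carrier := {x | v x ≤ exp (-n)}
  add_mem' {x y} hx hy := (v.map_add x y).trans (max_le hx hy)
  zero_mem' := by simp
  smul_mem' c x hx := by
    change v (c • x) ≤ _
    rw [Algebra.smul_def, map_mul]
    exact (mul_le_of_le_one_left' (IntegralConstants.le_one c)).trans hx

/-- The lattice `(𝔭^n)^r`, as a `K`-subspace of `F^r`; for `n = 0` this is `𝒪^r`. -/
def lat (n : ℤ) : Submodule K (Fin r → F) :=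
  Submodule.pi Set.univ fun _ => lat1 K v n

variable (F) in
/-- The action of `GL_1(F)` on `F` by multiplication. -/
def act1 : Fˣ →* (F ≃ₗ[K] F) := DistribMulAction.toModuleAut K F

variable (F) in
/-- The action of `GL_r(F)` on `F^r`. -/
def act : GL (Fin r) F →* ((Fin r → F) ≃ₗ[K] (Fin r → F)) where
  toFun g := (LinearMap.GeneralLinearGroup.generalLinearEquiv F _
    (GeneralLinearGroup.toLin g)).restrictScalars K
  map_one' := by rw [map_one, map_one]; rfl
  map_mul' g h := by rw [map_mul, map_mul]; rfl

variable {K r} in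
theorem act_apply (g : GL (Fin r) F) (x : Fin r → F) : act K F r g x = (g : Matrix _ _ F) *ᵥ x :=
  rfl

variable {r} in
/-- The map `GL_r(𝒪) → GL_r(F)`. -/
abbrev ofInt : GL (Fin r) v.integer →* GL (Fin r) F :=
  GeneralLinearGroup.map v.integer.subtype

variable {r} in
theorem act_ofInt_le (h : GL (Fin r) v.integer) :
    (lat K v r 0).map (act K F r (ofInt v h) : (Fin r → F) →ₗ[K] (Fin r → F)) ≤ lat K v r 0 := by
  rintro _ ⟨x, hx, rfl⟩
  rw [SetLike.mem_coe] at hx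
  simp only [lat, Submodule.mem_pi, Set.mem_univ, true_imp_iff] at hx ⊢
  intro i
  change ∑ j, (h i j : F) * x j ∈ lat1 K v 0
  refine (lat1 K v 0).sum_mem fun j _ => ?_
  have h1 : v (x j) ≤ exp (-0) := hx j
  have h2 : v (h i j : F) ≤ 1 := (h i j).2
  change v ((h i j : F) * x j) ≤ exp (-0)
  rw [map_mul]
  exact (mul_le_of_le_one_left' h2).trans h1

variable {r} in
theorem act_ofInt (h : GL (Fin r) v.integer) :
    (lat K v r 0).map (act K F r (ofInt v h) : (Fin r → F) →ₗ[K] (Fin r → F)) = lat K v r 0 := by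
  refine le_antisymm (act_ofInt_le K v h) ?_
  have := Submodule.map_mono (f := (act K F r (ofInt v h) : (Fin r → F) →ₗ[K] (Fin r → F)))
    (act_ofInt_le K v h⁻¹)
  rwa [← map_mul_eq, ← map_mul, ← map_mul, mul_inv_cancel, map_one, map_one, Ack.map_one_eq] at this

theorem act1_int_le (u : (v.integer)ˣ) :
    (lat1 K v 0).map (act1 K F (Units.map v.integer.subtype u) : F →ₗ[K] F) ≤ lat1 K v 0 := by
  rintro _ ⟨x, hx, rfl⟩
  have h1 : v x ≤ exp (-0) := hx
  have h2 : v (u : F) ≤ 1 := u.1.2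
  change v ((u : F) * x) ≤ exp (-0)
  rw [map_mul]
  exact (mul_le_of_le_one_left' h2).trans h1

theorem act1_int (u : (v.integer)ˣ) :
    (lat1 K v 0).map (act1 K F (Units.map v.integer.subtype u) : F →ₗ[K] F) = lat1 K v 0 := by
  refine le_antisymm (act1_int_le K v u) ?_
  have := Submodule.map_mono (f := (act1 K F (Units.map v.integer.subtype u) : F →ₗ[K] F))
    (act1_int_le K v u⁻¹)
  rwa [← map_mul_eq, ← map_mul, ← map_mul, mul_inv_cancel, map_one, map_one, Ack.map_one_eq] at this

/-! ### The geometric metaplectic extension of a local field -/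

/-- Triples `(g, x, y)` with `g ∈ GL_r(F)`, `0 ≠ x ∈ D_{det g} = (𝒪 | det(g) 𝒪)` and
`0 ≠ y ∈ D_g = (𝒪^r | g 𝒪^r)`. -/
def fibre : Subgroup (GL (Fin r) F × Ack (lat1 K v 0) × Ack (lat K v r 0)) where
  carrier := {p | Ack.proj p.2.1 = act1 K F (GeneralLinearGroup.det p.1) ∧
    Ack.proj p.2.2 = act K F r p.1}
  one_mem' := ⟨by simp, by simp⟩
  mul_mem' {p q} hp hq := ⟨by
    rw [Prod.snd_mul, Prod.fst_mul, Prod.fst_mul, map_mul, map_mul, map_mul, hp.1, hq.1], by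
    rw [Prod.snd_mul, Prod.snd_mul, Prod.fst_mul, map_mul, map_mul, hp.2, hq.2]⟩
  inv_mem' {p} hp := ⟨by
    rw [Prod.snd_inv, Prod.fst_inv, Prod.fst_inv, map_inv, map_inv, map_inv, hp.1], by
    rw [Prod.snd_inv, Prod.snd_inv, Prod.fst_inv, map_inv, map_inv, hp.2]⟩

/-- The scalars `c ∈ Kˣ`, acting on `D_{det g}`. -/
def fibreι : Kˣ →* fibre K v r where
  toFun c := ⟨(1, Ack.scalHom c, 1), by
    refine ⟨?_, by simp⟩
    simp only [map_one]
    rfl⟩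
  map_one' := Subtype.ext (by simp)
  map_mul' c d := Subtype.ext (by simp)

/-- The triples `(1, c, c)` with `c ∈ Kˣ`. -/
def antidiag : Subgroup (fibre K v r) where
  carrier := {p | ∃ c : Kˣ, p.1 = (1, Ack.scalHom c, Ack.scalHom c)}
  one_mem' := ⟨1, by rw [map_one, map_one]; rfl⟩
  mul_mem' := by
    rintro p q ⟨c, hc⟩ ⟨d, hd⟩
    exact ⟨c * d, by rw [Subgroup.coe_mul, hc, hd, map_mul, map_mul]; simp⟩
  inv_mem' := by
    rintro p ⟨c, hc⟩
    exact ⟨c⁻¹, by rw [Subgroup.coe_inv, hc, map_inv, map_inv]; simp⟩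

instance : (antidiag K v r).Normal where
  conj_mem := by
    rintro p ⟨c, hc⟩ q
    refine ⟨c, ?_⟩
    rw [Subgroup.coe_mul, Subgroup.coe_mul, Subgroup.coe_inv, hc]
    refine Prod.ext (by simp) (Prod.ext ?_ ?_)
    · change q.1.2.1 * Ack.scal c * (q.1.2.1)⁻¹ = Ack.scal c
      rw [← Ack.scal_comm, mul_inv_cancel_right]
    · change q.1.2.2 * Ack.scal c * (q.1.2.2)⁻¹ = Ack.scal c
      rw [← Ack.scal_comm, mul_inv_cancel_right]

/-- The geometric metaplectic group: pairs `(g, δ)` where `g ∈ GL_r(F)` and `δ` is a non-zero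
element of the line `Δ_g = D_{det g} ⊗ D_g^{-1}`, the class of a triple `(g, x, y)` being
`(g, x ⊗ y^{-1})`. It is the Baer difference of the pull-back by `det` of the extension of
`GL_1(F)` by `Kˣ` and of the extension of `GL_r(F)` by `Kˣ` given by the lines `D`. -/
def Geo : Type _ := fibre K v r ⧸ antidiag K v r

namespace Geo

instance : Group (Geo K v r) := inferInstanceAs (Group (fibre K v r ⧸ antidiag K v r))

/-- The class of a triple. -/
def mk : fibre K v r →* Geo K v r := QuotientGroup.mk' _

/-- The inclusion of the scalars. -/
def ι : Kˣ →* Geo K v r := (mk K v r).comp (fibreι K v r)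

/-- The projection `(g, δ) ↦ g`. -/
def proj : Geo K v r →* GL (Fin r) F :=
  QuotientGroup.lift (antidiag K v r) ((MonoidHom.fst _ _).comp (fibre K v r).subtype) (by
    rintro p ⟨c, hc⟩
    simp [hc])

/-- The canonical splitting over `GL_r(𝒪)`, given by the identifications `Δ_g = K` for
`g ∈ GL_r(𝒪)`. -/
def triv : GL (Fin r) v.integer →* Geo K v r := (mk K v r).comp
  { toFun := fun h => ⟨(ofInt v h, Ack.triv _ (act1_int K v (GeneralLinearGroup.det h)),
      Ack.triv _ (act_ofInt K v h)), by
        refine ⟨?_, rfl⟩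
        exact congrArg (act1 K F) (GeneralLinearGroup.map_det _ h).symm⟩
    map_one' := Subtype.ext (Prod.ext (map_one _)
      (Prod.ext (Ack.triv_one (act1_int K v _) (by simp)) (Ack.triv_one (act_ofInt K v _) (by simp))))
    map_mul' := fun h h' => Subtype.ext (Prod.ext (map_mul (ofInt v) h h')
      (Prod.ext (Ack.triv_mul' (act1_int K v _) (act1_int K v _) (act1_int K v _) (by simp)) (Ack.triv_mul' (act_ofInt K v _) (act_ofInt K v _) (act_ofInt K v _) (by simp)))) }

theorem proj_triv (h : GL (Fin r) v.integer) : proj K v r (triv K v r h) = ofInt v h := rfl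

theorem proj_ι (c : Kˣ) : proj K v r (ι K v r c) = 1 := rfl

theorem ι_comm (c : Kˣ) (e : Geo K v r) : ι K v r c * e = e * ι K v r c := by
  obtain ⟨p, rfl⟩ := QuotientGroup.mk'_surjective _ e
  change mk K v r (fibreι K v r c * p) = mk K v r (p * fibreι K v r c)
  congr 1
  refine Subtype.ext (Prod.ext (by simp [fibreι]) (Prod.ext ?_ (by simp [fibreι])))
  exact Ack.scal_comm c p.1.2.1

end Geo

/-! ### The section `g ↦ δ_g` -/

/-- `x ∈ D_n`, for an upper unipotent matrix `n`, is the canonical basis vector `𝔡_n`: for some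
lattice `M ⊆ 𝒪^r` with `nM = M`, it is the isomorphism `⋀ 𝒪^r/M → ⋀ n𝒪^r/M` induced by `n`, i.e.
it corresponds to `1 ∈ (M | nM) = K`. -/
def IsUnipotentLift (x : Ack (lat K v r 0)) : Prop :=
  ∃ M : Submodule K (Fin r → F), (∀ a : F, v a ≤ 1 → ∀ m ∈ M, a • m ∈ M) ∧ M ≤ lat K v r 0 ∧
    FiniteDimensional K (Quo (lat K v r 0) M) ∧
    M.map (x.f : (Fin r → F) →ₗ[K] (Fin r → F)) = M ∧
    ∃ y : DetIso (lat K v r 0) ((lat K v r 0).map (x.f : (Fin r → F) →ₗ[K] (Fin r → F))) M,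
      IsPush 1 x.x y ∧
      ∃ s : ((Fin r → F) ⧸ M) →ₗ[K] ((Fin r → F) ⧸ M), (∀ m, s (M.mkQ m) = M.mkQ (x.f m)) ∧
        ∀ a, inc (y a) = ExteriorAlgebra.map s (inc a)

/-- The inclusion of the `i`-th factor `F/𝔭^n → F^r/(𝔭^n)^r`. -/
def single (n : ℤ) (i : Fin r) : (F ⧸ lat1 K v n) →ₗ[K] ((Fin r → F) ⧸ lat K v r n) :=
  Submodule.mapQ _ _ (LinearMap.single K (fun _ => F) i) (by
    intro x hx
    simp only [lat, Submodule.mem_comap, Submodule.mem_pi, Set.mem_univ, true_imp_iff]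
    intro j
    by_cases h : j = i
    · subst h; simpa using hx
    · simp [h])

/-- For a diagonal matrix `t = (t_1, …, t_r)`, the element `c ∈ D_t` corresponds to
`y_1 ⊗ ⋯ ⊗ y_r` under `D_t ≃ D_{t_1} ⊗ ⋯ ⊗ D_{t_r}`. With `n` even such that
`𝔭^n ⊆ 𝒪 ∩ t_i 𝒪` for all `i`, this isomorphism comes from the isomorphisms
`⨂ ⋀(𝒪/𝔭^n) → ⋀(𝒪^r/(𝔭^n)^r)` and `⨂ ⋀(t_i 𝒪/𝔭^n) → ⋀(t𝒪^r/(𝔭^n)^r)`,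
`ω_1 ⊗ ⋯ ⊗ ω_r ↦ ω_1 ∧ ⋯ ∧ ω_r`. -/
def IsDiagonalLift (y : Fin r → Ack (lat1 K v 0)) (c : Ack (lat K v r 0)) : Prop :=
  ∃ n : ℤ, Even n ∧ lat1 K v n ≤ lat1 K v 0 ∧
    (∀ i, lat1 K v n ≤ (lat1 K v 0).map ((y i).f : F →ₗ[K] F)) ∧
    ∃ (x : ∀ i, DetIso (lat1 K v 0) ((lat1 K v 0).map ((y i).f : F →ₗ[K] F)) (lat1 K v n))
      (z : DetIso (lat K v r 0)
        ((lat K v r 0).map (c.f : (Fin r → F) →ₗ[K] (Fin r → F))) (lat K v r n)),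
      (∀ i, IsPush 1 (y i).x (x i)) ∧ IsPush 1 c.x z ∧
      ∃ (ω : TopExt K (Quo (lat1 K v 0) (lat1 K v n)))
        (Ω : TopExt K (Quo (lat K v r 0) (lat K v r n))), ω ≠ 0 ∧
        inc Ω = (List.ofFn fun i => ExteriorAlgebra.map (single K v r n i) (inc ω)).prod ∧
        inc (z Ω) =
          (List.ofFn fun i => ExteriorAlgebra.map (single K v r n i) (inc (x i ω))).prod

/-- The degree `dim_K(𝒪 / (𝒪 ∩ u𝒪)) - dim_K(u𝒪 / (𝒪 ∩ u𝒪))`. It is `v(u)` if `K` is the residue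
field. -/
def deg (u : Fˣ) : ℤ :=
  (finrank K (Quo (lat1 K v 0)
    (lat1 K v 0 ⊓ (lat1 K v 0).map (act1 K F u : F →ₗ[K] F))) : ℤ) -
  finrank K (Quo ((lat1 K v 0).map (act1 K F u : F →ₗ[K] F))
    (lat1 K v 0 ⊓ (lat1 K v 0).map (act1 K F u : F →ₗ[K] F)))

variable {r} in
/-- The diagonal matrix with entries `t_1, …, t_r`. -/
def diagGL (t : Fin r → Fˣ) : GL (Fin r) F where
  val := diagonal fun i => (t i : F)
  inv := diagonal fun i => ((t i)⁻¹ : F)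
  val_inv := by simp
  inv_val := by simp

variable (F) {r} in
/-- Permutation matrices. -/
def permGL : Equiv.Perm (Fin r) →* GL (Fin r) F := permMatrixHom.toHomUnits

variable {r} in
/-- Upper triangular unipotent matrices. -/
def IsUnipotent (n : GL (Fin r) F) : Prop :=
  (∀ i, n i i = 1) ∧ ∀ i j, j < i → n i j = 0

/-- `e` is the canonical lift `(n, δ_n)` of an upper unipotent matrix `n`, with
`δ_n = 1 ⊗ 𝔡_n^{-1}`. -/
def IsUnipotentSection (n : GL (Fin r) F) (e : Geo K v r) : Prop :=
  ∃ p : fibre K v r, p.1.1 = n ∧ p.1.2.1 = 1 ∧ IsUnipotentLift K v r p.1.2.2 ∧ e = Geo.mk K v r p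

/-- `e` is the lift `(tw, δ_{tw})`, where `δ_{tw} : D_{tw} → D_{det(tw)}` is the composition of
`D_{tw} = D_t ≃ D_{t_1} ⊗ ⋯ ⊗ D_{t_r}`, of the multiplication
`y_1 ⊗ ⋯ ⊗ y_r ↦ y_r ⋯ y_1 ∈ D_{det t} = D_{det(tw)}`, and of the multiplication by
`(-1)^(∑ (r - i) v(t_i))`. The identification `D_t = D_{tw}` is the right multiplication by the
canonical basis vector of the line `D_w = K`, and similarly for `D_{det t} = D_{det(tw)}`. -/
def IsMonomialSection (t : Fin r → Fˣ) (w : Equiv.Perm (Fin r)) (e : Geo K v r) : Prop :=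
  ∃ (p : fibre K v r) (y : Fin r → Ack (lat1 K v 0)) (c : Ack (lat K v r 0))
    (a : Ack (lat1 K v 0)) (b : Ack (lat K v r 0)),
    (∀ i, Ack.proj (y i) = act1 K F (t i)) ∧ Ack.proj c = act K F r (diagGL t) ∧
    IsDiagonalLift K v r y c ∧
    a.IsTriv ∧ Ack.proj a = act1 K F (GeneralLinearGroup.det (permGL F w)) ∧
    b.IsTriv ∧ Ack.proj b = act K F r (permGL F w) ∧
    p.1 = (diagGL t * permGL F w,
      Ack.scalHom ((-1) ^ ∑ i : Fin r, ((r : ℤ) - ((i : ℤ) + 1)) * deg K v (t i)) *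
        (List.ofFn fun i => y i.rev).prod * a, c * b) ∧
    e = Geo.mk K v r p

/-- For `g = n t w n'`, `e` is the lift `(g, δ_g) = (n, δ_n) (tw, δ_{tw}) (n', δ_{n'})`. -/
def IsBruhatSection (n : GL (Fin r) F) (t : Fin r → Fˣ) (w : Equiv.Perm (Fin r))
    (n' : GL (Fin r) F) (e : Geo K v r) : Prop :=
  ∃ e₁ e₂ e₃, IsUnipotentSection K v r n e₁ ∧ IsMonomialSection K v r t w e₂ ∧
    IsUnipotentSection K v r n' e₃ ∧ e = e₁ * e₂ * e₃

variable {r} in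
/-- `g = n t w n'` is a Bruhat decomposition: `n` and `n'` are upper unipotent, `t` is diagonal
and `w` is a permutation matrix. -/
def IsBruhat (g n : GL (Fin r) F) (t : Fin r → Fˣ) (w : Equiv.Perm (Fin r))
    (n' : GL (Fin r) F) : Prop :=
  IsUnipotent n ∧ IsUnipotent n' ∧ g = n * diagGL t * permGL F w * n'

namespace Geo

/-- `e = (g, δ_g)`, computed from some Bruhat decomposition of `g`. -/
def IsSection (g : GL (Fin r) F) (e : Geo K v r) : Prop :=
  ∃ n t w n', IsBruhat g n t w n' ∧ IsBruhatSection K v r n t w n' e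

/-- The section `g ↦ (g, δ_g)`. -/
def sect (g : GL (Fin r) F) : Geo K v r := Classical.epsilon (IsSection K v r g)

/-- The function `κ` on `GL_r(𝒪)`: the canonical splitting of `g` is `κ(g) · (g, δ_g)`. -/
def kappa (h : GL (Fin r) v.integer) : Kˣ :=
  Classical.epsilon fun c => triv K v r h = ι K v r c * sect K v r (ofInt v h)

end Geo

end Local

/-! ### Restricted products -/

section Adelic

open WithZero Matrix RestrictedProduct

variable {I : Type*} {k : Type*} [Field k] (K : I → Type*) [∀ i, Field (K i)]
  {F : I → Type*} [∀ i, Field (F i)] [∀ i, Algebra (K i) (F i)]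
  (v : ∀ i, Valuation (F i) ℤᵐ⁰) [∀ i, IntegralConstants (K i) (v i)]
  (N : ∀ i, (K i)ˣ →* kˣ) (r : ℕ)

/-- The restricted product of the groups `GL_r(F_i)` with respect to the subgroups `GL_r(𝒪_i)`. -/
abbrev AdelicGL : Type _ := Πʳ i, [GL (Fin r) (F i), (ofInt (r := r) (v i)).range]

/-- The restricted product of the geometric metaplectic groups with respect to the images of
the canonical splittings over the groups `GL_r(𝒪_i)`. -/
abbrev AdelicGeo : Type _ := Πʳ i, [Geo (K i) (v i) r, (Geo.triv (K i) (v i) r).range]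

/-- The subgroup of the elements `(∏ N_i(x_i)⁻¹, (x_i))` for `x_i ∈ K_iˣ`, almost all equal to
`1`. -/
def pushRel : Subgroup (kˣ × AdelicGeo K v r) where
  carrier := {p | ∃ x : ∀ i, (K i)ˣ, {i | x i ≠ 1}.Finite ∧
    (∀ i, p.2 i = Geo.ι (K i) (v i) r (x i)) ∧ p.1 = (∏ᶠ i, N i (x i))⁻¹}
  one_mem' := ⟨1, by simp, by simp, by simp⟩
  mul_mem' := by
    rintro p q ⟨x, hx, hx1, hx2⟩ ⟨y, hy, hy1, hy2⟩
    have h (z : ∀ i, (K i)ˣ) (hz : {i | z i ≠ 1}.Finite) :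
        Function.HasFiniteMulSupport fun i => N i (z i) :=
      hz.subset fun i hi h0 => hi (by
        change N i (z i) = 1
        rw [h0, map_one])
    refine ⟨x * y, (hx.union hy).subset fun i hi => ?_, fun i => ?_, ?_⟩
    · by_contra h0
      have h1 : ¬ (¬ x i = 1 ∨ ¬ y i = 1) := h0
      rw [not_or, not_not, not_not] at h1
      exact hi (by rw [Pi.mul_apply, h1.1, h1.2, one_mul])
    · rw [Prod.snd_mul, mul_apply, hx1, hy1, ← map_mul, Pi.mul_apply]
    · rw [Prod.fst_mul, hx2, hy2, ← mul_inv, ← finprod_mul_distrib (h x hx) (h y hy)]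
      simp
  inv_mem' := by
    rintro p ⟨x, hx, hx1, hx2⟩
    refine ⟨x⁻¹, by simpa using hx, fun i => ?_, ?_⟩
    · rw [Prod.snd_inv, inv_apply, hx1, ← map_inv, Pi.inv_apply]
    · rw [Prod.fst_inv, hx2, ← finprod_inv_distrib]
      simp

instance : (pushRel K v N r).Normal where
  conj_mem := by
    rintro p ⟨x, hx, hx1, hx2⟩ q
    refine ⟨x, hx, fun i => ?_, ?_⟩
    · rw [Prod.snd_mul, Prod.snd_mul, mul_apply, mul_apply, hx1, Prod.snd_inv, inv_apply,
        ← Geo.ι_comm, mul_inv_cancel_right]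
    · rw [Prod.fst_mul, Prod.fst_mul, Prod.fst_inv, mul_comm q.1, mul_inv_cancel_right, hx2]

/-- The extension by `kˣ` of the restricted product of the groups `GL_r(F_i)` obtained from the
restricted product of the geometric metaplectic groups by pushing out along `∏ N_i`. -/
def AdelicMeta : Type _ := (kˣ × AdelicGeo K v r) ⧸ pushRel K v N r

namespace AdelicMeta

instance : Group (AdelicMeta K v N r) :=
  inferInstanceAs (Group ((kˣ × AdelicGeo K v r) ⧸ pushRel K v N r))

/-- The class of the element `m · (e_i)`. -/
def mk : kˣ × AdelicGeo K v r →* AdelicMeta K v N r := QuotientGroup.mk' _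

/-- The inclusion of `kˣ`. -/
def ι : kˣ →* AdelicMeta K v N r := (mk K v N r).comp (MonoidHom.inl _ _)

/-- The projection to the restricted product of the groups `GL_r(F_i)`. -/
def proj : AdelicMeta K v N r →* AdelicGL v r :=
  QuotientGroup.lift (pushRel K v N r) ((mapAlongMonoidHom
    (fun i => Geo (K i) (v i) r) (fun i => GL (Fin r) (F i)) id Filter.tendsto_id
    (fun i => Geo.proj (K i) (v i) r) (Filter.Eventually.of_forall (by
      rintro i _ ⟨h, rfl⟩
      exact ⟨h, (Geo.proj_triv (K i) (v i) r h).symm⟩))).comp (MonoidHom.snd kˣ (AdelicGeo K v r))) (by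
    rintro p ⟨x, -, hx, -⟩
    refine RestrictedProduct.ext _ _ fun i => ?_
    change Geo.proj (K i) (v i) r (p.2 i) = 1
    rw [hx]
    rfl)

/-- The canonical splitting over the product of the groups `GL_r(𝒪_i)`. -/
def triv : (∀ i, GL (Fin r) (v i).integer) →* AdelicMeta K v N r where
  toFun h := mk K v N r (1, ⟨fun i => Geo.triv (K i) (v i) r (h i),
    Filter.Eventually.of_forall fun i => ⟨h i, rfl⟩⟩)
  map_one' := by
    rw [← map_one (mk K v N r)]
    congr 1
    exact Prod.ext rfl (RestrictedProduct.ext _ _ fun i => map_one (Geo.triv (K i) (v i) r))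
  map_mul' h h' := by
    rw [← map_mul]
    congr 1
    exact Prod.ext (one_mul _).symm (RestrictedProduct.ext _ _ fun i =>
      map_mul (Geo.triv (K i) (v i) r) (h i) (h' i))

end AdelicMeta

end Adelic

/-! ### The rational function field and its places -/

section Global

open WithZero Matrix Polynomial RestrictedProduct IsDedekindDomain

variable (k : Type*) [Field k]

/-- The places of `F = k(ϖ)`, i.e. the closed points of the projective line: the maximal ideals
of `k[ϖ]`, and the point at infinity. -/
abbrev Place : Type _ := Option (HeightOneSpectrum k[X])

variable {k}

open Classical in
/-- The normalised valuation of `F` attached to a place. -/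
def placeVal : Place k → Valuation (RatFunc k) ℤᵐ⁰
  | some p => p.valuation (RatFunc k)
  | none => RatFunc.inftyValuation k

/-- The completion `F_p` of `F` at the place `p`. -/
def Loc (p : Place k) : Type _ := (placeVal p).Completion

instance (p : Place k) : Field (Loc p) := inferInstanceAs (Field (placeVal p).Completion)

/-- The valuation of `F_p`. -/
def locVal (p : Place k) : Valuation (Loc p) ℤᵐ⁰ :=
  (Valued.v : Valuation (placeVal p).Completion ℤᵐ⁰)

/-- The embedding of `F` in `F_p`. -/
def toLoc (p : Place k) : RatFunc k →+* Loc p :=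
  (UniformSpace.Completion.coeRingHom (α := WithVal (placeVal p))).comp
    (WithVal.equiv (placeVal p)).symm.toRingHom

theorem locVal_toLoc (p : Place k) (f : RatFunc k) : locVal p (toLoc p f) = placeVal p f :=
  Valued.valuedCompletion_apply _

instance (p : Place k) : Algebra k (Loc p) :=
  ((toLoc p).comp (algebraMap k (RatFunc k))).toAlgebra

instance (p : Place k) : IntegralConstants k (locVal p) where
  le_one c := by
    change locVal p (toLoc p (algebraMap k (RatFunc k) c)) ≤ 1
    rw [locVal_toLoc]
    rcases p with _ | p
    · by_cases hc : c = 0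
      · simp [hc]
      · classical
        exact (RatFunc.inftyValuation.C k hc).le
    · change p.valuation (RatFunc k) _ ≤ 1
      rw [IsScalarTower.algebraMap_apply k k[X] (RatFunc k)]
      exact p.valuation_le_one _

/-- The residue field `k_p` of the place `p`, identified with the algebraic closure of `k` in
`F_p`; thus `F_p` is the field of Laurent series over `k_p` in a uniformiser. -/
abbrev ResField (p : Place k) : IntermediateField k (Loc p) := algebraicClosure k (Loc p)

instance (p : Place k) : IntegralConstants (ResField p) (locVal p) where
  le_one c := by
    have hc : IsIntegral k (c : Loc p) := (mem_algebraicClosure_iff.1 c.2).isIntegral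
    have hk (x : k) : algebraMap k (Loc p) x ∈ (locVal p).integer :=
      IntegralConstants.le_one (v := locVal p) x
    have h : IsIntegral (locVal p).integer (c : Loc p) := by
      obtain ⟨f, hf, hc⟩ := hc
      refine ⟨f.map ((algebraMap k (Loc p)).codRestrict (locVal p).integer hk), hf.map _, ?_⟩
      rw [eval₂_map]
      exact hc
    exact (Valuation.integer.integers (locVal p)).mem_of_integral h

variable (S : Set (Place k)) (r : ℕ)

/-- The ring `𝒪(S)` of the rational functions whose poles are in `S`. -/
def sInt : Subring (RatFunc k) := ⨅ p : {p : Place k // p ∉ S}, (placeVal p.1).integer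

/-- The inclusion of `𝒪(S)` in the valuation ring `𝒪_p` of `F_p`, for `p ∉ S`. -/
def sIntToLoc (p : {p : Place k // p ∉ S}) : sInt S →+* (locVal p.1).integer :=
  ((toLoc p.1).comp (sInt S).subtype).codRestrict (locVal p.1).integer fun f => by
    change locVal p.1 (toLoc p.1 f) ≤ 1
    rw [locVal_toLoc]
    exact (Subring.mem_iInf.1 f.2) p

variable {r} in
/-- A matrix over `F`, seen as a matrix over `F_p`. -/
def glLoc (p : Place k) : GL (Fin r) (RatFunc k) →* GL (Fin r) (Loc p) :=
  GeneralLinearGroup.map (toLoc p)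

variable {S r} in
/-- A matrix over `𝒪(S)`, seen as a matrix over `𝒪_p`, for `p ∉ S`. -/
def glIntLoc (p : {p : Place k // p ∉ S}) :
    GL (Fin r) (sInt S) →* GL (Fin r) (locVal p.1).integer :=
  GeneralLinearGroup.map (sIntToLoc S p)

variable {S r} in
theorem ofInt_glIntLoc (p : {p : Place k // p ∉ S}) (h : GL (Fin r) (sInt S)) :
    ofInt (locVal p.1) (glIntLoc p h) =
      glLoc p.1 (GeneralLinearGroup.map (sInt S).subtype h) := rfl

/-- The metaplectic group of the adeles outside `S`: the push-out, along `∏ N_{k_p/k}`, of the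
restricted product over `p ∉ S` of the local metaplectic groups, which are extensions of
`GL_r(F_p)` by `k_pˣ`. -/
abbrev MetaA : Type _ :=
  AdelicMeta (k := k) (fun p : {p : Place k // p ∉ S} => ResField p.1) (fun p => locVal p.1)
    (fun _ => Units.map (Algebra.norm k)) r

/-- Pairs `((g_p), δ)`, where `(g_p)` is in the restricted product over `p ∉ S` of the groups
`GL_r(F_p)` and `δ` is a non-zero element of the tensor product of the `k`-lines
`Δ_{g,p} = (𝒪_p | det(g_p) 𝒪_p)_k ⊗ (𝒪_p^r | g_p 𝒪_p^r)_k^{-1}`, which are canonically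
identified with `k` for almost all `p`; the class of `(m, (δ_p))` is `m ⨂ δ_p`. -/
abbrev TensorMeta : Type _ :=
  AdelicMeta (k := k) (fun _ : {p : Place k // p ∉ S} => k) (fun p => locVal p.1)
    (fun _ => MonoidHom.id kˣ) r

/-- The `S`-global metaplectic group: pairs `(g, δ)`, where `g ∈ GL_r(F)` and `δ` is a non-zero
element of the `k`-line `⨂_{p ∉ S} Δ_{g,p}`. -/
def GlobalMeta : Subgroup (GL (Fin r) (RatFunc k) × TensorMeta S r) where
  carrier := {q | ∀ p, AdelicMeta.proj _ _ _ r q.2 p = glLoc p.1 q.1}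
  one_mem' := fun p => by simp
  mul_mem' := fun {q q'} h h' p => by
    rw [Prod.snd_mul, map_mul, mul_apply, h, h', Prod.fst_mul, map_mul]
  inv_mem' := fun {q} h p => by
    rw [Prod.snd_inv, map_inv, inv_apply, h, Prod.fst_inv, map_inv]

namespace GlobalMeta

/-- The inclusion of `kˣ`. -/
def ι : kˣ →* GlobalMeta S r :=
  ((MonoidHom.inr (GL (Fin r) (RatFunc k)) (TensorMeta S r)).comp
    (AdelicMeta.ι _ _ _ r)).codRestrict (GlobalMeta S r) fun c p => by
      change _ = glLoc p.1 1
      rw [map_one]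
      rfl

/-- The projection `(g, δ) ↦ g`. -/
def proj : GlobalMeta S r →* GL (Fin r) (RatFunc k) :=
  (MonoidHom.fst _ _).comp (GlobalMeta S r).subtype

/-- The canonical splitting `κ_S^*` over `GL_r(𝒪(S))`, given by the identifications
`Δ_{h,p} = k` for `h ∈ GL_r(𝒪(S))` and `p ∉ S`. -/
def triv : GL (Fin r) (sInt S) →* GlobalMeta S r :=
  ((GeneralLinearGroup.map (sInt S).subtype).prod
    ((AdelicMeta.triv _ _ _ r).comp (MonoidHom.pi fun p => glIntLoc p))).codRestrict
      (GlobalMeta S r) fun _ _ => rfl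

/-- `x = (g, δ_g)` with `δ_g = ⨂ δ_{g,p}`, where the sections `δ_{g,p}` of the `k`-lines
`Δ_{g,p}` are computed from a Bruhat decomposition of `g` over `F`. -/
def IsSection (g : GL (Fin r) (RatFunc k)) (x : GlobalMeta S r) : Prop :=
  ∃ n t w n', IsBruhat g n t w n' ∧
    ∃ e : AdelicGeo (fun _ : {p : Place k // p ∉ S} => k) (fun p => locVal p.1) r,
      (∀ p, IsBruhatSection k (locVal p.1) r (glLoc p.1 n)
        (fun i => Units.map (toLoc p.1).toMonoidHom (t i)) w (glLoc p.1 n') (e p)) ∧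
      x.1 = (g, AdelicMeta.mk _ _ _ r (1, e))

/-- The section `g ↦ (g, δ_g)`. -/
def sect (g : GL (Fin r) (RatFunc k)) : GlobalMeta S r := Classical.epsilon (IsSection S r g)

/-- The global function `κ_S` on `GL_r(𝒪(S))`: `κ_S^*(h) = κ_S(h) · (h, δ_h)`. -/
def kappa (h : GL (Fin r) (sInt S)) : kˣ :=
  Classical.epsilon fun c =>
    triv S r h = ι S r c * sect S r (GeneralLinearGroup.map (sInt S).subtype h)

end GlobalMeta

variable {r} in
/-- The local function `κ_p : GL_r(𝒪_p) → kˣ`, the norm of the function with values in `k_pˣ`. -/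
def kappaLoc (p : Place k) (h : GL (Fin r) (locVal p).integer) : kˣ :=
  Units.map (Algebra.norm k) (Geo.kappa (ResField p) (locVal p) r h)

end Global

/-- `1 → A → E → G → 1` is a central extension. -/
structure IsCentralExtension {A E G : Type*} [Group A] [Group E] [Group G] (ι : A →* E)
    (π : E →* G) : Prop where
  injective : Function.Injective ι
  exact : ι.range = π.ker
  surjective : Function.Surjective π
  central : ι.range ≤ Subgroup.center E

end Metaplectic

end

/-! The two rows are formed over different constants: at a place p the adelic group uses top
exterior powers over the residue field K' = k_p, the global group uses those over k. The bridge is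
the norm. If two K'-bases a and b of W satisfy ⋀b = c ⋀a, then multiplying their vectors by a fixed
K-basis of K' gives K-bases whose exterior products differ by N(c), because the K-determinant of a
K'-linear map is the norm of its K'-determinant (`wedge_scaleList_eq`). This yields homomorphisms
`Ack.normHom` and `Geo.norm` from the extensions over K' to those over K, equal to the norm on
scalars and compatible with the projections and the canonical splittings. Taken at all p outside S,
they give a morphism between the two adelic extensions of the same group which is the identity on
kˣ, hence an isomorphism (`AdelicMeta.norm_bijective`). The global group is by construction the
pull-back to GL_r(F) of the adelic extension made of k-lines; Φ is the projection to that extension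
followed by the inverse of the norm, and the square is cartesian.

All computations with lines are made in coordinates: `Ack.Rep u L a b c` says that u corresponds to
c a^* ⊗ b for bases a, b modulo a common sublattice L, and such a coordinate together with the
automorphism determines u. Refinement, base change, product and norm of coordinates have simple
formulas.

The section is well defined for three reasons. For unipotent n the choice of the stable lattice is
immaterial because n has determinant 1 on every finite stable subquotient (`IsCanon.of_stable`). For
a diagonal matrix the choice of the even exponent is immaterial because 𝔭^n/𝔭^n' then has even
dimension, so the extra exterior factors commute with everything (`IsDiagRep.mono`), and scalars in
the chosen y_i cancel between the two lines. In a Bruhat decomposition t and w are unique, and the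
ambiguity in n, n' disappears because the unipotent lifts are multiplicative and respect conjugation
by arbitrary elements of the extension (`IsBruhatSection.eq`).

The norm preserves the section (`IsBruhatSection.norm`): a unipotent lift has coordinate 1 and N(1)
= 1; concatenation over the diagonal entries commutes with extension of bases; and the sign is
respected because N(-1) = (-1)^[K':K] while deg_K = [K':K] deg_K'. For almost all p all the factors
of a global decomposition are integral, so that the local sections lie in the restricted product.
Applying Φ to κ_S^*(h) = κ_S(h) s(h) and comparing with the local identities triv = κ'_p δ gives the
product formula (`GlobalMeta.kappa_eq`). -/

noncomputable section

namespace Metaplectic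

section

open Module

/-! ### Exterior products of lists and bases modulo a sublattice -/

section ListWedge

variable {K : Type*} [Field K] {V W : Type*} [AddCommGroup V] [Module K V] [AddCommGroup W]
  [Module K W]

variable (K) in
/-- The exterior product of a list of vectors. -/
def wedge (l : List V) : ExteriorAlgebra K V := (l.map (ExteriorAlgebra.ι K)).prod

@[simp] theorem wedge_nil : wedge K ([] : List V) = 1 := rfl

@[simp] theorem wedge_append (l l' : List V) : wedge K (l ++ l') = wedge K l * wedge K l' := by
  simp [wedge]

theorem map_wedge (f : V →ₗ[K] W) (l : List V) :
    ExteriorAlgebra.map f (wedge K l) = wedge K (l.map f) := by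
  rw [wedge, wedge, map_list_prod, List.map_map, List.map_map]
  congr 1
  exact List.map_congr_left fun x _ => ExteriorAlgebra.map_apply_ι f x

theorem wedge_eq_ιMulti (l : List V) :
    wedge K l = ExteriorAlgebra.ιMulti K l.length fun i => l[i] := by
  rw [ExteriorAlgebra.ιMulti_apply, wedge]
  congr 1
  conv_lhs => rw [← List.ofFn_getElem (xs := l), List.map_ofFn]
  rfl

theorem wedge_mem (l : List V) {n : ℕ} (h : l.length = n) : wedge K l ∈ ⋀[K]^n V := by
  subst h
  rw [wedge_eq_ιMulti]
  exact ExteriorAlgebra.ιMulti_range K l.length ⟨_, rfl⟩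

/-- A spanning list whose length is the dimension, as a basis. -/
def listBasis [FiniteDimensional K V] (l : List V) (hl : l.length = finrank K V)
    (hs : Submodule.span K {x | x ∈ l} = ⊤) : Basis (Fin l.length) K V :=
  basisOfTopLeSpanOfCardEqFinrank (fun i => l[i])
    (by
      rw [show Set.range (fun i : Fin l.length => l[i]) = {x | x ∈ l} from ?_, hs]
      ext x
      simp [List.mem_iff_getElem, Fin.exists_iff]) (by simp [hl])

theorem listBasis_apply [FiniteDimensional K V] (l : List V) (hl : l.length = finrank K V)
    (hs : Submodule.span K {x | x ∈ l} = ⊤) : (listBasis l hl hs : _ → V) = fun i => l[i] :=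
  coe_basisOfTopLeSpanOfCardEqFinrank _ _ _

theorem wedge_ne_zero [FiniteDimensional K V] {l : List V} (hl : l.length = finrank K V)
    (hs : Submodule.span K {x | x ∈ l} = ⊤) : wedge K l ≠ 0 := by
  rw [wedge_eq_ιMulti, ← listBasis_apply l hl hs]
  exact ιMulti_basis_ne_zero _

/-- The top exterior power is a line, so some scalar relates the two products; evaluating the
determinant form of the basis identifies this scalar. -/
theorem wedge_map_eq_det [FiniteDimensional K V] (φ : V →ₗ[K] V) {l : List V}
    (hl : l.length = finrank K V) (hs : Submodule.span K {x | x ∈ l} = ⊤) :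
    wedge K (l.map φ) = LinearMap.det φ • wedge K l := by
  let b := listBasis l hl hs
  have hb : (b : _ → V) = fun i => l[i] := listBasis_apply l hl hs
  have h1 : wedge K (l.map φ) = ExteriorAlgebra.ιMulti K l.length (φ ∘ b) := by
    rw [← map_wedge, wedge_eq_ιMulti l, ExteriorAlgebra.map_apply_ιMulti, hb]
  have h2 : exteriorPower.ιMulti K l.length (φ ∘ b) =
      LinearMap.det φ • exteriorPower.ιMulti K l.length b := by
    have hne : exteriorPower.ιMulti K l.length b ≠ 0 := fun h =>
      ιMulti_basis_ne_zero b (congrArg Subtype.val h)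
    have hr : finrank K (⋀[K]^l.length V) = 1 := by
      rw [exteriorPower.finrank_eq, hl, Nat.choose_self]
    obtain ⟨d, hd⟩ := (finrank_eq_one_iff_of_nonzero' _ hne).1 hr
      (exteriorPower.ιMulti K l.length (φ ∘ b))
    have h3 := congrArg (exteriorPower.alternatingMapLinearEquiv b.det) hd
    rw [map_smul, exteriorPower.alternatingMapLinearEquiv_apply_ιMulti,
      exteriorPower.alternatingMapLinearEquiv_apply_ιMulti, Basis.det_comp, Basis.det_self,
      mul_one, smul_eq_mul, mul_one] at h3
    rw [← hd, h3]
  rw [h1, wedge_eq_ιMulti l, ← hb]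
  exact congrArg Subtype.val h2

/-- The list `l` maps to a basis of `A / (A ∩ L)`. -/
structure IsBasisMod (A L : Submodule K V) (l : List V) : Prop where
  mem : ∀ x ∈ l, x ∈ A
  le_span : A ≤ Submodule.span K {x | x ∈ l} ⊔ L
  length : l.length = finrank K (Quo A L)

variable {A B L L' : Submodule K V} {a b l l' : List V}

theorem IsBasisMod.fin (h : IsBasisMod A L a) : FiniteDimensional K (Quo A L) :=
  fin_quo_iff.2 ⟨_, Submodule.fg_span a.finite_toSet, (sup_comm _ _).le.trans' h.le_span⟩

/-- Transfers representatives in V to a basis of the abstract space A/L, where dimension and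
determinant arguments apply. -/
theorem IsBasisMod.lift (h : IsBasisMod A L a) :
    ∃ a' : List (Quo A L), a'.map (Quo A L).subtype = a.map L.mkQ ∧
      a'.length = finrank K (Quo A L) ∧ Submodule.span K {x | x ∈ a'} = ⊤ := by
  have h1 : ∀ x ∈ a.map L.mkQ, x ∈ Quo A L := by
    intro x hx
    obtain ⟨y, hy, rfl⟩ := List.mem_map.1 hx
    exact Submodule.mem_map_of_mem (h.mem y hy)
  refine ⟨(a.map L.mkQ).pmap Subtype.mk h1, ?_, ?_, ?_⟩
  · rw [List.map_pmap]; simp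
  · simp [h.length]
  · refine Submodule.map_injective_of_injective (Submodule.subtype_injective (Quo A L))
      (le_antisymm (Submodule.map_mono le_top) ?_)
    have h2 : (Quo A L).subtype '' {x | x ∈ (a.map L.mkQ).pmap Subtype.mk h1} =
        L.mkQ '' {x | x ∈ a} := by
      ext x
      simp only [Set.mem_image, Set.mem_ofPred_eq, List.mem_pmap, List.mem_map]
      constructor
      · rintro ⟨_, ⟨_, ⟨y, hy, rfl⟩, rfl⟩, rfl⟩
        exact ⟨y, hy, rfl⟩
      · rintro ⟨y, hy, rfl⟩
        exact ⟨⟨L.mkQ y, h1 _ (List.mem_map_of_mem hy)⟩, ⟨_, ⟨y, hy, rfl⟩, rfl⟩, rfl⟩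
    rw [Submodule.map_span, h2, ← Submodule.map_span, Submodule.map_subtype_top]
    refine (Submodule.map_mono h.le_span).trans ?_
    rw [Submodule.map_sup, Submodule.mkQ_map_self, sup_bot_eq]

theorem IsBasisMod.exists_top (h : IsBasisMod A L a) :
    ∃ α : TopExt K (Quo A L), α ≠ 0 ∧ inc α = wedge K (a.map L.mkQ) := by
  have := h.fin
  obtain ⟨a', h1, h2, h3⟩ := h.lift
  refine ⟨⟨wedge K a', wedge_mem a' h2⟩, fun h0 => wedge_ne_zero h2 h3 (congrArg Subtype.val h0),
    ?_⟩
  rw [inc, map_wedge, h1]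

theorem IsBasisMod.wedge_ne_zero (h : IsBasisMod A L a) : wedge K (a.map L.mkQ) ≠ 0 := by
  obtain ⟨α, h0, h1⟩ := h.exists_top
  rw [← h1]
  intro h2
  exact h0 (inc_injective (h2.trans (by simp [inc])))

theorem IsBasisMod.nil (A : Submodule K V) : IsBasisMod A A [] where
  mem := by simp
  le_span := le_sup_right
  length := by rw [Quo, Submodule.mkQ_map_self, finrank_bot]; rfl

theorem exists_isBasisMod (h : FiniteDimensional K (Quo A L)) : ∃ a, IsBasisMod A L a := by
  let b := finBasis K (Quo A L)
  have h1 (i) : ∃ x ∈ A, L.mkQ x = b i := (b i).2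
  choose f hf hfb using h1
  refine ⟨List.ofFn f, ?_, fun x hx => ?_, by simp⟩
  · intro x hx
    obtain ⟨i, rfl⟩ := (List.mem_ofFn' _ _).1 hx
    exact hf i
  · let y : Quo A L := ⟨L.mkQ x, Submodule.mem_map_of_mem hx⟩
    -- The coordinates of the class of x, applied to the chosen representatives, recover x up to an
    -- element of L.
    have h2 : x - ∑ i, b.repr y i • f i ∈ L := by
      refine (Submodule.Quotient.eq L).1 (?_ : L.mkQ x = L.mkQ _)
      have := congrArg Subtype.val (b.sum_repr y)
      simp only [Submodule.coe_sum, Submodule.coe_smul, ← hfb] at this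
      simp only [map_sum, map_smul, this, y]
    rw [← sub_add_cancel x (∑ i, b.repr y i • f i), add_comm]
    refine Submodule.add_mem_sup (Submodule.sum_mem _ fun i _ => Submodule.smul_mem _ _
      (Submodule.subset_span ?_)) h2
    exact (List.mem_ofFn' _ _).2 ⟨i, rfl⟩

theorem finrank_quo_add (h : L' ≤ L) (hA : L ≤ A) (hfin : FiniteDimensional K (Quo A L')) :
    finrank K (Quo A L') = finrank K (Quo A L) + finrank K (Quo L L') := by
  let p : Quo A L' →ₗ[K] Quo A L := (Submodule.factor h).restrict (by
    rintro _ ⟨x, hx, rfl⟩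
    exact Submodule.mem_map_of_mem hx)
  have hp : Function.Surjective p := by
    rintro ⟨_, x, hx, rfl⟩
    exact ⟨⟨L'.mkQ x, Submodule.mem_map_of_mem hx⟩, rfl⟩
  rw [← LinearMap.finrank_range_add_finrank_ker p, LinearMap.range_eq_top.2 hp, finrank_top]
  congr 1
  have h2 : p.ker.map (Quo A L').subtype = Quo L L' := by
    ext x
    constructor
    · rintro ⟨⟨_, y, hy, rfl⟩, h0, rfl⟩
      have h3 : L.mkQ y = 0 := congrArg Subtype.val h0
      rw [← LinearMap.mem_ker, Submodule.ker_mkQ] at h3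
      exact Submodule.mem_map_of_mem h3
    · rintro ⟨y, hy, rfl⟩
      refine ⟨⟨L'.mkQ y, Submodule.mem_map_of_mem (hA hy)⟩, Subtype.ext ?_, rfl⟩
      change L.mkQ y = 0
      rwa [← LinearMap.mem_ker, Submodule.ker_mkQ]
  rw [← h2]
  exact (Submodule.equivMapOfInjective _ (Submodule.subtype_injective _) _).finrank_eq

theorem IsBasisMod.append (ha : IsBasisMod A L a) (hl : IsBasisMod L L' l) (h : L' ≤ L)
    (hA : L ≤ A) : IsBasisMod A L' (a ++ l) := by
  refine ⟨fun x hx => (List.mem_append.1 hx).elim (ha.mem x) fun h => hA (hl.mem x h), ?_, ?_⟩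
  · have e : {x | x ∈ a ++ l} = {x | x ∈ a} ∪ {x | x ∈ l} := by ext; simp
    rw [e, Submodule.span_union, sup_assoc]
    exact ha.le_span.trans (sup_le_sup_left hl.le_span _)
  · rw [finrank_quo_add h hA (fin_quo_trans ha.fin hl.fin), List.length_append, ha.length,
      hl.length]

theorem IsBasisMod.map (ha : IsBasisMod A L a) (g : V ≃ₗ[K] V) :
    IsBasisMod (A.map (g : V →ₗ[K] V)) (L.map (g : V →ₗ[K] V)) (a.map g) := by
  refine ⟨fun x hx => ?_, ?_, ?_⟩
  · obtain ⟨y, hy, rfl⟩ := List.mem_map.1 hx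
    exact Submodule.mem_map_of_mem (ha.mem y hy)
  · refine (Submodule.map_mono ha.le_span).trans ?_
    rw [Submodule.map_sup, Submodule.map_span]
    refine sup_le_sup_right (Submodule.span_mono ?_) _
    rintro _ ⟨x, hx, rfl⟩
    exact List.mem_map_of_mem hx
  · rw [List.length_map, ha.length]
    let e := Submodule.Quotient.equiv L (L.map (g : V →ₗ[K] V)) g rfl
    have : (Quo A L).map (e : (V ⧸ L) →ₗ[K] _) =
        Quo (A.map (g : V →ₗ[K] V)) (L.map (g : V →ₗ[K] V)) := by
      rw [Quo, Quo, ← Submodule.map_comp, ← Submodule.map_comp]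
      rfl
    rw [← this]
    exact (e.submoduleMap _).finrank_eq

/-- Two bases of `A / L` have proportional exterior products. -/
theorem IsBasisMod.exists_smul (ha : IsBasisMod A L a) (hb : IsBasisMod A L b) :
    ∃ c : Kˣ, wedge K (b.map L.mkQ) = c • wedge K (a.map L.mkQ) := by
  have := ha.fin
  obtain ⟨α, h0, h1⟩ := ha.exists_top
  obtain ⟨β, h2, h3⟩ := hb.exists_top
  obtain ⟨c, rfl⟩ := topExt_smul_eq h0 β
  have hc : c ≠ 0 := by rintro rfl; simp at h2
  exact ⟨Units.mk0 c hc, by rw [← h3, inc_smul, h1]; rfl⟩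

/-- The exterior product of a basis of `A / L` is multiplied by the determinant under a linear
map. -/
theorem IsBasisMod.wedge_map (ha : IsBasisMod A L a) (φ : Quo A L →ₗ[K] Quo A L)
    (g : V → V) (hg : ∀ x (hx : x ∈ A), (φ ⟨L.mkQ x, Submodule.mem_map_of_mem hx⟩ : V ⧸ L) =
      L.mkQ (g x)) :
    wedge K ((a.map g).map L.mkQ) = LinearMap.det φ • wedge K (a.map L.mkQ) := by
  have := ha.fin
  obtain ⟨a', h1, h2, h3⟩ := ha.lift
  have h4 := congrArg (ExteriorAlgebra.map (Quo A L).subtype) (wedge_map_eq_det φ h2 h3)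
  rw [map_smul, map_wedge, map_wedge, h1] at h4
  rw [← h4]
  congr 1
  -- The lifted list need not carry its original representatives; only the class of each entry
  -- matters for φ.
  have h5 (x : Quo A L) (y : V) (hy : y ∈ A) (hxy : (x : V ⧸ L) = L.mkQ y) :
      (φ x : V ⧸ L) = L.mkQ (g y) := by
    rw [← hg y hy]
    exact congrArg (fun z => (φ z : V ⧸ L)) (Subtype.ext hxy)
  refine List.ext_getElem (by simpa using (congrArg List.length h1).symm) fun i hi hi' => ?_
  simp only [List.length_map] at hi hi'
  have h6 : (a'.map (Quo A L).subtype)[i]'(by simpa using hi') =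
      (a.map L.mkQ)[i]'(by simpa using hi) := by simp only [h1]
  simp only [List.getElem_map] at h6 ⊢
  exact (h5 _ _ (ha.mem _ (List.getElem_mem _)) h6).symm

end ListWedge

end

section

open Module

/-! ### Coordinates on determinant lines and on the extension `Ack` -/

section Representation

variable {K : Type*} [Field K] {V : Type*} [AddCommGroup V] [Module K V]

variable {A B L A' B' L' : Submodule K V} {a b l a' b' : List V} {c d e : Kˣ}

/-- `x` sends the exterior product of `a` to `c` times the exterior product of `b`. -/
def Sends (x : DetIso A B L) (a b : List V) (c : Kˣ) : Prop :=
  ∀ α, inc α = wedge K (a.map L.mkQ) → inc (x α) = c • wedge K (b.map L.mkQ)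

theorem inc_units_smul (c : Kˣ) (α : TopExt K (Quo A L)) : inc (c • α) = c • inc α :=
  inc_smul (c : K) α

theorem Sends.eq {x y : DetIso A B L} (ha : IsBasisMod A L a) (hx : Sends x a b c)
    (hy : Sends y a b c) : x = y := by
  have := ha.fin
  obtain ⟨α, h0, h1⟩ := ha.exists_top
  refine LinearEquiv.ext fun β => ?_
  obtain ⟨d, rfl⟩ := topExt_smul_eq h0 β
  rw [map_smul, map_smul, inc_injective ((hx α h1).trans (hy α h1).symm)]

theorem Sends.unique {x : DetIso A B L} (ha : IsBasisMod A L a) (hb : IsBasisMod B L b)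
    (hx : Sends x a b c) (hy : Sends x a b d) : c = d := by
  obtain ⟨α, h0, h1⟩ := ha.exists_top
  exact Units.ext (smul_left_injective K hb.wedge_ne_zero ((hx α h1).symm.trans (hy α h1)))

theorem exists_sends (ha : IsBasisMod A L a) (hb : IsBasisMod B L b) (c : Kˣ) :
    ∃ x : DetIso A B L, Sends x a b c := by
  have := ha.fin
  have := hb.fin
  obtain ⟨α, h0, h1⟩ := ha.exists_top
  obtain ⟨β, h2, h3⟩ := hb.exists_top
  have hβ : c • β ≠ 0 := by rwa [Ne, smul_eq_zero_iff_eq]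
  have key (A : Submodule K V) [FiniteDimensional K (Quo A L)] (α : TopExt K (Quo A L))
      (h0 : α ≠ 0) : ∃ e : K ≃ₗ[K] TopExt K (Quo A L), e 1 = α := by
    exact ⟨LinearEquiv.ofBijective (LinearMap.toSpanSingleton K _ α)
      ⟨smul_left_injective K h0, fun β => topExt_smul_eq h0 β⟩, one_smul K α⟩
  obtain ⟨f, hf⟩ := key A α h0
  obtain ⟨g, hg⟩ := key B (c • β) hβ
  refine ⟨f.symm.trans g, fun α' hα' => ?_⟩
  rw [← h1] at hα'
  rw [inc_injective hα', ← hf, LinearEquiv.trans_apply, LinearEquiv.symm_apply_apply, hg,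
    inc_units_smul, h3]

theorem exists_sends_of (x : DetIso A B L) (ha : IsBasisMod A L a) (hb : IsBasisMod B L b) :
    ∃ c, Sends x a b c := by
  have := hb.fin
  obtain ⟨α, h0, h1⟩ := ha.exists_top
  obtain ⟨β, h2, h3⟩ := hb.exists_top
  obtain ⟨c, hc⟩ := topExt_smul_eq h2 (x α)
  have hc0 : c ≠ 0 := by
    rintro rfl
    rw [zero_smul] at hc
    exact h0 (x.map_eq_zero_iff.1 hc.symm)
  refine ⟨Units.mk0 c hc0, fun α' hα' => ?_⟩
  rw [← h1] at hα'
  rw [inc_injective hα', ← hc, inc_smul, h3]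
  rfl

theorem Sends.trans {C : Submodule K V} {x : DetIso A B L} {y : DetIso B C L}
    (hb : IsBasisMod B L b) (hx : Sends x a b c) (hy : Sends y b l d) :
    Sends (x.trans y) a l (c * d) := by
  intro α hα
  obtain ⟨β, h0, h1⟩ := hb.exists_top
  have h2 : x α = c • β := inc_injective (by rw [hx α hα, inc_units_smul, h1])
  have h3 : (x.trans y) α = c • y β := by
    rw [LinearEquiv.trans_apply, h2]
    exact y.map_smul (c : K) β
  rw [h3, inc_units_smul, hy β h1, smul_smul]

/-- The factor d enters on the source, hence linearly, and e on the target, hence inversely. -/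
theorem Sends.change {x : DetIso A B L} (hx : Sends x a b c)
    (ha : wedge K (a'.map L.mkQ) = d • wedge K (a.map L.mkQ))
    (hb : wedge K (b'.map L.mkQ) = e • wedge K (b.map L.mkQ)) :
    Sends x a' b' (c * d * e⁻¹) := by
  intro α hα
  have h1 : inc (d⁻¹ • α) = wedge K (a.map L.mkQ) := by
    rw [inc_units_smul, hα, ha, smul_smul, inv_mul_cancel, one_smul]
  have h2 := hx _ h1
  have h3 : x (d⁻¹ • α) = d⁻¹ • x α := x.map_smul ((d⁻¹ : Kˣ) : K) α
  rw [h3, inc_units_smul, inv_smul_eq_iff, smul_smul] at h2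
  rw [h2, hb, smul_smul, inv_mul_cancel_right, mul_comm]

/-- The lift s and the map induced by g differ by vectors of gL/L', and these are annihilated by the
top form of gL/L'. Thus the auxiliary lift in `IsPush` can be replaced by g itself. -/
theorem map_isLift_mul {g : V ≃ₗ[K] V} {s : (V ⧸ L) →ₗ[K] (V ⧸ L')} (hs : IsLift g L L' s)
    {l : TopExt K (Quo (L.map (g : V →ₗ[K] V)) L')}
    (hfin : FiniteDimensional K (Quo (L.map (g : V →ₗ[K] V)) L')) (a : List V) :
    ExteriorAlgebra.map s (wedge K (a.map L.mkQ)) * inc l =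
      wedge K ((a.map g).map L'.mkQ) * inc l := by
  have h := map_mul_map_congr (s ∘ₗ L.mkQ) (L'.mkQ ∘ₗ (g : V →ₗ[K] V))
    (Quo (L.map (g : V →ₗ[K] V)) L').subtype (fun v => ⟨⟨_, hs v⟩, rfl⟩) (wedge K a) l
  rw [← ExteriorAlgebra.map_comp_map, ← ExteriorAlgebra.map_comp_map, AlgHom.comp_apply,
    AlgHom.comp_apply, map_wedge L.mkQ, map_wedge (g : V →ₗ[K] V), map_wedge L'.mkQ] at h
  exact h

/-- `IsPush` in coordinates: the same list l is placed on the right of both bases, so the scalar is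
unchanged and no sign occurs. -/
theorem IsPush.sends {g : V ≃ₗ[K] V} {x : DetIso A B L} {x' : DetIso A' B' L'}
    (h : IsPush g x x') (hA : PushOK g A L A' L') (ha : IsBasisMod A L a)
    (hl : IsBasisMod (L.map (g : V →ₗ[K] V)) L' l) (hx : Sends x a b c) :
    Sends x' (a.map g ++ l) (b.map g ++ l) c := by
  intro α hα
  have := hA.fin_map
  obtain ⟨s, hs⟩ := exists_isLift g hA.le_map
  obtain ⟨m, hm, hml⟩ := hl.exists_top
  obtain ⟨β, -, hβ⟩ := ha.exists_top
  have h1 : inc α = ExteriorAlgebra.map s (inc β) * inc m := by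
    rw [hβ, map_isLift_mul hs this, hml, hα, List.map_append, wedge_append]
  rw [h.forall hs hm h1, hx β hβ, List.map_append, wedge_append, ← hml,
    ← map_isLift_mul hs this]
  rw [Units.smul_def, Units.smul_def, map_smul, smul_mul_assoc]

end Representation

namespace Ack

variable {K : Type*} [Field K] {V : Type*} [AddCommGroup V] [Module K V]
  {A L L' : Submodule K V} {a b l a' b' : List V} {c d e : Kˣ}

/-- For `L ⊆ A ∩ fA`, and bases `a` and `b` of `A/L` and `fA/L`, the element `u = (f, x)`
corresponds to `c a^* ⊗ b`. -/
structure Rep (u : Ack A) (L : Submodule K V) (a b : List V) (c : Kˣ) : Prop where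
  basis_left : IsBasisMod A L a
  basis_right : IsBasisMod (A.map (u.f : V →ₗ[K] V)) L b
  le : L ≤ A
  le_map : L ≤ A.map (u.f : V →ₗ[K] V)
  exists_sends : ∃ x : DetIso A (A.map (u.f : V →ₗ[K] V)) L, IsPush 1 u.x x ∧ Sends x a b c

theorem commens_of_le (h : FiniteDimensional K (Quo A L)) (hL : L ≤ A) : Commens A L :=
  commens_iff.2 ⟨h, fin_quo_mono le_rfl hL (fin_quo_self L)⟩

theorem pushOK_one (u : Ack A) (hL : L ≤ A) (hL' : L ≤ A.map (u.f : V →ₗ[K] V))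
    (h : FiniteDimensional K (Quo A L)) :
    PushOK 1 A (A ⊓ A.map (u.f : V →ₗ[K] V)) A L :=
  u.pushOK_left (map_one_eq A) hL (by rwa [one_mul]) (commens_of_le h hL)

variable {u v : Ack A}

theorem exists_rep (u : Ack A) (hL : L ≤ A) (hL' : L ≤ A.map (u.f : V →ₗ[K] V))
    (ha : IsBasisMod A L a) (hb : IsBasisMod (A.map (u.f : V →ₗ[K] V)) L b) :
    ∃ c, u.Rep L a b c := by
  obtain ⟨x, hx⟩ := u.exists_push 1 (map_one_eq A) (by rw [one_mul]) hL hL'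
    (commens_of_le ha.fin hL) (commens_of_le hb.fin hL')
  obtain ⟨c, hc⟩ := exists_sends_of x ha hb
  exact ⟨c, ha, hb, hL, hL', x, hx, hc⟩

theorem Rep.unique (h : u.Rep L a b c) (h' : u.Rep L a b d) : c = d := by
  obtain ⟨x, hx, hx'⟩ := h.exists_sends
  obtain ⟨y, hy, hy'⟩ := h'.exists_sends
  rw [IsPush.eq_right (u.pushOK_one h.le h.le_map h.basis_left.fin) hy hx] at hy'
  exact hx'.unique h.basis_left h.basis_right hy'

/-- The basic tool for proving equalities in `Ack`: it suffices to compare a single coordinate. -/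
theorem Rep.ext (hf : u.f = v.f) (hu : u.Rep L a b c) (hv : v.Rep L a b c) : u = v := by
  obtain ⟨f, h1, x1⟩ := u
  obtain ⟨f', h2, x2⟩ := v
  obtain rfl : f = f' := hf
  obtain ⟨x, hx, hx'⟩ := hu.exists_sends
  obtain ⟨y, hy, hy'⟩ := hv.exists_sends
  rw [hy'.eq hu.basis_left hx'] at hy
  exact ext_push rfl x rfl hu.le hu.le_map (commens_of_le hu.basis_left.fin hu.le)
    (commens_of_le hu.basis_right.fin hu.le_map) hx hy

theorem exists_of_rep (f : V ≃ₗ[K] V) (hL : L ≤ A) (hL' : L ≤ A.map (f : V →ₗ[K] V))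
    (ha : IsBasisMod A L a) (hb : IsBasisMod (A.map (f : V →ₗ[K] V)) L b) (c : Kˣ) :
    ∃ u : Ack A, u.f = f ∧ u.Rep L a b c := by
  obtain ⟨x, hx⟩ := Metaplectic.exists_sends ha hb c
  have h1 := commens_of_le ha.fin hL
  have h2 := commens_of_le hb.fin hL'
  obtain ⟨z, hz⟩ := exists_isPush_left (g := 1) (A := A) (B := A.map (f : V →ₗ[K] V))
    (L := A ⊓ A.map (f : V →ₗ[K] V))
    ⟨map_one_eq A, inf_le_left, (le_inf hL hL').trans (map_one_eq _).ge, h1.fin⟩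
    ⟨map_one_eq _, inf_le_right, (le_inf hL hL').trans (map_one_eq _).ge, h2.fin⟩ x
  exact ⟨⟨f, h1.trans h2.symm, z⟩, rfl, ha, hb, hL, hL', x, hz, hx⟩

theorem Rep.change (h : u.Rep L a b c) (ha' : IsBasisMod A L a')
    (hb' : IsBasisMod (A.map (u.f : V →ₗ[K] V)) L b')
    (ha : wedge K (a'.map L.mkQ) = d • wedge K (a.map L.mkQ))
    (hb : wedge K (b'.map L.mkQ) = e • wedge K (b.map L.mkQ)) :
    u.Rep L a' b' (c * d * e⁻¹) := by
  obtain ⟨x, hx, hx'⟩ := h.exists_sends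
  exact ⟨ha', hb', h.le, h.le_map, x, hx, hx'.change ha hb⟩

theorem Rep.refine (h : u.Rep L a b c) (hl : IsBasisMod L L' l) (hL : L' ≤ L) :
    u.Rep L' (a ++ l) (b ++ l) c := by
  have ha := h.basis_left.append hl hL h.le
  have hb := h.basis_right.append hl hL h.le_map
  refine ⟨ha, hb, hL.trans h.le, hL.trans h.le_map, ?_⟩
  obtain ⟨x, hx, hx'⟩ := h.exists_sends
  have ok : PushOK 1 A L A L' := ⟨map_one_eq A, h.le, by rwa [map_one_eq], ha.fin⟩
  obtain ⟨y, hy⟩ := exists_isPush ok ⟨map_one_eq _, h.le_map, by rwa [map_one_eq], hb.fin⟩ x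
  refine ⟨y, ?_, ?_⟩
  · have := IsPush.comp (u.pushOK_one h.le h.le_map h.basis_left.fin) ok hx hy
    rwa [mul_one] at this
  · have := hy.sends ok h.basis_left (by rwa [map_one_eq]) hx'
    rwa [show ⇑(1 : V ≃ₗ[K] V) = id from rfl, List.map_id, List.map_id] at this

/-- The target basis of u is the image under u of the source basis of v, so the contraction of the
two tensors just multiplies the scalars. -/
theorem Rep.mul (hu : u.Rep (L.map (u.f : V →ₗ[K] V)) a (a'.map u.f) c)
    (hv : v.Rep L a' b' d) :
    (u * v).Rep (L.map (u.f : V →ₗ[K] V)) a (b'.map u.f) (c * d) := by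
  have e : A.map ((u * v).f : V →ₗ[K] V) = (A.map (v.f : V →ₗ[K] V)).map (u.f : V →ₗ[K] V) :=
    map_mul_eq A
  have hb : IsBasisMod (A.map ((u * v).f : V →ₗ[K] V)) (L.map (u.f : V →ₗ[K] V)) (b'.map u.f) := by
    rw [e]
    exact hv.basis_right.map u.f
  have hle : L.map (u.f : V →ₗ[K] V) ≤ A.map ((u * v).f : V →ₗ[K] V) := by
    rw [e]
    exact Submodule.map_mono hv.le_map
  refine ⟨hu.basis_left, hb, hu.le, hle, ?_⟩
  obtain ⟨x, hx, hx'⟩ := hu.exists_sends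
  obtain ⟨y, hy, hy'⟩ := hv.exists_sends
  have ok : PushOK u.f A L (A.map (u.f : V →ₗ[K] V)) (L.map (u.f : V →ₗ[K] V)) :=
    ⟨rfl, hv.le, le_rfl, hu.basis_right.fin⟩
  obtain ⟨z, hz⟩ := exists_isPush ok
    (B' := A.map ((u * v).f : V →ₗ[K] V)) ⟨e.symm, hv.le_map, le_rfl, hb.fin⟩ y
  have hz' := IsPush.comp (v.pushOK_one hv.le hv.le_map hv.basis_left.fin) ok hy hz
  rw [mul_one] at hz'
  refine ⟨x.trans z, mul_push u v (map_one_eq A) (by rw [one_mul]) (by rw [one_mul]; rfl)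
    hu.le hu.le_map hle (commens_of_le hu.basis_left.fin hu.le) hx (by rwa [one_mul]), ?_⟩
  have := hz.sends ok hv.basis_left (IsBasisMod.nil _) hy'
  rw [List.append_nil, List.append_nil] at this
  exact hx'.trans hu.basis_right this

theorem rep_triv (f : V ≃ₗ[K] V) (h : A.map (f : V →ₗ[K] V) = A) (ha : IsBasisMod A L a)
    (hL : L ≤ A) : (triv f h).Rep L a a 1 := by
  refine ⟨ha, ?_, hL, ?_, DetIso.ofEq h.symm, triv_push f h (map_one_eq A) h.symm hL
    (commens_of_le ha.fin hL), fun α hα => ?_⟩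
  · change IsBasisMod (A.map (f : V →ₗ[K] V)) L a
    rwa [h]
  · change L ≤ A.map (f : V →ₗ[K] V)
    rwa [h]
  · exact (DetIso.inc_ofEq h.symm α).trans (hα.trans (one_smul Kˣ _).symm)

theorem rep_scal (c : Kˣ) (ha : IsBasisMod A L a) (hL : L ≤ A) :
    (scal c : Ack A).Rep L a a c := by
  have e : A.map ((scal c : Ack A).f : V →ₗ[K] V) = A := map_one_eq A
  have hp := scal_push c (map_one_eq A) hL (commens_of_le ha.fin hL)
  have ok := (scal c : Ack A).pushOK_one hL (by rwa [e]) ha.fin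
  refine ⟨ha, ?_, hL, by rwa [e], (LinearEquiv.smulOfUnit c : DetIso A A L).trans
    (DetIso.ofEq e.symm), ?_, fun α hα => ?_⟩
  · rwa [e]
  · exact IsPush.trans ok (isPush_smul ok c) (isPush_ofEq ok _ _)
  · rw [LinearEquiv.trans_apply, DetIso.inc_ofEq, ← hα]
    exact inc_smul (c : K) α

theorem scal_f (c : Kˣ) : (scal c : Ack A).f = 1 := rfl

theorem Rep.scal_mul (h : u.Rep L a b c) (d : Kˣ) : (scal d * u).Rep L a b (d * c) := by
  have e : L.map ((scal d : Ack A).f : V →ₗ[K] V) = L := map_one_eq L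
  have h1 := rep_scal d h.basis_left h.le
  have h2 : (scal d : Ack A).Rep (L.map ((scal d : Ack A).f : V →ₗ[K] V)) a
      (a.map (scal d : Ack A).f) d := by
    rw [e, scal_f, show ⇑(1 : V ≃ₗ[K] V) = id from rfl, List.map_id]
    exact h1
  have h3 := h2.mul h
  rwa [e, scal_f, show ⇑(1 : V ≃ₗ[K] V) = id from rfl, List.map_id] at h3

/-- Two elements over the same automorphism differ by a scalar. -/
theorem exists_scal_mul (h : u.f = v.f) : ∃ c, v = scal c * u := by
  obtain ⟨a, ha⟩ := exists_isBasisMod (L := A ⊓ A.map (u.f : V →ₗ[K] V)) u.comm.1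
  obtain ⟨b, hb⟩ := exists_isBasisMod (L := A ⊓ A.map (u.f : V →ₗ[K] V)) u.comm.2
  obtain ⟨c, hc⟩ := u.exists_rep inf_le_left inf_le_right ha hb
  obtain ⟨d, hd⟩ := v.exists_rep (h ▸ inf_le_left) (h ▸ inf_le_right) ha
    (show IsBasisMod (A.map (v.f : V →ₗ[K] V)) (A ⊓ A.map (u.f : V →ₗ[K] V)) b by
      simpa only [h] using hb)
  refine ⟨d * c⁻¹, hd.ext (h.symm.trans (one_mul _).symm) ?_⟩
  have := hc.scal_mul (d * c⁻¹)
  rwa [inv_mul_cancel_right] at this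

theorem scal_injective : Function.Injective (scal : Kˣ → Ack A) := fun c d h =>
  (rep_scal c (IsBasisMod.nil A) le_rfl).unique (h ▸ rep_scal d (IsBasisMod.nil A) le_rfl)

theorem exists_of_commens (f : V ≃ₗ[K] V) (h : Commens A (A.map (f : V →ₗ[K] V))) :
    ∃ u : Ack A, u.f = f := by
  obtain ⟨a, ha⟩ := exists_isBasisMod (L := A ⊓ A.map (f : V →ₗ[K] V)) h.1
  obtain ⟨b, hb⟩ := exists_isBasisMod (L := A ⊓ A.map (f : V →ₗ[K] V)) h.2
  obtain ⟨u, hu, -⟩ := exists_of_rep f inf_le_left inf_le_right ha hb 1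
  exact ⟨u, hu⟩

theorem IsTriv.mul (hu : u.IsTriv) (hv : v.IsTriv) : (u * v).IsTriv := by
  obtain ⟨h1, h2⟩ := hu
  obtain ⟨h3, h4⟩ := hv
  have h : A.map ((u * v).f : V →ₗ[K] V) = A := by
    rw [mul_f, map_mul_eq, h3, h1]
  refine ⟨h, ?_⟩
  conv_lhs => rw [h2, h4]
  exact (triv_mul _ _ h1 h3 h).symm

theorem isTriv_one : (1 : Ack A).IsTriv := ⟨map_one_eq A, rfl⟩

theorem isTriv_triv (f : V ≃ₗ[K] V) (h : A.map (f : V →ₗ[K] V) = A) : (triv f h).IsTriv :=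
  ⟨h, rfl⟩

theorem IsTriv.eq (hu : u.IsTriv) (hv : v.IsTriv) (h : u.f = v.f) : u = v := by
  obtain ⟨h1, h2⟩ := hu
  obtain ⟨h3, h4⟩ := hv
  rw [h2, h4]
  simp only [h]

/-- With L = A the bases are empty. Conversely, an empty basis of fA modulo A forces fA ≤ A, while
the definition of a coordinate in A already contains A ≤ fA. -/
theorem isTriv_iff : u.IsTriv ↔ u.Rep A [] [] 1 := by
  constructor
  · rintro ⟨h1, h2⟩
    rw [h2]
    exact rep_triv _ h1 (IsBasisMod.nil A) le_rfl
  · intro h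
    have h1 : A.map (u.f : V →ₗ[K] V) = A := by
      refine le_antisymm ?_ h.le_map
      have := h.basis_right.le_span
      simpa using this
    exact ⟨h1, h.ext rfl (rep_triv _ h1 (IsBasisMod.nil A) le_rfl)⟩

end Ack

end

section

open Module

set_option linter.unusedSectionVars false

/-! ### Restriction of scalars and the norm of a determinant line -/

section ScaleList

variable (K : Type*) [Field K] {K' : Type*} [Field K'] [Algebra K K'] [FiniteDimensional K K']
  {V W : Type*} [AddCommGroup V] [Module K V] [Module K' V] [IsScalarTower K K' V]
  [AddCommGroup W] [Module K W] [Module K' W] [IsScalarTower K K' W]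

variable (K') in
/-- The list obtained from a list of vectors by replacing each `e` by `b_1 e, …, b_d e`, where
`b_1, …, b_d` is a basis of `K'` over `K`. -/
def scaleList (a : List V) : List V :=
  a.flatMap fun e => List.ofFn fun i => finBasis K K' i • e

theorem scaleList_append (a b : List V) :
    scaleList K K' (a ++ b) = scaleList K K' a ++ scaleList K K' b := by
  simp [scaleList]

theorem map_scaleList (f : V →ₗ[K'] W) (a : List V) :
    (scaleList K K' a).map f = scaleList K K' (a.map f) := by
  simp only [scaleList, List.map_flatMap, List.flatMap_map, List.map_ofFn]
  congr 1
  funext e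
  congr 1
  funext i
  simp

theorem length_scaleList (a : List V) :
    (scaleList K K' a).length = a.length * finrank K K' := by
  simp [scaleList]

theorem mem_scaleList {a : List V} {x : V} :
    x ∈ scaleList K K' a ↔ ∃ e ∈ a, ∃ i, finBasis K K' i • e = x := by
  simp [scaleList]

theorem span_scaleList (a : List V) :
    Submodule.span K {x | x ∈ scaleList K K' a} =
      (Submodule.span K' {x | x ∈ a}).restrictScalars K := by
  refine le_antisymm (Submodule.span_le.2 fun x hx => ?_) fun x hx => ?_
  · obtain ⟨e, he, i, rfl⟩ := (mem_scaleList K).1 hx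
    exact Submodule.smul_mem (Submodule.span K' {x | x ∈ a}) _ (Submodule.subset_span he)
  · refine Submodule.span_induction (p := fun x _ => x ∈ Submodule.span K _) ?_
      (Submodule.zero_mem _) (fun x y _ _ => Submodule.add_mem _) ?_ hx
    · intro e he
      -- The chosen basis of K' need not contain 1, so e is recovered by expanding 1 in it.
      have h1 : e = ∑ i, (finBasis K K').repr 1 i • finBasis K K' i • e := by
        simp_rw [← smul_assoc]
        rw [← Finset.sum_smul, Basis.sum_repr, one_smul]
      rw [h1]
      exact Submodule.sum_mem _ fun i _ => Submodule.smul_mem _ _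
        (Submodule.subset_span ((mem_scaleList K).2 ⟨e, he, i, rfl⟩))
    · intro c x _ hx
      refine Submodule.span_induction (p := fun x _ => c • x ∈ Submodule.span K _) ?_
        (by simp) (fun x y _ _ hx hy => by rw [smul_add]; exact Submodule.add_mem _ hx hy)
        (fun d x _ hx => by rw [smul_comm]; exact Submodule.smul_mem _ _ hx) hx
      intro x hx
      obtain ⟨e, he, i, rfl⟩ := (mem_scaleList K).1 hx
      rw [smul_smul, ← (finBasis K K').sum_repr (c * _), Finset.sum_smul]
      refine Submodule.sum_mem _ fun j _ => ?_
      rw [smul_assoc]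
      exact Submodule.smul_mem _ _ (Submodule.subset_span ((mem_scaleList K).2 ⟨e, he, j, rfl⟩))

/-- The K'-linear map φ taking a to b has determinant c; over K it takes one extended basis to the
other and its determinant is N(c). This transitivity of determinants is the source of all norms
below. -/
theorem wedge_scaleList_eq [FiniteDimensional K' W] {a b : List W}
    (ha : a.length = finrank K' W) (ha' : Submodule.span K' {x | x ∈ a} = ⊤)
    (hb : b.length = finrank K' W) {c : K'} (h : wedge K' b = c • wedge K' a) :
    wedge K (scaleList K K' b) = Algebra.norm K c • wedge K (scaleList K K' a) := by
  let e := listBasis a ha ha'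
  have he : (e : _ → W) = fun i => a[i] := listBasis_apply a ha ha'
  let φ : W →ₗ[K'] W := e.constr K' fun i => b[i.1]'(by rw [hb, ← ha]; exact i.2)
  have hφ : a.map φ = b := by
    refine List.ext_getElem (by simp [ha, hb]) fun i hi hi' => ?_
    rw [List.length_map] at hi
    rw [List.getElem_map]
    have h1 : a[i] = e ⟨i, hi⟩ := by rw [he]; rfl
    rw [h1, Basis.constr_basis]
  have h2 : LinearMap.det φ = c := by
    rw [← hφ, wedge_map_eq_det φ ha ha'] at h
    exact smul_left_injective K' (wedge_ne_zero ha ha') h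
  have : FiniteDimensional K W := FiniteDimensional.trans K K' W
  have h3 := wedge_map_eq_det (φ.restrictScalars K) (l := scaleList K K' a)
    (by rw [length_scaleList, ha, mul_comm, finrank_mul_finrank])
    (by rw [span_scaleList, ha', Submodule.restrictScalars_top])
  rw [LinearMap.det_restrictScalars, h2] at h3
  rw [← h3, ← hφ, ← map_scaleList]
  rfl

variable {A L : Submodule K' V} {a b : List V}

theorem map_mkQ_restrictScalars (a : List V) :
    ((a.map L.mkQ).map ((Submodule.Quotient.restrictScalarsEquiv K L).symm :
      (V ⧸ L) →ₗ[K] (V ⧸ L.restrictScalars K))) = a.map (L.restrictScalars K).mkQ := by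
  rw [List.map_map]
  rfl

theorem finrank_quo_restrictScalars :
    finrank K (Quo (A.restrictScalars K) (L.restrictScalars K)) =
      finrank K K' * finrank K' (Quo A L) := by
  rw [finrank_mul_finrank]
  have h : (((Quo A L).restrictScalars K).map ((Submodule.Quotient.restrictScalarsEquiv K L).symm :
      (V ⧸ L) →ₗ[K] (V ⧸ L.restrictScalars K))) =
      Quo (A.restrictScalars K) (L.restrictScalars K) := by
    ext x
    constructor
    · rintro ⟨_, ⟨y, hy, rfl⟩, rfl⟩
      exact ⟨y, hy, rfl⟩
    · rintro ⟨y, hy, rfl⟩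
      exact ⟨_, ⟨y, hy, rfl⟩, rfl⟩
  rw [← h]
  exact (LinearEquiv.submoduleMap _ _).finrank_eq.symm

theorem IsBasisMod.restrictScalars (h : IsBasisMod A L a) :
    IsBasisMod (A.restrictScalars K) (L.restrictScalars K) (scaleList K K' a) := by
  refine ⟨fun x hx => ?_, ?_, ?_⟩
  · obtain ⟨e, he, i, rfl⟩ := (mem_scaleList K).1 hx
    exact A.smul_mem _ (h.mem e he)
  · rw [span_scaleList, ← Submodule.restrictScalars_sup]
    exact h.le_span
  · rw [length_scaleList, h.length, finrank_quo_restrictScalars, mul_comm]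

theorem IsBasisMod.wedge_scaleList (ha : IsBasisMod A L a) (hb : IsBasisMod A L b) {c : K'ˣ}
    (h : wedge K' (b.map L.mkQ) = c • wedge K' (a.map L.mkQ)) :
    wedge K ((scaleList K K' b).map (L.restrictScalars K).mkQ) =
      Units.map (Algebra.norm K) c •
        wedge K ((scaleList K K' a).map (L.restrictScalars K).mkQ) := by
  have := ha.fin
  obtain ⟨a', h1, h2, h3⟩ := ha.lift
  obtain ⟨b', h4, h5, h6⟩ := hb.lift
  have h7 : wedge K' b' = (c : K') • wedge K' a' := by
    refine ExteriorAlgebra.map_injective_field (Submodule.ker_subtype (Quo A L)) ?_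
    rw [map_smul, map_wedge, map_wedge, h1, h4, h]
    rfl
  have h8 := wedge_scaleList_eq K h2 h3 h5 h7
  have key (l : List V) (l' : List (Quo A L)) (hl : l'.map (Quo A L).subtype = l.map L.mkQ) :
      (scaleList K K' l).map (L.restrictScalars K).mkQ =
        (scaleList K K' l').map ((Submodule.Quotient.restrictScalarsEquiv K L).symm.toLinearMap ∘ₗ
          (Quo A L).subtype.restrictScalars K) := by
    rw [← map_mkQ_restrictScalars, map_scaleList, ← hl, ← map_scaleList, List.map_map]
    rfl
  rw [key b b' h4, key a a' h1, ← map_wedge, ← map_wedge, h8, map_smul]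
  rfl

end ScaleList

namespace Ack

variable {K : Type*} [Field K] {K' : Type*} [Field K'] [Algebra K K'] [FiniteDimensional K K']
  {V : Type*} [AddCommGroup V] [Module K V] [Module K' V] [IsScalarTower K K' V]
  {A : Submodule K' V} {A' : Submodule K V}

/-- `u'` is the image of `u` under the norm. -/
def IsNorm (u : Ack A) (u' : Ack A') : Prop :=
  u'.f = u.f.restrictScalars K ∧ ∀ L a b c, u.Rep L a b c →
    u'.Rep (L.restrictScalars K) (scaleList K K' a) (scaleList K K' b)
      (Units.map (Algebra.norm K) c)

/-- The norm is prescribed by a coordinate in the largest common sublattice L₀ = A ∩ fA. Any other L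
admitted in a coordinate lies in L₀, so refinement and change of bases give the formula there as
well. -/
theorem exists_isNorm (hA : A' = A.restrictScalars K) (u : Ack A) :
    ∃ u' : Ack A', IsNorm u u' := by
  subst hA
  obtain ⟨a₀, ha₀⟩ := exists_isBasisMod (L := A ⊓ A.map (u.f : V →ₗ[K'] V)) u.comm.1
  obtain ⟨b₀, hb₀⟩ := exists_isBasisMod (L := A ⊓ A.map (u.f : V →ₗ[K'] V)) u.comm.2
  obtain ⟨c₀, hc₀⟩ := u.exists_rep inf_le_left inf_le_right ha₀ hb₀
  obtain ⟨u', hu', hr⟩ := exists_of_rep (A := A.restrictScalars K) (u.f.restrictScalars K)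
    (L := (A ⊓ A.map (u.f : V →ₗ[K'] V)).restrictScalars K)
    (inf_le_left : A ⊓ A.map (u.f : V →ₗ[K'] V) ≤ A)
    (inf_le_right : A ⊓ A.map (u.f : V →ₗ[K'] V) ≤ _)
    (ha₀.restrictScalars K) (hb₀.restrictScalars K) (Units.map (Algebra.norm K) c₀)
  refine ⟨u', hu', fun L a b c h => ?_⟩
  set L₀ := A ⊓ A.map (u.f : V →ₗ[K'] V)
  have e : (A.restrictScalars K).map (u'.f : V →ₗ[K] V) =
    (A.map (u.f : V →ₗ[K'] V)).restrictScalars K := by rw [hu']; rfl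
  have hL : L ≤ L₀ := le_inf h.le h.le_map
  obtain ⟨l, hl⟩ := exists_isBasisMod (fin_quo_mono inf_le_left le_rfl h.basis_left.fin :
    FiniteDimensional K' (Quo L₀ L))
  have h1 := hc₀.refine hl hL
  have h2 := hr.refine (hl.restrictScalars K) hL
  rw [← scaleList_append, ← scaleList_append] at h2
  obtain ⟨d, hd⟩ := h1.basis_left.exists_smul h.basis_left
  obtain ⟨d', hd'⟩ := h1.basis_right.exists_smul h.basis_right
  -- The base-change factors d and d' over K' become their norms over K, so multiplicativity of the
  -- norm matches the two changes of coordinates.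
  have h3 := h1.change h.basis_left h.basis_right hd hd'
  rw [h.unique h3]
  simp only [map_mul, map_inv]
  exact h2.change (h.basis_left.restrictScalars K) (e ▸ h.basis_right.restrictScalars K)
    (h1.basis_left.wedge_scaleList K h.basis_left hd)
    (h1.basis_right.wedge_scaleList K h.basis_right hd')

theorem IsNorm.eq {u : Ack A} {u' u'' : Ack A'} (h : IsNorm u u') (h' : IsNorm u u'') :
    u' = u'' := by
  obtain ⟨a, ha⟩ := exists_isBasisMod (L := A ⊓ A.map (u.f : V →ₗ[K'] V)) u.comm.1
  obtain ⟨b, hb⟩ := exists_isBasisMod (L := A ⊓ A.map (u.f : V →ₗ[K'] V)) u.comm.2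
  obtain ⟨c, hc⟩ := u.exists_rep inf_le_left inf_le_right ha hb
  exact (h.2 _ _ _ _ hc).ext (h.1.trans h'.1.symm) (h'.2 _ _ _ _ hc)

/-- A single coordinate suffices, since the norm exists and is determined by any one of its
coordinates. -/
theorem isNorm_of_rep (hA : A' = A.restrictScalars K) {u : Ack A} {u' : Ack A'}
    (hf : u'.f = u.f.restrictScalars K) {L : Submodule K' V} {a b : List V} {c : K'ˣ}
    (h : u.Rep L a b c) (h' : u'.Rep (L.restrictScalars K) (scaleList K K' a)
      (scaleList K K' b) (Units.map (Algebra.norm K) c)) : IsNorm u u' := by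
  obtain ⟨u'', h''⟩ := exists_isNorm hA u
  rwa [h'.ext (hf.trans h''.1.symm) (h''.2 _ _ _ _ h)]

/-- For lattices `A ⊇ L`, the sublattice of `L` contained in its image under `f⁻¹`. -/
theorem exists_common (u v : Ack A) : ∃ (L : Submodule K' V) (a a' b' : List V) (c d : K'ˣ),
    u.Rep (L.map (u.f : V →ₗ[K'] V)) a (a'.map u.f) c ∧ v.Rep L a' b' d := by
  -- The last factor ensures uL ≤ A, so that uL is a common sublattice for u while L is one for v,
  -- the shape required by `Rep.mul`.
  let L := A ⊓ A.map (v.f : V →ₗ[K'] V) ⊓ A.map ((u⁻¹).f : V →ₗ[K'] V)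
  have e : (A.map ((u⁻¹).f : V →ₗ[K'] V)).map (u.f : V →ₗ[K'] V) = A := by
    rw [← map_mul_eq, inv_f, mul_inv_cancel, map_one_eq]
  have cL : Commens A L := ((Commens.refl A).inf v.comm).inf (u⁻¹).comm
  have l1 : L ≤ A := inf_le_left.trans inf_le_left
  have l2 : L ≤ A.map (v.f : V →ₗ[K'] V) := inf_le_left.trans inf_le_right
  obtain ⟨a', ha'⟩ := exists_isBasisMod cL.fin
  obtain ⟨b', hb'⟩ := exists_isBasisMod (v.comm.symm.trans cL).fin
  have cL' : Commens A (L.map (u.f : V →ₗ[K'] V)) := u.comm.trans (cL.map _)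
  obtain ⟨a, ha⟩ := exists_isBasisMod cL'.fin
  obtain ⟨c, hc⟩ := u.exists_rep (L := L.map (u.f : V →ₗ[K'] V))
    ((Submodule.map_mono inf_le_right).trans e.le) (Submodule.map_mono l1) ha (ha'.map u.f)
  obtain ⟨d, hd⟩ := v.exists_rep l1 l2 ha' hb'
  exact ⟨L, a, a', b', c, d, hc, hd⟩

theorem IsNorm.mul (hA : A' = A.restrictScalars K) {u v : Ack A} {u' v' : Ack A'}
    (hu : IsNorm u u') (hv : IsNorm v v') : IsNorm (u * v) (u' * v') := by
  obtain ⟨L, a, a', b', c, d, h1, h2⟩ := exists_common u v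
  have hf : (u' * v').f = (u * v).f.restrictScalars K := by
    rw [mul_f, mul_f, hu.1, hv.1]; rfl
  refine isNorm_of_rep hA hf (h1.mul h2) ?_
  have h3 := hu.2 _ _ _ _ h1
  have h4 := hv.2 _ _ _ _ h2
  have e1 : (L.map (u.f : V →ₗ[K'] V)).restrictScalars K =
    (L.restrictScalars K).map (u'.f : V →ₗ[K] V) := by rw [hu.1]; rfl
  have e2 (l : List V) : scaleList K K' (l.map u.f) = (scaleList K K' l).map u'.f := by
    rw [hu.1]
    exact (map_scaleList K (u.f : V →ₗ[K'] V) l).symm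
  rw [e1, e2] at h3
  rw [e1, e2, map_mul]
  exact h3.mul h4

/-- The norm from the extension over `K'` to the extension over `K`. -/
def normHom (hA : A' = A.restrictScalars K) : Ack A →* Ack A' :=
  MonoidHom.mk' (fun u => (exists_isNorm hA u).choose) fun u v =>
    (exists_isNorm hA (u * v)).choose_spec.eq
      ((exists_isNorm hA u).choose_spec.mul hA (exists_isNorm hA v).choose_spec)

theorem isNorm_normHom (hA : A' = A.restrictScalars K) (u : Ack A) : IsNorm u (normHom hA u) :=
  (exists_isNorm hA u).choose_spec

theorem normHom_scal (hA : A' = A.restrictScalars K) (c : K'ˣ) :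
    normHom hA (scal c) = scal (Units.map (Algebra.norm K) c) := by
  refine (isNorm_normHom hA _).eq (isNorm_of_rep hA rfl (rep_scal c (IsBasisMod.nil A) le_rfl) ?_)
  subst hA
  exact rep_scal _ (IsBasisMod.nil _) le_rfl

theorem IsTriv.normHom (hA : A' = A.restrictScalars K) {u : Ack A} (h : u.IsTriv) :
    (normHom hA u).IsTriv := by
  rw [isTriv_iff] at h ⊢
  have := (isNorm_normHom hA u).2 _ _ _ _ h
  rwa [map_one, ← hA] at this

end Ack

end

/-! ### Canonical lifts attached to stable lattices -/

section

open Module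

/-- The characteristic polynomial of the nilpotent map 1 - φ is a power of X; its value at 1 is both
1 and det φ. -/
theorem det_eq_one_of_isNilpotent {K W : Type*} [Field K] [AddCommGroup W] [Module K W]
    [FiniteDimensional K W] (φ : W →ₗ[K] W) (h : IsNilpotent (φ - 1)) : LinearMap.det φ = 1 := by
  have h1 : IsNilpotent (1 - φ) := by
    rw [← neg_sub]
    exact h.neg
  have h2 := LinearMap.eval_charpoly (1 - φ) 1
  rw [h1.charpoly_eq_X_pow_finrank] at h2
  simpa using h2.symm

namespace Ack

variable {K : Type*} [Field K] {V : Type*} [AddCommGroup V] [Module K V]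
  {A M M' : Submodule K V} {a : List V} {u v : Ack A}

/-- For a lattice `M` with `fM = M`, the element `u = (f, x)` corresponds to `1 ∈ (M | fM) = K`,
i.e. `x` is the isomorphism `⋀ A/M → ⋀ fA/M` induced by `f`. -/
def IsCanon (u : Ack A) (M : Submodule K V) : Prop :=
  M.map (u.f : V →ₗ[K] V) = M ∧ ∃ a, u.Rep M a (a.map u.f) 1

theorem wedge_map_mkQ_map {f : V ≃ₗ[K] V} (hf : M.map (f : V →ₗ[K] V) = M) (a : List V) :
    ExteriorAlgebra.map (M.mapQ M (f : V →ₗ[K] V) (Submodule.map_le_iff_le_comap.1 hf.le))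
      (wedge K (a.map M.mkQ)) = wedge K ((a.map f).map M.mkQ) := by
  rw [map_wedge, List.map_map, List.map_map]
  rfl

/-- Since f acts on V/M, a change of basis of A/M and the corresponding change of its image involve
the same scalar, which cancels. -/
theorem IsCanon.rep (h : u.IsCanon M) (ha : IsBasisMod A M a) : u.Rep M a (a.map u.f) 1 := by
  obtain ⟨hM, b, hb⟩ := h
  obtain ⟨d, hd⟩ := hb.basis_left.exists_smul ha
  have h1 := ha.map u.f
  rw [hM] at h1
  have h2 := congrArg (ExteriorAlgebra.map
    (M.mapQ M (u.f : V →ₗ[K] V) (Submodule.map_le_iff_le_comap.1 hM.le))) hd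
  rw [wedge_map_mkQ_map hM, Units.smul_def, map_smul, wedge_map_mkQ_map hM] at h2
  have := hb.change ha h1 hd h2
  rwa [one_mul, mul_inv_cancel] at this

theorem IsCanon.fin (h : u.IsCanon M) : FiniteDimensional K (Quo A M) :=
  h.2.choose_spec.basis_left.fin

theorem IsCanon.ext (hu : u.IsCanon M) (hv : v.IsCanon M) (h : u.f = v.f) : u = v := by
  obtain ⟨a, ha⟩ := hu.2
  have h1 := hv.rep ha.basis_left
  rw [← h] at h1
  exact ha.ext h h1

theorem exists_isCanon (f : V ≃ₗ[K] V) (hf : M.map (f : V →ₗ[K] V) = M) (hM : M ≤ A)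
    (h : FiniteDimensional K (Quo A M)) : ∃ u : Ack A, u.f = f ∧ u.IsCanon M := by
  obtain ⟨a, ha⟩ := exists_isBasisMod h
  have h1 := ha.map f
  rw [hf] at h1
  obtain ⟨u, rfl, hu⟩ := exists_of_rep f hM (hf.ge.trans (Submodule.map_mono hM)) ha h1 1
  exact ⟨u, rfl, hf, a, hu⟩

theorem det_mapQ_restrict_eq_one {f : V ≃ₗ[K] V} (hn : IsNilpotent ((f : V →ₗ[K] V) - 1))
    (φ : Quo M M' →ₗ[K] Quo M M') (h : FiniteDimensional K (Quo M M'))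
    (hM : ∀ x ∈ M, f x ∈ M)
    (hφ : ∀ x (hx : x ∈ M), (φ ⟨M'.mkQ x, Submodule.mem_map_of_mem hx⟩ : V ⧸ M') = M'.mkQ (f x)) :
    LinearMap.det φ = 1 := by
  refine det_eq_one_of_isNilpotent φ ?_
  obtain ⟨n, hn⟩ := hn
  refine ⟨n, LinearMap.ext fun x => Subtype.ext ?_⟩
  -- Powers of φ - 1 on the subquotient are induced by powers of f - 1, so nilpotency descends.
  have key (m : ℕ) (x : V) (hx : x ∈ M) :
      (((φ - 1) ^ m) ⟨M'.mkQ x, Submodule.mem_map_of_mem hx⟩ : V ⧸ M') =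
        M'.mkQ ((((f : V →ₗ[K] V) - 1) ^ m) x) := by
    induction m generalizing x with
    | zero => rfl
    | succ m ih =>
      have hx' : f x - x ∈ M := sub_mem (hM x hx) hx
      have h1 : (φ - 1) ⟨M'.mkQ x, Submodule.mem_map_of_mem hx⟩ =
          (⟨M'.mkQ (f x - x), Submodule.mem_map_of_mem hx'⟩ : Quo M M') := Subtype.ext (by
        change (φ ⟨M'.mkQ x, _⟩ : V ⧸ M') - M'.mkQ x = _
        rw [hφ x hx, ← map_sub])
      rw [pow_succ, pow_succ, Module.End.mul_apply, Module.End.mul_apply, h1, ih _ hx']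
      rfl
  obtain ⟨_, y, hy, rfl⟩ := x
  rw [key n y hy, hn]
  simp

/-- Refinement appends the same basis l of M/M' on both sides, whereas the canonical element appends
f(l) on the target. The two differ by the determinant of f on M/M', which is 1 because f - 1 is
nilpotent. -/
theorem IsCanon.mono (h : u.IsCanon M) (hn : IsNilpotent ((u.f : V →ₗ[K] V) - 1)) (hM : M' ≤ M)
    (hf : M'.map (u.f : V →ₗ[K] V) = M') (hfin : FiniteDimensional K (Quo A M')) :
    u.IsCanon M' := by
  obtain ⟨h1, a, ha⟩ := h
  have hfin' : FiniteDimensional K (Quo M M') := fin_quo_mono ha.le le_rfl hfin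
  obtain ⟨l, hl⟩ := exists_isBasisMod hfin'
  refine ⟨hf, a ++ l, ?_⟩
  have h2 := ha.refine hl hM
  have h3 : IsBasisMod (A.map (u.f : V →ₗ[K] V)) M' ((a ++ l).map u.f) := by
    have := h2.basis_left.map u.f
    rwa [hf] at this
  let φ : Quo M M' →ₗ[K] Quo M M' :=
    (M'.mapQ M' (u.f : V →ₗ[K] V) (Submodule.map_le_iff_le_comap.1 hf.le)).restrict (by
      rintro _ ⟨x, hx, rfl⟩
      exact ⟨u.f x, h1.le (Submodule.mem_map_of_mem hx), rfl⟩)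
  have h4 := hl.wedge_map φ u.f fun x hx => rfl
  rw [det_mapQ_restrict_eq_one hn φ hfin' (fun x hx => h1.le (Submodule.mem_map_of_mem hx))
    fun x hx => rfl, one_smul] at h4
  have h5 : wedge K (((a ++ l).map u.f).map M'.mkQ) =
      (1 : Kˣ) • wedge K ((a.map u.f ++ l).map M'.mkQ) := by
    rw [one_smul, List.map_append, List.map_append, List.map_append, wedge_append, wedge_append,
      h4]
  have := h2.change h2.basis_left h3 (one_smul _ _).symm h5
  simpa using this

/-- The canonical elements of M and M' are compared in the stable lattice M ∩ M'. This is the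
independence of 𝔡_n from the lattice. -/
theorem IsCanon.of_stable (h : u.IsCanon M) (hn : IsNilpotent ((u.f : V →ₗ[K] V) - 1))
    (hM : M' ≤ A) (hf : M'.map (u.f : V →ₗ[K] V) = M') (hfin : FiniteDimensional K (Quo A M')) :
    u.IsCanon M' := by
  obtain ⟨v, hv, hc⟩ := exists_isCanon u.f hf hM hfin
  have h1 : (M ⊓ M').map (u.f : V →ₗ[K] V) = M ⊓ M' := by
    rw [Submodule.map_inf _ u.f.injective, h.1, hf]
  have h2 := fin_quo_inf h.fin hfin
  have h3 := h.mono hn inf_le_left h1 h2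
  have h4 := hc.mono (hv ▸ hn) inf_le_right (hv ▸ h1) h2
  rwa [h3.ext h4 hv.symm]

theorem IsCanon.mul (hu : u.IsCanon M) (hv : v.IsCanon M) : (u * v).IsCanon M := by
  obtain ⟨a, ha⟩ := hv.2
  have h1 := hu.rep ha.basis_left
  refine ⟨by rw [mul_f, map_mul_eq, hv.1, hu.1], a, ?_⟩
  have h2 : u.Rep (M.map (u.f : V →ₗ[K] V)) a (a.map u.f) 1 := by rwa [hu.1]
  have := h2.mul ha
  rw [hu.1, List.map_map, one_mul] at this
  exact this

/-- Take for g a coordinate with target basis g(a), where a is a basis of A/M. Both products then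
have the same scalar as g, and their target bases x'g(a) and gx(a) coincide. -/
theorem IsCanon.mul_comm {g x x' : Ack A} (hx : x.IsCanon M)
    (hx' : x'.IsCanon (M.map (g.f : V →ₗ[K] V))) (h : x'.f * g.f = g.f * x.f) :
    x' * g = g * x := by
  obtain ⟨a, ha⟩ := hx.2
  obtain ⟨e, he⟩ := hx'.2
  obtain ⟨c, hc⟩ := g.exists_rep (L := M.map (g.f : V →ₗ[K] V)) (a := e) (b := a.map g.f) he.le
    (Submodule.map_mono ha.le) he.basis_left (ha.basis_left.map g.f)
  have h1 : x'.Rep ((M.map (g.f : V →ₗ[K] V)).map (x'.f : V →ₗ[K] V)) e (e.map x'.f) 1 := by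
    rwa [hx'.1]
  have h2 := h1.mul hc
  have h3 := hc.mul ha
  rw [List.map_map, show ⇑x'.f ∘ ⇑g.f = ⇑g.f ∘ ⇑x.f from congrArg DFunLike.coe h, one_mul,
    hx'.1, ← List.map_map] at h2
  rw [mul_one] at h3
  exact h2.ext h h3

theorem isCanon_triv (f : V ≃ₗ[K] V) (h : A.map (f : V →ₗ[K] V) = A) : (triv f h).IsCanon A :=
  ⟨h, [], rep_triv f h (IsBasisMod.nil A) le_rfl⟩

end Ack

end

section

open Module WithZero Matrix

set_option linter.unusedSectionVars false

/-! ### The lattices 𝔭^n and their finite-dimensional quotients -/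

section Lattices

variable (K : Type*) [Field K] {F : Type*} [Field F] [Algebra K F] (v : Valuation F ℤᵐ⁰) (r : ℕ)

/-- The residue field of `v` is finite over `K`, and `v` has a uniformiser. -/
class FiniteResidue [IntegralConstants K v] : Prop where
  fin : FiniteDimensional K (Quo (lat1 K v 0) (lat1 K v 1))
  exists_uniformizer : ∃ π, v π = exp (-1 : ℤ)

variable [IntegralConstants K v]

variable {K v r}

theorem mem_lat1 {n : ℤ} {x : F} : x ∈ lat1 K v n ↔ v x ≤ exp (-n) := Iff.rfl

theorem mem_lat {n : ℤ} {x : Fin r → F} : x ∈ lat K v r n ↔ ∀ i, v (x i) ≤ exp (-n) := by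
  simp [lat, mem_lat1, -WithZero.exp_neg]

theorem lat1_anti {m n : ℤ} (h : m ≤ n) : lat1 K v n ≤ lat1 K v m := fun _ hx =>
  le_trans hx (exp_le_exp.2 (neg_le_neg h))

theorem lat_anti {m n : ℤ} (h : m ≤ n) : lat K v r n ≤ lat K v r m := fun _ hx =>
  mem_lat.2 fun i => lat1_anti (K := K) h (mem_lat.1 hx i)

theorem map_act1_lat1 {u : Fˣ} {m : ℤ} (hu : v u = exp (-m)) (n : ℤ) :
    (lat1 K v n).map (act1 K F u : F →ₗ[K] F) = lat1 K v (n + m) := by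
  have key (u : Fˣ) (m n : ℤ) (hu : v u = exp (-m)) :
      (lat1 K v n).map (act1 K F u : F →ₗ[K] F) ≤ lat1 K v (n + m) := by
    rintro _ ⟨x, hx, rfl⟩
    change v ((u : F) * x) ≤ _
    rw [map_mul, hu, neg_add_rev, WithZero.exp_add]
    exact mul_le_mul_right hx _
  refine le_antisymm (key u m n hu) ?_
  have h1 := key u⁻¹ (-m) (n + m) (by rw [Units.val_inv_eq_inv_val, map_inv₀, hu, WithZero.exp_neg (-m)])
  rw [add_neg_cancel_right] at h1
  have := Submodule.map_mono (f := (act1 K F u : F →ₗ[K] F)) h1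
  rwa [← map_mul_eq, ← map_mul, mul_inv_cancel, map_one, Ack.map_one_eq] at this

theorem exists_val_eq (u : Fˣ) : ∃ m : ℤ, v u = exp (-m) :=
  ⟨-log (v u), by rw [neg_neg, exp_log ((Valuation.ne_zero_iff v).2 u.ne_zero)]⟩

variable (K v) in
theorem exists_map_act1_lat1 (u : Fˣ) :
    ∃ m : ℤ, ∀ n, (lat1 K v n).map (act1 K F u : F →ₗ[K] F) = lat1 K v (n + m) := by
  obtain ⟨m, hm⟩ := exists_val_eq (v := v) u
  exact ⟨m, map_act1_lat1 hm⟩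

section Finite

variable [FiniteResidue K v]

variable (K v) in
theorem exists_shift (m : ℤ) :
    ∃ u : Fˣ, ∀ n, (lat1 K v n).map (act1 K F u : F →ₗ[K] F) = lat1 K v (n + m) := by
  obtain ⟨π, hπ⟩ := FiniteResidue.exists_uniformizer K (v := v)
  have h0 : π ≠ 0 := by
    rintro rfl
    rw [map_zero] at hπ
    exact exp_ne_zero hπ.symm
  refine ⟨Units.mk0 π h0 ^ m, map_act1_lat1 ?_⟩
  rw [Units.val_zpow_eq_zpow_val, map_zpow₀, Units.val_mk0, hπ, ← WithZero.exp_zsmul]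
  rw [smul_eq_mul, mul_neg_one]

/-- Each successive quotient of the filtration is the image of 𝒪/𝔭 under multiplication by an
element of the appropriate valuation. -/
theorem fin_lat1 (m n : ℤ) : FiniteDimensional K (Quo (lat1 K v m) (lat1 K v n)) := by
  rcases le_total n m with h | h
  · exact fin_quo_mono le_rfl (lat1_anti h) (fin_quo_self _)
  · obtain ⟨d, rfl⟩ := Int.le.dest h
    induction d with
    | zero =>
      rw [Nat.cast_zero, add_zero]
      exact fin_quo_self _
    | succ d ih =>
      refine fin_quo_trans (ih (by simp)) ?_
      obtain ⟨u, hu⟩ := exists_shift K v (m + d)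
      have := fin_quo_map (act1 K F u : F →ₗ[K] F) (FiniteResidue.fin (K := K) (v := v))
      rwa [hu, hu, zero_add, add_comm 1, add_assoc, ← Nat.cast_succ] at this

theorem finrank_quo_map {V : Type*} [AddCommGroup V] [Module K V] {A L : Submodule K V}
    (g : V ≃ₗ[K] V) (h : FiniteDimensional K (Quo A L)) :
    finrank K (Quo (A.map (g : V →ₗ[K] V)) (L.map (g : V →ₗ[K] V))) = finrank K (Quo A L) := by
  obtain ⟨a, ha⟩ := exists_isBasisMod h
  rw [← ha.length, ← (ha.map g).length, List.length_map]

theorem even_finrank_lat1 {m n : ℤ} (h : m ≤ n) (he : Even (n - m)) :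
    Even (finrank K (Quo (lat1 K v m) (lat1 K v n))) := by
  obtain ⟨d, hd⟩ := he
  -- Multiplication by u identifies the two halves 𝔭^m/𝔭^(m+d) and 𝔭^(m+d)/𝔭^(m+2d), so the
  -- dimension is twice that of one half.
  obtain ⟨u, hu⟩ := exists_shift K v d
  have h1 := finrank_quo_map (act1 K F u) (fin_lat1 (K := K) (v := v) m (m + d))
  rw [hu, hu, show m + d + d = n by omega] at h1
  rw [finrank_quo_add (lat1_anti (by omega : m + d ≤ n)) (lat1_anti (by omega)) (fin_lat1 _ _), h1]
  exact ⟨_, rfl⟩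

theorem fin_lat (m n : ℤ) : FiniteDimensional K (Quo (lat K v r m) (lat K v r n)) := by
  obtain ⟨N, hN, h⟩ := fin_quo_iff.1 (fin_lat1 (K := K) (v := v) m n)
  refine fin_quo_iff.2 ⟨⨆ i, N.map (LinearMap.single K (fun _ : Fin r => F) i),
    Submodule.fg_iSup _ fun i => hN.map _, fun x hx => ?_⟩
  have h1 (i : Fin r) : ∃ y ∈ lat1 K v n, ∃ z ∈ N, y + z = x i :=
    Submodule.mem_sup.1 (h (mem_lat.1 hx i))
  choose y hy z hz hyz using h1
  have h2 : x = y + ∑ i, LinearMap.single K (fun _ : Fin r => F) i (z i) := by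
    refine funext fun i => ?_
    rw [Pi.add_apply, Finset.sum_apply, Finset.sum_eq_single i]
    · simp [hyz]
    · intro j _ hj
      simp [Pi.single_eq_of_ne hj.symm]
    · simp
  rw [h2]
  exact Submodule.add_mem_sup (mem_lat.2 hy) (Submodule.sum_mem _ fun i _ =>
    (le_iSup (fun i => N.map (LinearMap.single K (fun _ : Fin r => F) i)) i)
      (Submodule.mem_map_of_mem (hz i)))

end Finite

theorem exists_bound (v : Valuation F ℤᵐ⁰) (g : GL (Fin r) F) : ∃ N : ℤ, 0 ≤ N ∧ ∀ i j, v (g i j) ≤ exp N := by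
  obtain ⟨N, hN⟩ := (Finset.univ.image fun p : Fin r × Fin r => log (v (g p.1 p.2))).exists_le
  refine ⟨max N 0, le_max_right _ _, fun i j => ?_⟩
  refine le_trans ?_ (exp_le_exp.2 (le_max_left N 0))
  refine le_exp_of_log_le ?_
  exact hN _ (Finset.mem_image_of_mem _ (Finset.mem_univ (i, j)))

theorem val_mulVec_le {g : Matrix (Fin r) (Fin r) F} {x : Fin r → F} {i : Fin r} {c : ℤᵐ⁰}
    (h : ∀ j, v (g i j * x j) ≤ c) : v ((g *ᵥ x) i) ≤ c :=
  v.map_sum_le (g := c) (s := Finset.univ) (f := fun j => g i j * x j) fun j _ => h j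

variable (K v) in
theorem exists_map_lat_le (g : GL (Fin r) F) : ∃ N : ℤ, 0 ≤ N ∧ ∀ n,
    (lat K v r n).map (act K F r g : (Fin r → F) →ₗ[K] (Fin r → F)) ≤ lat K v r (n - N) := by
  obtain ⟨N, h0, hN⟩ := exists_bound v g
  refine ⟨N, h0, fun n => ?_⟩
  rintro _ ⟨x, hx, rfl⟩
  refine mem_lat.2 fun i => val_mulVec_le fun j => ?_
  rw [map_mul, neg_sub, sub_eq_add_neg, WithZero.exp_add]
  exact mul_le_mul' (hN i j) (mem_lat.1 hx j)

theorem map_act_map_act_inv (g : GL (Fin r) F) (L : Submodule K (Fin r → F)) :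
    (L.map (act K F r g⁻¹ : (Fin r → F) →ₗ[K] (Fin r → F))).map
      (act K F r g : (Fin r → F) →ₗ[K] (Fin r → F)) = L := by
  rw [← map_mul_eq, ← map_mul, mul_inv_cancel, map_one, Ack.map_one_eq]

variable (K v) in
theorem exists_lat_le_map (g : GL (Fin r) F) : ∃ N : ℤ, 0 ≤ N ∧ ∀ n,
    lat K v r (n + N) ≤ (lat K v r n).map (act K F r g : (Fin r → F) →ₗ[K] (Fin r → F)) := by
  obtain ⟨N, h0, hN⟩ := exists_map_lat_le K v g⁻¹
  refine ⟨N, h0, fun n => ?_⟩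
  have := Submodule.map_mono (f := (act K F r g : (Fin r → F) →ₗ[K] (Fin r → F))) (hN (n + N))
  rwa [map_act_map_act_inv, add_sub_cancel_right] at this

theorem commens_act [FiniteResidue K v] (g : GL (Fin r) F) :
    Commens (lat K v r 0)
      ((lat K v r 0).map (act K F r g : (Fin r → F) →ₗ[K] (Fin r → F))) := by
  obtain ⟨N, -, hN⟩ := exists_map_lat_le K v g
  obtain ⟨N', -, hN'⟩ := exists_lat_le_map K v g
  exact commens_iff.2 ⟨fin_quo_mono le_rfl (hN' 0) (fin_lat _ _),
    fin_quo_mono (hN 0) le_rfl (fin_lat _ _)⟩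

theorem commens_act1 [FiniteResidue K v] (u : Fˣ) :
    Commens (lat1 K v 0) ((lat1 K v 0).map (act1 K F u : F →ₗ[K] F)) := by
  obtain ⟨m, hm⟩ := exists_map_act1_lat1 K v u
  rw [hm]
  exact commens_iff.2 ⟨fin_lat1 _ _, fin_lat1 _ _⟩

end Lattices

/-! ### Unipotent matrices: stable lattices and canonical lifts -/

section Unipotent

variable {F : Type*} [Field F] {r : ℕ}

theorem IsUnipotent.mul {n n' : GL (Fin r) F} (h : IsUnipotent n) (h' : IsUnipotent n') :
    IsUnipotent (n * n') := by
  constructor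
  · intro i
    change ((n : Matrix (Fin r) (Fin r) F) * n') i i = 1
    rw [mul_apply, Finset.sum_eq_single i, h.1, h'.1, one_mul]
    · intro j _ hj
      rcases lt_or_gt_of_ne hj with h1 | h1
      · rw [h.2 _ _ h1, zero_mul]
      · rw [h'.2 _ _ h1, mul_zero]
    · simp
  · intro i j hij
    change ((n : Matrix (Fin r) (Fin r) F) * n') i j = 0
    rw [mul_apply]
    refine Finset.sum_eq_zero fun k _ => ?_
    rcases lt_or_ge k i with h1 | h1
    · rw [h.2 _ _ h1, zero_mul]
    · rw [h'.2 _ _ (hij.trans_le h1), mul_zero]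

theorem IsUnipotent.inv {n : GL (Fin r) F} (h : IsUnipotent n) : IsUnipotent n⁻¹ := by
  have h0 : BlockTriangular (n : Matrix (Fin r) (Fin r) F) id := fun _ _ hij => h.2 _ _ hij
  have h1 : ∀ i j, j < i → (n⁻¹ : GL (Fin r) F) i j = 0 := by
    intro i j hij
    have : Invertible (n : Matrix (Fin r) (Fin r) F) := n.invertible
    have := blockTriangular_inv_of_blockTriangular h0
    rw [← Matrix.coe_units_inv] at this
    exact this hij
  refine ⟨fun i => ?_, h1⟩
  have h2 : ((n : Matrix (Fin r) (Fin r) F) * (n⁻¹ : GL (Fin r) F)) i i = 1 := by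
    rw [Units.mul_inv, one_apply_eq]
  rw [mul_apply, Finset.sum_eq_single i, h.1, one_mul] at h2
  · exact h2
  · intro j _ hj
    rcases lt_or_gt_of_ne hj with h3 | h3
    · rw [h.2 _ _ h3, zero_mul]
    · rw [h1 _ _ h3, mul_zero]
  · simp

theorem isUnipotent_one : IsUnipotent (1 : GL (Fin r) F) :=
  ⟨fun i => one_apply_eq i, fun _ _ h => one_apply_ne h.ne'⟩

theorem IsUnipotent.det {n : GL (Fin r) F} (h : IsUnipotent n) :
    GeneralLinearGroup.det n = 1 := by
  refine Units.ext ?_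
  have h0 : BlockTriangular (n : Matrix (Fin r) (Fin r) F) id := fun _ _ hij => h.2 _ _ hij
  change Matrix.det (n : Matrix (Fin r) (Fin r) F) = 1
  rw [det_of_isUpperTriangular h0]
  exact Finset.prod_eq_one fun i _ => h.1 i

variable {K : Type*} [Field K] [Algebra K F]

/-- The strictly upper triangular matrix n - 1 has characteristic polynomial X^r, so Cayley–Hamilton
applies. -/
theorem IsUnipotent.isNilpotent {n : GL (Fin r) F} (h : IsUnipotent n) :
    IsNilpotent ((act K F r n : (Fin r → F) →ₗ[K] (Fin r → F)) - 1) := by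
  have h0 : BlockTriangular ((n : Matrix (Fin r) (Fin r) F) - 1) id :=
    BlockTriangular.sub (fun _ _ hij => h.2 _ _ hij) blockTriangular_one
  have h1 := aeval_self_charpoly ((n : Matrix (Fin r) (Fin r) F) - 1)
  rw [charpoly_of_isUpperTriangular _ h0] at h1
  have h2 (i : Fin r) : ((n : Matrix (Fin r) (Fin r) F) - 1) i i = 0 := by
    rw [Matrix.sub_apply, h.1, one_apply_eq, sub_self]
  simp only [h2, map_zero, sub_zero, Finset.prod_const, Finset.card_univ, Fintype.card_fin,
    map_pow, Polynomial.aeval_X] at h1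
  refine ⟨r, ?_⟩
  have key (m : ℕ) : ((act K F r n : (Fin r → F) →ₗ[K] (Fin r → F)) - 1) ^ m =
      ((((n : Matrix (Fin r) (Fin r) F) - 1) ^ m).mulVecLin).restrictScalars K := by
    induction m with
    | zero =>
      ext x
      simp
    | succ m ih =>
      rw [pow_succ, ih, pow_succ, mulVecLin_mul]
      refine LinearMap.ext fun x => ?_
      change ((n : Matrix (Fin r) (Fin r) F) - 1) ^ m *ᵥ ((n : Matrix (Fin r) (Fin r) F) *ᵥ x - x) =
        ((n : Matrix (Fin r) (Fin r) F) - 1) ^ m *ᵥ (((n : Matrix (Fin r) (Fin r) F) - 1) *ᵥ x)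
      rw [sub_mulVec, one_mulVec]
  rw [key, h1]
  ext x
  simp

variable {v : Valuation F ℤᵐ⁰} [IntegralConstants K v]

/-- A lattice that shrinks fast enough from one coordinate to the next absorbs the denominators of
the entries above the diagonal. Two matrices are treated at once so that products can be computed in
one lattice, and m lets the lattice be as small as required. -/
theorem exists_stable_lattice [FiniteResidue K v] {n n' : GL (Fin r) F} (h : IsUnipotent n)
    (h' : IsUnipotent n') (m : ℤ) : ∃ M : Submodule K (Fin r → F),
      (∀ a : F, v a ≤ 1 → ∀ x ∈ M, a • x ∈ M) ∧ M ≤ lat K v r m ∧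
      (∀ l, FiniteDimensional K (Quo (lat K v r l) M)) ∧
      M.map (act K F r n : (Fin r → F) →ₗ[K] (Fin r → F)) = M ∧
      M.map (act K F r n' : (Fin r → F) →ₗ[K] (Fin r → F)) = M := by
  have hN : ∃ N : ℤ, 0 ≤ N ∧ ∀ u : GL (Fin r) F, u ∈ [n, n⁻¹, n', n'⁻¹] → ∀ i j,
      v (u i j) ≤ exp N := by
    obtain ⟨N₁, h1, H1⟩ := exists_bound v n
    obtain ⟨N₂, h2, H2⟩ := exists_bound v n⁻¹
    obtain ⟨N₃, h3, H3⟩ := exists_bound v n'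
    obtain ⟨N₄, h4, H4⟩ := exists_bound v n'⁻¹
    refine ⟨N₁ + N₂ + N₃ + N₄, by positivity, ?_⟩
    simp only [List.mem_cons, List.not_mem_nil, or_false, forall_eq_or_imp, forall_eq]
    exact ⟨fun i j => (H1 i j).trans (exp_le_exp.2 (by omega)),
      fun i j => (H2 i j).trans (exp_le_exp.2 (by omega)),
      fun i j => (H3 i j).trans (exp_le_exp.2 (by omega)),
      fun i j => (H4 i j).trans (exp_le_exp.2 (by omega))⟩
  obtain ⟨N, h0, hN⟩ := hN
  -- An entry in position (i, j) with i < j lies in 𝔭^(-N) and sends 𝔭^(m+jN) into 𝔭^(m+(j-1)N),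
  -- which is contained in 𝔭^(m+iN).
  let M : Submodule K (Fin r → F) := Submodule.pi Set.univ fun i => lat1 K v (m + (i : ℕ) * N)
  have hM {x : Fin r → F} : x ∈ M ↔ ∀ i : Fin r, v (x i) ≤ exp (-(m + (i : ℕ) * N)) := by
    simp [M, mem_lat1, -WithZero.exp_neg, -WithZero.exp_add]
  have key (u : GL (Fin r) F) (hu : IsUnipotent u) (hu' : u ∈ [n, n⁻¹, n', n'⁻¹]) :
      M.map (act K F r u : (Fin r → F) →ₗ[K] (Fin r → F)) ≤ M := by
    rintro _ ⟨x, hx, rfl⟩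
    refine hM.2 fun i => val_mulVec_le fun j => ?_
    have hxj := hM.1 hx j
    rw [map_mul]
    rcases lt_trichotomy i j with hij | rfl | hij
    · refine (mul_le_mul' (hN u hu' i j) hxj).trans ?_
      rw [← WithZero.exp_add, exp_le_exp]
      have h1 : ((i : ℕ) : ℤ) + 1 ≤ ((j : ℕ) : ℤ) := by exact_mod_cast hij
      nlinarith
    · rw [hu.1, map_one, one_mul]
      exact hxj
    · rw [hu.2 _ _ hij, map_zero, zero_mul]
      exact zero_le
  have key' (u : GL (Fin r) F) (h1 : M.map (act K F r u : (Fin r → F) →ₗ[K] (Fin r → F)) ≤ M)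
      (h2 : M.map (act K F r u⁻¹ : (Fin r → F) →ₗ[K] (Fin r → F)) ≤ M) :
      M.map (act K F r u : (Fin r → F) →ₗ[K] (Fin r → F)) = M := by
    refine le_antisymm h1 ?_
    have := Submodule.map_mono (f := (act K F r u : (Fin r → F) →ₗ[K] (Fin r → F))) h2
    rwa [map_act_map_act_inv] at this
  refine ⟨M, fun a ha x hx => hM.2 fun i => ?_, fun x hx => mem_lat.2 fun i => ?_, fun l => ?_,
    key' n (key n h (by simp)) (key _ h.inv (by simp)),
    key' n' (key n' h' (by simp)) (key _ h'.inv (by simp))⟩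
  · rw [Pi.smul_apply, smul_eq_mul, map_mul]
    exact (mul_le_of_le_one_left' ha).trans (hM.1 hx i)
  · refine (hM.1 hx i).trans (exp_le_exp.2 ?_)
    have : 0 ≤ ((i : ℕ) : ℤ) * N := by positivity
    omega
  · refine fin_quo_mono le_rfl (fun x hx => hM.2 fun i => (mem_lat.1 hx i).trans
      (exp_le_exp.2 ?_)) (fin_lat l (m + r * N))
    have h1 : ((i : ℕ) : ℤ) ≤ r := by exact_mod_cast i.2.le
    nlinarith

variable {x y : Ack (lat K v r 0)} {n n' : GL (Fin r) F}

theorem isUnipotentLift_iff : IsUnipotentLift K v r x ↔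
    ∃ M : Submodule K (Fin r → F), (∀ a : F, v a ≤ 1 → ∀ m ∈ M, a • m ∈ M) ∧ x.IsCanon M := by
  constructor
  · rintro ⟨M, hM, hle, hfin, hx, z, hz, s, hs, h⟩
    refine ⟨M, hM, hx, ?_⟩
    obtain ⟨a, ha⟩ := exists_isBasisMod hfin
    have h1 := ha.map x.f
    rw [hx] at h1
    refine ⟨a, ha, h1, hle, hx.ge.trans (Submodule.map_mono hle), z, hz, fun α hα => ?_⟩
    rw [h, hα, map_wedge, List.map_map, List.map_map, one_smul]
    congr 1
    exact List.map_congr_left fun m _ => hs m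
  · rintro ⟨M, hM, hx, a, ha⟩
    obtain ⟨z, hz, hz'⟩ := ha.exists_sends
    refine ⟨M, hM, ha.le, ha.basis_left.fin, hx, z, hz,
      M.mapQ M (x.f : (Fin r → F) →ₗ[K] (Fin r → F)) (Submodule.map_le_iff_le_comap.1 hx.le),
      fun m => rfl, fun α => ?_⟩
    have := ha.basis_left.fin
    obtain ⟨β, h0, h1⟩ := ha.basis_left.exists_top
    obtain ⟨c, rfl⟩ := topExt_smul_eq h0 α
    rw [map_smul, inc_smul, inc_smul, map_smul, hz' β h1, h1, Ack.wedge_map_mkQ_map hx, one_smul]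

theorem exists_isUnipotentLift [FiniteResidue K v] (h : IsUnipotent n) :
    ∃ x : Ack (lat K v r 0), x.f = act K F r n ∧ IsUnipotentLift K v r x := by
  obtain ⟨M, h1, h2, h3, h4, -⟩ := exists_stable_lattice (K := K) (v := v) h h 0
  obtain ⟨x, hx, hx'⟩ := Ack.exists_isCanon (act K F r n) h4 h2 (h3 0)
  exact ⟨x, hx, isUnipotentLift_iff.2 ⟨M, h1, hx'⟩⟩

/-- The 𝒪-stable lattice used in the definition can be exchanged for any stable K-subspace of finite
codimension in 𝒪^r. -/
theorem IsUnipotentLift.isCanon (hx : IsUnipotentLift K v r x) (h : IsUnipotent n)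
    (hf : x.f = act K F r n) {M : Submodule K (Fin r → F)} (hM : M ≤ lat K v r 0)
    (hfin : FiniteDimensional K (Quo (lat K v r 0) M))
    (hs : M.map (act K F r n : (Fin r → F) →ₗ[K] (Fin r → F)) = M) : x.IsCanon M := by
  obtain ⟨M', -, h1⟩ := isUnipotentLift_iff.1 hx
  exact h1.of_stable (hf ▸ h.isNilpotent) hM (hf ▸ hs) hfin

theorem IsUnipotentLift.eq [FiniteResidue K v] (hx : IsUnipotentLift K v r x)
    (hy : IsUnipotentLift K v r y) (h : IsUnipotent n) (hf : x.f = act K F r n)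
    (hf' : y.f = act K F r n) : x = y := by
  obtain ⟨M, h1, h2, h3, h4, -⟩ := exists_stable_lattice (K := K) (v := v) h h 0
  exact (hx.isCanon h hf h2 (h3 0) h4).ext (hy.isCanon h hf' h2 (h3 0) h4) (hf.trans hf'.symm)

theorem IsUnipotentLift.mul [FiniteResidue K v] (hx : IsUnipotentLift K v r x)
    (hy : IsUnipotentLift K v r y) (h : IsUnipotent n) (h' : IsUnipotent n')
    (hf : x.f = act K F r n) (hf' : y.f = act K F r n') : IsUnipotentLift K v r (x * y) := by
  obtain ⟨M, h1, h2, h3, h4, h5⟩ := exists_stable_lattice (K := K) (v := v) h h' 0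
  exact isUnipotentLift_iff.2
    ⟨M, h1, (hx.isCanon h hf h2 (h3 0) h4).mul (hy.isCanon h' hf' h2 (h3 0) h5)⟩

/-- Canonical unipotent lifts are carried to each other by conjugation by any lift of any γ,
provided both matrices are unipotent. This absorbs the ambiguity of the Bruhat decomposition. -/
theorem IsUnipotentLift.mul_comm [FiniteResidue K v] (hx : IsUnipotentLift K v r x)
    (hy : IsUnipotentLift K v r y) (h : IsUnipotent n) (h' : IsUnipotent n')
    (hf : x.f = act K F r n) (hf' : y.f = act K F r n') {g : Ack (lat K v r 0)}
    {γ : GL (Fin r) F} (hg : g.f = act K F r γ) (hγ : n' * γ = γ * n) : y * g = g * x := by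
  obtain ⟨N, hN0, hN⟩ := exists_map_lat_le K v γ
  obtain ⟨N', hN0', hN'⟩ := exists_lat_le_map K v γ
  -- M is taken inside (𝔭^N)^r so that γM stays in 𝒪^r; it is stable under n' because n'γM = γnM =
  -- γM.
  obtain ⟨M, h1, h2, h3, h4, -⟩ := exists_stable_lattice (K := K) (v := v) h h N
  have h5 := hx.isCanon h hf (h2.trans (lat_anti hN0)) (h3 0) h4
  refine h5.mul_comm (hy.isCanon h' hf' ?_ ?_ ?_) ?_
  · rw [hg]
    refine (Submodule.map_mono h2).trans ((hN N).trans ?_)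
    rw [sub_self]
  · rw [hg]
    refine fin_quo_mono ?_ le_rfl (fin_quo_map _ (h3 (-N')))
    have := hN' (-N')
    rwa [neg_add_cancel] at this
  · rw [hg, ← map_mul_eq, ← map_mul, hγ, map_mul, map_mul_eq, h4]
  · rw [hf, hf', hg, ← map_mul, ← map_mul, hγ]

theorem isUnipotentLift_of_isTriv (hx : x.IsTriv) : IsUnipotentLift K v r x := by
  obtain ⟨h1, h2⟩ := hx
  refine isUnipotentLift_iff.2 ⟨lat K v r 0, fun a ha m hm => mem_lat.2 fun i => ?_,
    h2 ▸ Ack.isCanon_triv x.f h1⟩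
  rw [Pi.smul_apply, smul_eq_mul, map_mul]
  exact (mul_le_of_le_one_left' ha).trans (mem_lat.1 hm i)

end Unipotent

end

section

open Module WithZero Matrix

set_option linter.unusedSectionVars false

/-! ### Direct sums of bases and the diagonal isomorphism D_t ≃ ⨂ D_{t_i} -/

section DirectSum

variable {K : Type*} [Field K] {V : Type*} [AddCommGroup V] [Module K V] {r : ℕ}

theorem prod_ofFn_smul {E : Type*} [Ring E] [Algebra K E] {r : ℕ} (c : Fin r → Kˣ)
    (z : Fin r → E) :
    (List.ofFn fun i => c i • z i).prod = (∏ i, c i) • (List.ofFn z).prod := by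
  induction r with
  | zero => simp
  | succ r ih =>
    rw [List.ofFn_succ, List.ofFn_succ, List.prod_cons, List.prod_cons, ih, Fin.prod_univ_succ,
      smul_mul_smul_comm]

theorem prod_ofFn_mul {E : Type*} [Monoid E] {r : ℕ} (y z : Fin r → E)
    (h : ∀ i x, Commute (z i) x) :
    (List.ofFn fun i => y i * z i).prod = (List.ofFn y).prod * (List.ofFn z).prod := by
  induction r with
  | zero => simp
  | succ r ih =>
    rw [List.ofFn_succ, List.ofFn_succ, List.ofFn_succ, List.prod_cons, List.prod_cons,
      List.prod_cons, ih _ _ fun i => h i.succ, mul_assoc, mul_assoc, ← mul_assoc (z 0),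
      (h 0 _).eq, mul_assoc]

/-- Moving a vector across the product costs one sign for each factor, hence no sign in total;
vectors generate the algebra. -/
theorem commute_wedge_of_even {l : List V} (hl : Even l.length) (z : ExteriorAlgebra K V) :
    Commute (wedge K l) z := by
  have h1 (l : List V) :
      CliffordAlgebra.involute (wedge K l) = (-1 : K) ^ l.length • wedge K l := by
    induction l with
    | nil => simp
    | cons x l ih =>
      have h2 : wedge K (x :: l) = ExteriorAlgebra.ι K x * wedge K l := by simp [wedge]
      rw [h2, map_mul, ih, ExteriorAlgebra.ι, CliffordAlgebra.involute_ι, List.length_cons,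
        pow_succ, mul_neg_one, neg_smul, neg_mul, mul_smul_comm]
  have h3 (x : V) : Commute (ExteriorAlgebra.ι K x) (wedge K l) := by
    change _ * _ = _ * _
    rw [ι_mul_eq, h1, hl.neg_one_pow, one_smul]
  induction z using ExteriorAlgebra.induction with
  | algebraMap c => exact (Algebra.commute_algebraMap_left _ _).symm
  | ι x => exact (h3 x).symm
  | mul x y hx hy => exact hx.mul_right hy
  | add x y hx hy => exact hx.add_right hy

/-- The concatenation of lists in the factors of `V^r`. -/
def sumList (b : Fin r → List V) : List (Fin r → V) :=
  (List.ofFn fun i => (b i).map (Pi.single i)).flatten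

theorem mem_sumList {b : Fin r → List V} {x : Fin r → V} :
    x ∈ sumList b ↔ ∃ i, ∃ y ∈ b i, Pi.single i y = x := by
  simp [sumList, List.mem_ofFn']

theorem length_sumList (b : Fin r → List V) : (sumList b).length = ∑ i, (b i).length := by
  simp [sumList, List.sum_ofFn, Function.comp_def]

theorem sumList_nil : (sumList fun _ : Fin r => ([] : List V)) = [] := by
  simp [sumList]

theorem wedge_map_sumList {W : Type*} [AddCommGroup W] [Module K W] (f : (Fin r → V) →ₗ[K] W)
    (b : Fin r → List V) : wedge K ((sumList b).map f) =
      (List.ofFn fun i => wedge K ((b i).map (f ∘ₗ LinearMap.single K (fun _ => V) i))).prod := by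
  have h (l : List (List W)) : wedge K l.flatten = (l.map (wedge K)).prod := by
    rw [wedge, List.map_flatten, List.prod_flatten, List.map_map]
    rfl
  rw [sumList, List.map_flatten, h, List.map_ofFn, List.map_ofFn]
  congr 2
  funext i
  simp only [Function.comp_apply, List.map_map]
  rfl

theorem finrank_quo_pi (A L : Fin r → Submodule K V) (h : ∀ i, FiniteDimensional K (Quo (A i) (L i))) :
    finrank K (Quo (Submodule.pi Set.univ A) (Submodule.pi Set.univ L)) =
      ∑ i, finrank K (Quo (A i) (L i)) := by
  let p (i : Fin r) : ((Fin r → V) ⧸ Submodule.pi Set.univ L) →ₗ[K] (V ⧸ L i) :=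
    Submodule.mapQ _ _ (LinearMap.proj i) fun x hx => hx i (Set.mem_univ i)
  let φ : Quo (Submodule.pi Set.univ A) (Submodule.pi Set.univ L) →ₗ[K] ∀ i, Quo (A i) (L i) :=
    LinearMap.pi fun i => (p i).restrict (by
      rintro _ ⟨x, hx, rfl⟩
      exact ⟨x i, hx i (Set.mem_univ i), rfl⟩)
  rw [← finrank_pi_fintype]
  refine (LinearEquiv.ofBijective φ ⟨?_, fun z => ?_⟩).finrank_eq
  · rw [injective_iff_map_eq_zero]
    rintro ⟨_, x, hx, rfl⟩ h0
    refine Subtype.ext ?_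
    change (Submodule.pi Set.univ L).mkQ x = 0
    rw [← LinearMap.mem_ker, Submodule.ker_mkQ]
    intro i _
    have h1 : (L i).mkQ (x i) = 0 := congrArg Subtype.val (congrFun h0 i)
    rwa [← LinearMap.mem_ker, Submodule.ker_mkQ] at h1
  · have h1 (i) : ∃ x ∈ A i, (L i).mkQ x = z i := (z i).2
    choose x hx hxz using h1
    exact ⟨⟨_, x, fun i _ => hx i, rfl⟩, funext fun i => Subtype.ext (hxz i)⟩

theorem IsBasisMod.sumList {A L : Fin r → Submodule K V} {b : Fin r → List V}
    (h : ∀ i, IsBasisMod (A i) (L i) (b i)) :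
    IsBasisMod (Submodule.pi Set.univ A) (Submodule.pi Set.univ L) (sumList b) := by
  refine ⟨fun x hx => ?_, fun x hx => ?_, ?_⟩
  · obtain ⟨i, y, hy, rfl⟩ := mem_sumList.1 hx
    intro j _
    rcases eq_or_ne j i with rfl | hj
    · rw [Pi.single_eq_same]
      exact (h _).mem y hy
    · rw [Pi.single_eq_of_ne hj]
      exact zero_mem _
  · have h1 (i) : ∃ y ∈ Submodule.span K {x | x ∈ b i}, ∃ z ∈ L i, y + z = x i :=
      Submodule.mem_sup.1 ((h i).le_span (hx i (Set.mem_univ i)))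
    choose y hy z hz hyz using h1
    have h2 : x = ∑ i, LinearMap.single K (fun _ : Fin r => V) i (y i) + z := by
      refine funext fun i => ?_
      rw [Pi.add_apply, Finset.sum_apply, Finset.sum_eq_single i]
      · simp [hyz]
      · intro j _ hj
        simp [Pi.single_eq_of_ne hj.symm]
      · simp
    rw [h2]
    refine Submodule.add_mem_sup (Submodule.sum_mem _ fun i _ => ?_) fun i _ => hz i
    have h3 := Submodule.mem_map_of_mem (f := LinearMap.single K (fun _ : Fin r => V) i) (hy i)
    rw [Submodule.map_span] at h3
    refine Submodule.span_mono ?_ h3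
    rintro _ ⟨w, hw, rfl⟩
    exact mem_sumList.2 ⟨i, w, hw, rfl⟩
  · rw [length_sumList, finrank_quo_pi _ _ fun i => (h i).fin]
    exact Finset.sum_congr rfl fun i _ => (h i).length

end DirectSum

section Diagonal

variable {K : Type*} [Field K] {F : Type*} [Field F] [Algebra K F] {v : Valuation F ℤᵐ⁰} {r : ℕ}
  [IntegralConstants K v]

theorem wedge_sumList_mkQ (n : ℤ) (b : Fin r → List F) :
    wedge K ((sumList b).map (lat K v r n).mkQ) = (List.ofFn fun i =>
      ExteriorAlgebra.map (single K v r n i) (wedge K ((b i).map (lat1 K v n).mkQ))).prod := by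
  rw [wedge_map_sumList]
  congr 2
  funext i
  rw [map_wedge, List.map_map]
  rfl

theorem wedge_sumList_smul {n : ℤ} {a b : Fin r → List F} {c : Fin r → Kˣ}
    (h : ∀ i, wedge K ((b i).map (lat1 K v n).mkQ) = c i • wedge K ((a i).map (lat1 K v n).mkQ)) :
    wedge K ((sumList b).map (lat K v r n).mkQ) =
      (∏ i, c i) • wedge K ((sumList a).map (lat K v r n).mkQ) := by
  rw [wedge_sumList_mkQ, wedge_sumList_mkQ, ← prod_ofFn_smul]
  congr 2
  funext i
  rw [h, Units.smul_def, map_smul]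
  rfl

theorem map_act_diagGL (t : Fin r → Fˣ) :
    (lat K v r 0).map (act K F r (diagGL t) : (Fin r → F) →ₗ[K] (Fin r → F)) =
      Submodule.pi Set.univ fun i => (lat1 K v 0).map (act1 K F (t i) : F →ₗ[K] F) := by
  ext x
  constructor
  · rintro ⟨y, hy, rfl⟩ i -
    refine ⟨y i, mem_lat.1 hy i, ?_⟩
    change (t i : F) * y i = (diagonal (fun i => (t i : F)) *ᵥ y) i
    rw [mulVec_diagonal]
  · intro hx
    have h1 (i) : ∃ y ∈ lat1 K v 0, act1 K F (t i) y = x i := hx i (Set.mem_univ i)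
    choose y hy hyx using h1
    refine ⟨y, mem_lat.2 hy, funext fun i => ?_⟩
    rw [← hyx]
    change (diagonal (fun i => (t i : F)) *ᵥ y) i = (t i : F) * y i
    rw [mulVec_diagonal]

/-- The identity `c = y_1 ⊗ ⋯ ⊗ y_r`, computed in the lattice `𝔭^n` by means of bases. -/
def IsDiagRep (n : ℤ) (y : Fin r → Ack (lat1 K v 0)) (c : Ack (lat K v r 0)) : Prop :=
  ∃ (a : List F) (b : Fin r → List F) (d : Fin r → Kˣ), lat1 K v n ≤ lat1 K v 0 ∧
    IsBasisMod (lat1 K v 0) (lat1 K v n) a ∧ (∀ i, (y i).Rep (lat1 K v n) a (b i) (d i)) ∧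
    c.Rep (lat K v r n) (sumList fun _ => a) (sumList b) (∏ i, d i)

variable {n : ℤ} {y : Fin r → Ack (lat1 K v 0)} {c c' : Ack (lat K v r 0)} {t : Fin r → Fˣ}

theorem map_f_eq_pi (hy : ∀ i, (y i).f = act1 K F (t i)) (hc : c.f = act K F r (diagGL t)) :
    (lat K v r 0).map (c.f : (Fin r → F) →ₗ[K] (Fin r → F)) =
      Submodule.pi Set.univ fun i => (lat1 K v 0).map ((y i).f : F →ₗ[K] F) := by
  rw [hc, map_act_diagGL]
  simp only [hy]

/-- At a fixed exponent n the relation does not depend on the bases: the base-change factors of the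
summands multiply to those of the direct sum. -/
theorem IsDiagRep.rep (h : IsDiagRep n y c) {a : List F} {b : Fin r → List F} {d : Fin r → Kˣ}
    (ha : IsBasisMod (lat1 K v 0) (lat1 K v n) a)
    (hy : ∀ i, (y i).Rep (lat1 K v n) a (b i) (d i))
    (hb : IsBasisMod ((lat K v r 0).map (c.f : (Fin r → F) →ₗ[K] (Fin r → F))) (lat K v r n)
      (sumList b)) :
    c.Rep (lat K v r n) (sumList fun _ => a) (sumList b) (∏ i, d i) := by
  obtain ⟨a₀, b₀, d₀, -, h0, h1, h2⟩ := h
  obtain ⟨p, hp⟩ := h0.exists_smul ha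
  have h3 (i) := (h1 i).basis_right.exists_smul (hy i).basis_right
  choose q hq using h3
  have h4 (i) : d i = d₀ i * p * (q i)⁻¹ :=
    (hy i).unique ((h1 i).change (hy i).basis_left (hy i).basis_right hp (hq i))
  simp only [h4, Finset.prod_mul_distrib, Finset.prod_inv_distrib]
  refine h2.change (IsBasisMod.sumList fun i => ha) hb ?_ (wedge_sumList_smul hq)
  exact wedge_sumList_smul fun _ => hp

/-- Here the evenness condition is used. Refining the direct sum puts the bases of 𝔭^n/𝔭^n' at the
end, refining the summands interleaves them; having even length, they can be moved without a sign.
-/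
theorem IsDiagRep.mono (h : IsDiagRep n y c) (hy : ∀ i, (y i).f = act1 K F (t i))
    (hc : c.f = act K F r (diagGL t)) [FiniteResidue K v] {n' : ℤ} (hn : n ≤ n')
    (he : Even (n' - n)) : IsDiagRep n' y c := by
  obtain ⟨a, b, d, h0, ha, h1, h2⟩ := h
  obtain ⟨l, hl⟩ := exists_isBasisMod (fin_lat1 (K := K) (v := v) n n')
  have hle : Even (l.map (lat1 K v n').mkQ).length := by
    rw [List.length_map, hl.length]
    exact even_finrank_lat1 hn he
  have h3 (i) := (h1 i).refine hl (lat1_anti hn)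
  refine ⟨a ++ l, fun i => b i ++ l, d, (lat1_anti hn).trans h0,
    ha.append hl (lat1_anti hn) h0, h3, ?_⟩
  have hl' : IsBasisMod (lat K v r n) (lat K v r n') (sumList fun _ => l) :=
    IsBasisMod.sumList fun _ => hl
  have h4 := h2.refine hl' (lat_anti hn)
  -- The products of the lists l are even, hence central, and can be gathered after all the products
  -- of the b_i.
  have key (b : Fin r → List F) :
      wedge K ((sumList fun i => b i ++ l).map (lat K v r n').mkQ) =
        (1 : Kˣ) • wedge K ((sumList b ++ sumList fun _ => l).map (lat K v r n').mkQ) := by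
    rw [one_smul, List.map_append, wedge_append, wedge_sumList_mkQ, wedge_sumList_mkQ,
      wedge_sumList_mkQ, ← prod_ofFn_mul]
    · congr 2
      funext i
      rw [List.map_append, wedge_append, map_mul]
    · intro i x
      rw [map_wedge]
      exact commute_wedge_of_even (by rwa [List.length_map]) x
  have h5 := h4.change (IsBasisMod.sumList fun i => ha.append hl (lat1_anti hn) h0)
    (b' := sumList fun i => b i ++ l) (by
      rw [map_f_eq_pi hy hc]
      exact IsBasisMod.sumList fun i => (h3 i).basis_right) (key _) (key _)
  simpa using h5

theorem exists_rep_lat1 [FiniteResidue K v] (y : Ack (lat1 K v 0))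
    (hn : lat1 K v n ≤ lat1 K v 0) (hn' : lat1 K v n ≤ (lat1 K v 0).map (y.f : F →ₗ[K] F))
    {u : Fˣ} (hy : y.f = act1 K F u) {a : List F} (ha : IsBasisMod (lat1 K v 0) (lat1 K v n) a) :
    ∃ b d, y.Rep (lat1 K v n) a b d := by
  obtain ⟨m, hm⟩ := exists_map_act1_lat1 K v u
  have h1 : FiniteDimensional K (Quo ((lat1 K v 0).map (y.f : F →ₗ[K] F)) (lat1 K v n)) := by
    rw [hy, hm]
    exact fin_lat1 _ _
  obtain ⟨b, hb⟩ := exists_isBasisMod h1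
  obtain ⟨d, hd⟩ := y.exists_rep hn hn' ha hb
  exact ⟨b, d, hd⟩

/-- Translates the definition in terms of elements of top exterior powers into bases, where
refinement and norms can be computed. -/
theorem isDiagonalLift_iff [FiniteResidue K v] (hy : ∀ i, (y i).f = act1 K F (t i))
    (hc : c.f = act K F r (diagGL t)) :
    IsDiagonalLift K v r y c ↔ ∃ n, Even n ∧ IsDiagRep n y c := by
  constructor
  · rintro ⟨n, he, h0, hi, x, z, hx, hz, ω, Ω, hω, hΩ, hzΩ⟩
    refine ⟨n, he, ?_⟩
    obtain ⟨a, ha⟩ := exists_isBasisMod (fin_lat1 (K := K) (v := v) 0 n)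
    have h1 (i) := exists_rep_lat1 (y i) h0 (hi i) (hy i) ha
    choose b d hd using h1
    refine ⟨a, b, d, h0, ha, hd, ?_⟩
    have hsa : IsBasisMod (lat K v r 0) (lat K v r n) (sumList fun _ => a) :=
      IsBasisMod.sumList fun _ => ha
    have hsb : IsBasisMod ((lat K v r 0).map (c.f : (Fin r → F) →ₗ[K] (Fin r → F)))
        (lat K v r n) (sumList b) := by
      rw [map_f_eq_pi hy hc]
      exact IsBasisMod.sumList fun i => (hd i).basis_right
    have hle : lat K v r n ≤ lat K v r 0 := fun x hx => mem_lat.2 fun i =>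
      h0 (mem_lat.1 hx i)
    have hle' : lat K v r n ≤ (lat K v r 0).map (c.f : (Fin r → F) →ₗ[K] (Fin r → F)) := by
      rw [map_f_eq_pi hy hc]
      exact fun x hx i _ => hi i (mem_lat.1 hx i)
    obtain ⟨e, hze⟩ := exists_sends_of z hsa hsb
    have := ha.fin
    obtain ⟨α, hα0, hα⟩ := ha.exists_top
    obtain ⟨p, rfl⟩ := topExt_smul_eq hα0 ω
    have hp : p ≠ 0 := by rintro rfl; simp at hω
    obtain ⟨p, rfl⟩ : ∃ p' : Kˣ, (p' : K) = p := ⟨Units.mk0 p hp, rfl⟩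
    have h2 (i) : inc (x i ((p : K) • α)) = (p * d i) • wedge K ((b i).map (lat1 K v n).mkQ) := by
      obtain ⟨x', hx', hs⟩ := (hd i).exists_sends
      rw [IsPush.eq_right ((y i).pushOK_one h0 (hi i) ha.fin) (hx i) hx', map_smul, inc_smul,
        hs α hα, mul_smul]
      rfl
    obtain ⟨β, hβ0, hβ⟩ := hsa.exists_top
    have h3 : Ω = (∏ _i : Fin r, p) • β := by
      refine inc_injective ?_
      rw [hΩ, inc_units_smul, hβ, wedge_sumList_mkQ, ← prod_ofFn_smul]
      congr 2
      funext i
      rw [inc_smul, map_smul, hα]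
      rfl
    have h4 : z Ω = (∏ _i : Fin r, p) • z β := by
      rw [h3]
      exact z.map_smul ((∏ _i : Fin r, p : Kˣ) : K) β
    rw [h4, inc_units_smul, hze β hβ] at hzΩ
    have h5 : (List.ofFn fun i => ExteriorAlgebra.map (single K v r n i)
        (inc (x i ((p : K) • α)))).prod =
        ((∏ _i : Fin r, p) * ∏ i, d i) • wedge K ((sumList b).map (lat K v r n).mkQ) := by
      rw [wedge_sumList_mkQ, ← Finset.prod_mul_distrib, ← prod_ofFn_smul]
      congr 2
      funext i
      rw [h2, Units.smul_def, map_smul]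
      rfl
    rw [h5, smul_smul] at hzΩ
    -- The ratio p of ω to the product of the basis a occurs once per summand on both sides, and so
    -- cancels.
    have h6 := mul_left_cancel (Units.ext (smul_left_injective K hsb.wedge_ne_zero hzΩ))
    exact ⟨hsa, hsb, hle, hle', z, hz, h6 ▸ hze⟩
  · rintro ⟨n, he, a, b, d, h0, ha, hd, hr⟩
    have h1 (i) := (hd i).exists_sends
    choose x hx hs using h1
    obtain ⟨z, hz, hzs⟩ := hr.exists_sends
    refine ⟨n, he, h0, fun i => (hd i).le_map, x, z, hx, hz, ?_⟩
    obtain ⟨α, hα0, hα⟩ := ha.exists_top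
    obtain ⟨β, hβ0, hβ⟩ := hr.basis_left.exists_top
    refine ⟨α, β, hα0, ?_, ?_⟩
    · rw [hβ, wedge_sumList_mkQ, hα]
    · rw [hzs β hβ, wedge_sumList_mkQ, ← prod_ofFn_smul]
      congr 2
      funext i
      rw [hs i α hα, Units.smul_def, Units.smul_def, map_smul]

end Diagonal

end

section

open Module WithZero Matrix

set_option linter.unusedSectionVars false

/-! ### Existence and uniqueness of the diagonal lift -/

section Diagonal

variable {K : Type*} [Field K] {F : Type*} [Field F] [Algebra K F] {v : Valuation F ℤᵐ⁰} {r : ℕ}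
  [IntegralConstants K v] {n : ℤ} {y : Fin r → Ack (lat1 K v 0)} {c c' : Ack (lat K v r 0)}
  {t : Fin r → Fˣ}

theorem exists_isDiagonalLift [FiniteResidue K v] (hy : ∀ i, (y i).f = act1 K F (t i)) :
    ∃ c : Ack (lat K v r 0), c.f = act K F r (diagGL t) ∧ IsDiagonalLift K v r y c := by
  have h1 (i) := exists_map_act1_lat1 K v (t i)
  choose m hm using h1
  obtain ⟨N, hN⟩ := (Finset.univ.image m).exists_le
  -- This exponent is even, non-negative and at least every valuation m i, as the inclusions in 𝒪
  -- and t_i 𝒪 require.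
  let n : ℤ := 2 * max N 0
  have h0 : lat1 K v n ≤ lat1 K v 0 := lat1_anti (by positivity)
  have hi (i) : lat1 K v n ≤ (lat1 K v 0).map ((y i).f : F →ₗ[K] F) := by
    rw [hy, hm]
    refine lat1_anti ?_
    have := hN _ (Finset.mem_image_of_mem m (Finset.mem_univ i))
    omega
  obtain ⟨a, ha⟩ := exists_isBasisMod (fin_lat1 (K := K) (v := v) 0 n)
  have h2 (i) := exists_rep_lat1 (y i) h0 (hi i) (hy i) ha
  choose b d hd using h2
  obtain ⟨c, hc, hr⟩ := Ack.exists_of_rep (act K F r (diagGL t)) (A := lat K v r 0)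
    (L := lat K v r n) (a := sumList fun _ => a) (b := sumList b)
    (fun x hx => mem_lat.2 fun i => h0 (mem_lat.1 hx i))
    (by
      rw [map_act_diagGL]
      intro x hx i _
      have := hi i (mem_lat.1 hx i)
      rwa [hy] at this)
    (IsBasisMod.sumList fun _ => ha)
    (by
      rw [map_act_diagGL]
      exact IsBasisMod.sumList fun i => hy i ▸ (hd i).basis_right) (∏ i, d i)
  exact ⟨c, hc, (isDiagonalLift_iff hy hc).2 ⟨n, even_two_mul _, a, b, d, h0, ha, hd, hr⟩⟩

theorem IsDiagonalLift.eq [FiniteResidue K v] (hy : ∀ i, (y i).f = act1 K F (t i))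
    (hc : c.f = act K F r (diagGL t)) (hc' : c'.f = act K F r (diagGL t))
    (h : IsDiagonalLift K v r y c) (h' : IsDiagonalLift K v r y c') : c = c' := by
  obtain ⟨n, hn, h1⟩ := (isDiagonalLift_iff hy hc).1 h
  obtain ⟨n', hn', h2⟩ := (isDiagonalLift_iff hy hc').1 h'
  -- The maximum of two even exponents is even, so its differences with both are even and
  -- `IsDiagRep.mono` applies to both.
  have he : Even (max n n') := by rcases max_choice n n' with e | e <;> rwa [e]
  have h3 := h1.mono hy hc (le_max_left n n') (he.sub hn)
  have h4 := h2.mono hy hc' (le_max_right n n') (he.sub hn')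
  obtain ⟨a, b, d, h0, ha, hd, hr⟩ := h3
  have h5 := h4.rep ha hd (by
    have := hr.basis_right
    rwa [hc, ← hc'] at this)
  exact hr.ext (hc.trans hc'.symm) h5

theorem scal_mul_f {V : Type*} [AddCommGroup V] [Module K V] {A : Submodule K V} (e : Kˣ)
    (u : Ack A) : (Ack.scal e * u).f = u.f := by
  rw [Ack.mul_f, Ack.scal_f, one_mul]

theorem IsDiagonalLift.scal [FiniteResidue K v] (hy : ∀ i, (y i).f = act1 K F (t i))
    (hc : c.f = act K F r (diagGL t)) (h : IsDiagonalLift K v r y c) (e : Fin r → Kˣ) :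
    IsDiagonalLift K v r (fun i => Ack.scal (e i) * y i) (Ack.scal (∏ i, e i) * c) := by
  obtain ⟨n, hn, a, b, d, h0, ha, hd, hr⟩ := (isDiagonalLift_iff hy hc).1 h
  refine (isDiagonalLift_iff (t := t) (fun i => by rw [scal_mul_f, hy])
    (by rw [scal_mul_f, hc])).2 ⟨n, hn, a, b, fun i => e i * d i, h0, ha,
      fun i => (hd i).scal_mul _, ?_⟩
  rw [Finset.prod_mul_distrib]
  exact hr.scal_mul _

/-- When all lattices coincide the exponent 0 is allowed; all bases are empty and all scalars are 1.
-/
theorem isDiagonalLift_of_isTriv [FiniteResidue K v] (hy : ∀ i, (y i).f = act1 K F (t i))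
    (hc : c.f = act K F r (diagGL t)) (h : ∀ i, (y i).IsTriv) (h' : c.IsTriv) :
    IsDiagonalLift K v r y c := by
  refine (isDiagonalLift_iff hy hc).2 ⟨0, Even.zero, [], fun _ => [], fun _ => 1, le_rfl,
    IsBasisMod.nil _, fun i => Ack.isTriv_iff.1 (h i), ?_⟩
  rw [sumList_nil, Finset.prod_const_one]
  exact Ack.isTriv_iff.1 h'

end Diagonal

/-! ### Compatibility of the norm with unipotent and diagonal lifts -/

section Norm

variable {K : Type*} [Field K] {K' : Type*} [Field K'] [Algebra K K'] [FiniteDimensional K K']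
  {F : Type*} [Field F] [Algebra K F] [Algebra K' F] [IsScalarTower K K' F]
  {v : Valuation F ℤᵐ⁰} {r : ℕ} [IntegralConstants K v] [IntegralConstants K' v]

variable (K K' v r)

theorem lat1_restrictScalars (n : ℤ) : lat1 K v n = (lat1 K' v n).restrictScalars K := rfl

theorem lat_restrictScalars (n : ℤ) : lat K v r n = (lat K' v r n).restrictScalars K := rfl

theorem act1_restrictScalars (u : Fˣ) :
    act1 K F u = (act1 K' F u).restrictScalars K := rfl

theorem act_restrictScalars (g : GL (Fin r) F) :
    act K F r g = (act K' F r g).restrictScalars K := rfl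

/-- The norm on the extension of `GL_1(F)`. -/
def norm1 : Ack (lat1 K' v 0) →* Ack (lat1 K v 0) :=
  Ack.normHom (lat1_restrictScalars K K' v 0)

/-- The norm on the extension of `GL_r(F)`. -/
def normr : Ack (lat K' v r 0) →* Ack (lat K v r 0) :=
  Ack.normHom (lat_restrictScalars K K' v r 0)

variable {K K' v r}

theorem norm1_f {y : Ack (lat1 K' v 0)} {u : Fˣ} (h : y.f = act1 K' F u) :
    (norm1 K K' v y).f = act1 K F u := by
  rw [act1_restrictScalars K K', ← h]
  exact (Ack.isNorm_normHom _ y).1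

theorem normr_f {x : Ack (lat K' v r 0)} {g : GL (Fin r) F} (h : x.f = act K' F r g) :
    (normr K K' v r x).f = act K F r g := by
  rw [act_restrictScalars K K', ← h]
  exact (Ack.isNorm_normHom _ x).1

/-- The same lattice M serves over K: extending a basis commutes with f, and the coordinate becomes
N(1) = 1. -/
theorem IsUnipotentLift.normr {x : Ack (lat K' v r 0)} (h : IsUnipotentLift K' v r x) :
    IsUnipotentLift K v r (normr K K' v r x) := by
  obtain ⟨M, hM, hx, a, ha⟩ := isUnipotentLift_iff.1 h
  have h1 := Ack.isNorm_normHom (lat_restrictScalars K K' v r 0) x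
  refine isUnipotentLift_iff.2 ⟨M.restrictScalars K, hM, ?_, scaleList K K' a, ?_⟩
  · refine (congrArg (fun f : (Fin r → F) ≃ₗ[K] (Fin r → F) =>
      (M.restrictScalars K).map (f : (Fin r → F) →ₗ[K] (Fin r → F))) h1.1).trans ?_
    exact congrArg (Submodule.restrictScalars K) hx
  · have h2 := h1.2 _ _ _ _ ha
    have e : scaleList K K' (a.map x.f) =
        (scaleList K K' a).map (x.f : (Fin r → F) →ₗ[K'] (Fin r → F)) :=
      (map_scaleList K (x.f : (Fin r → F) →ₗ[K'] (Fin r → F)) a).symm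
    rw [map_one, e] at h2
    have h3 : (scaleList K K' a).map (Metaplectic.normr K K' v r x).f =
        (scaleList K K' a).map (x.f : (Fin r → F) →ₗ[K'] (Fin r → F)) :=
      congrArg (fun f : (Fin r → F) ≃ₗ[K] (Fin r → F) => (scaleList K K' a).map f) h1.1
    rw [h3]
    exact h2

/-- The two operations produce the same vectors in the same order, so the norm introduces no sign in
the diagonal isomorphism. -/
theorem scaleList_sumList {V : Type*} [AddCommGroup V] [Module K V] [Module K' V]
    [IsScalarTower K K' V] (b : Fin r → List V) :
    scaleList K K' (sumList b) = sumList fun i => scaleList K K' (b i) := by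
  have h (l : List (List (Fin r → V))) :
      scaleList K K' l.flatten = (l.map (scaleList K K')).flatten := by
    induction l with
    | nil => rfl
    | cons x l ih => rw [List.flatten_cons, scaleList_append, ih, List.map_cons, List.flatten_cons]
  rw [sumList, h, List.map_ofFn, sumList]
  congr 2
  funext i
  exact (map_scaleList K (LinearMap.single K' (fun _ : Fin r => V) i) (b i)).symm

theorem IsDiagonalLift.normr [FiniteResidue K' v] [FiniteResidue K v] {t : Fin r → Fˣ}
    {y : Fin r → Ack (lat1 K' v 0)} {c : Ack (lat K' v r 0)}
    (hy : ∀ i, (y i).f = act1 K' F (t i)) (hc : c.f = act K' F r (diagGL t))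
    (h : IsDiagonalLift K' v r y c) :
    IsDiagonalLift K v r (fun i => norm1 K K' v (y i)) (Metaplectic.normr K K' v r c) := by
  obtain ⟨n, hn, a, b, d, h0, ha, hd, hr⟩ := (isDiagonalLift_iff hy hc).1 h
  refine (isDiagonalLift_iff (fun i => norm1_f (hy i)) (normr_f hc)).2
    ⟨n, hn, scaleList K K' a, fun i => scaleList K K' (b i),
      fun i => Units.map (Algebra.norm K) (d i), h0, ha.restrictScalars K,
      fun i => (Ack.isNorm_normHom _ (y i)).2 _ _ _ _ (hd i), ?_⟩
  have := (Ack.isNorm_normHom (lat_restrictScalars K K' v r 0) c).2 _ _ _ _ hr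
  rw [scaleList_sumList, scaleList_sumList, map_prod] at this
  exact this

theorem deg_restrictScalars (u : Fˣ) : deg K v u = finrank K K' * deg K' v u := by
  have h (A L : Submodule K' F) : (finrank K (Quo (A.restrictScalars K) (L.restrictScalars K)) : ℤ)
      = finrank K K' * finrank K' (Quo A L) := by
    rw [finrank_quo_restrictScalars]
    push_cast
    rfl
  rw [deg, deg, mul_sub, ← h, ← h]
  rfl

end Norm

end

section

open Module Matrix

/-! ### Bruhat decomposition -/

section Bruhat

variable {F : Type*} [Field F] {r : ℕ}

theorem permGL_apply (w : Equiv.Perm (Fin r)) (i j : Fin r) :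
    permGL F w i j = if w⁻¹ i = j then 1 else 0 := by
  change (Equiv.Perm.permMatrix F w⁻¹) i j = _
  simp [PEquiv.toMatrix_apply, Equiv.toPEquiv_apply, eq_comm]

theorem diagGL_mul_permGL_apply (t : Fin r → Fˣ) (w : Equiv.Perm (Fin r)) (i j : Fin r) :
    (diagGL t * permGL F w) i j = if i = w j then (t i : F) else 0 := by
  change (diagonal (fun i => (t i : F)) * (permGL F w : Matrix (Fin r) (Fin r) F)) i j = _
  rw [diagonal_mul, permGL_apply]
  simp [Equiv.symm_apply_eq]

/-- The unipotent matrix `1 + a b^T`, where `a_p b_q = 0` for `q ≤ p`. -/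
theorem exists_isUnipotent_vecMulVec (a b : Fin r → F)
    (h : ∀ p q, q ≤ p → a p * b q = 0) :
    ∃ u : GL (Fin r) F, IsUnipotent u ∧ (u : Matrix (Fin r) (Fin r) F) = 1 + vecMulVec a b := by
  have h1 (p q) (hpq : q < p) : (1 + vecMulVec a b) p q = 0 := by
    rw [Matrix.add_apply, one_apply_ne hpq.ne', vecMulVec_apply, h p q hpq.le, add_zero]
  have h2 (p) : (1 + vecMulVec a b) p p = 1 := by
    rw [Matrix.add_apply, one_apply_eq, vecMulVec_apply, h p p le_rfl, add_zero]
  have h3 : (1 + vecMulVec a b).det = 1 := by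
    rw [det_of_isUpperTriangular fun p q hpq => h1 p q hpq]
    exact Finset.prod_eq_one fun i _ => h2 i
  refine ⟨GeneralLinearGroup.mk'' (1 + vecMulVec a b) (by rw [h3]; exact isUnit_one),
    ⟨h2, h1⟩, rfl⟩

/-- Gaussian elimination, column by column, with upper unipotent operations only. After m stages
each of the first m columns has a single non-zero entry, which is also the only one in its row. -/
theorem exists_bruhat_aux (g : GL (Fin r) F) (m : ℕ) (hm : m ≤ r) :
    ∃ u u' : GL (Fin r) F, IsUnipotent u ∧ IsUnipotent u' ∧ ∃ σ : Fin r → Fin r,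
      ∀ j : Fin r, (j : ℕ) < m → (u * g * u') (σ j) j ≠ 0 ∧
        (∀ i, i ≠ σ j → (u * g * u') i j = 0) ∧ ∀ l, l ≠ j → (u * g * u') (σ j) l = 0 := by
  induction m with
  | zero => exact ⟨1, 1, isUnipotent_one, isUnipotent_one, id, fun j hj => absurd hj (by omega)⟩
  | succ m ih =>
    obtain ⟨u, u', hu, hu', σ, hσ⟩ := ih (by omega)
    set X := u * g * u' with hX
    let c : Fin r := ⟨m, hm⟩
    have hne : ∃ i, X i c ≠ 0 := by
      by_contra! h0
      have h1 : (X : Matrix (Fin r) (Fin r) F).det = 0 := det_eq_zero_of_column_eq_zero c h0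
      exact X.det_ne_zero h1
    -- The lowest non-zero entry is the pivot, so the rest of the column is cleared by adding a row
    -- to rows above it.
    obtain ⟨i, hi, hmax⟩ : ∃ i, X i c ≠ 0 ∧ ∀ p, i < p → X p c = 0 := by
      classical
      let s := Finset.univ.filter fun i => X i c ≠ 0
      have hs : s.Nonempty := by
        obtain ⟨i, hi⟩ := hne
        exact ⟨i, by simpa [s] using hi⟩
      refine ⟨s.max' hs, ?_, fun p hp => ?_⟩
      · simpa [s] using s.max'_mem hs
      · by_contra h0
        exact absurd (s.le_max' p (by simpa [s] using h0)) (not_le.2 hp)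
    have hlt (j : Fin r) (hj : (j : ℕ) < m) : c ≠ j ∧ j < c := by
      have : j < c := hj
      exact ⟨this.ne', this⟩
    have hiσ (j : Fin r) (hj : (j : ℕ) < m) : i ≠ σ j := by
      rintro rfl
      exact hi ((hσ j hj).2.2 c (hlt j hj).1)
    let a : Fin r → F := fun p => if p < i then -(X p c / X i c) else 0
    -- Only entries to the right of the pivot need clearing: those to its left vanish because
    -- earlier columns have their pivots in other rows.
    let b : Fin r → F := fun q => if c < q then -(X i q / X i c) else 0
    obtain ⟨w, hw, hw'⟩ := exists_isUnipotent_vecMulVec a (Pi.single i 1) (fun p q hpq => by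
      by_cases hq : q = i
      · subst hq
        simp [a, not_lt.2 hpq]
      · simp [Pi.single_eq_of_ne hq])
    obtain ⟨w', hw₁, hw₂⟩ := exists_isUnipotent_vecMulVec (Pi.single c 1) b (fun p q hpq => by
      by_cases hp : p = c
      · subst hp
        simp [b, not_lt.2 hpq]
      · simp [Pi.single_eq_of_ne hp])
    have hwX (p q) : (w * X) p q = X p q + a p * X i q := by
      change ((w : Matrix (Fin r) (Fin r) F) * X) p q = _
      rw [hw', add_mul, one_mul, Matrix.add_apply, vecMulVec_mul, vecMulVec_apply,
        single_one_vecMul]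
      rfl
    have hY (p q) : (w * X * w') p q = X p q + a p * X i q + (X p c + a p * X i c) * b q := by
      change ((w * X : GL (Fin r) F) * (w' : Matrix (Fin r) (Fin r) F)) p q = _
      rw [hw₂, mul_add, mul_one, Matrix.add_apply, mul_vecMulVec, vecMulVec_apply,
        mulVec_single_one, hwX]
      congr 2
      exact hwX p c
    refine ⟨w * u, u' * w', hw.mul hu, hu'.mul hw₁, Function.update σ c i, fun j hj => ?_⟩
    rw [show w * u * g * (u' * w') = w * X * w' by rw [hX]; group]
    have hac (p) (hp : p ≠ i) : X p c + a p * X i c = 0 := by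
      rcases lt_or_gt_of_ne hp with h | h
      · simp only [a, if_pos h]
        field_simp
        ring
      · simp [a, not_lt.2 h.le, hmax p h]
    have hai : a i = 0 := by simp [a]
    have hbc : b c = 0 := by simp [b]
    rcases Nat.lt_succ_iff_lt_or_eq.1 hj with hj | hj
    · obtain ⟨h1, h2, h3⟩ := hσ j hj
      have hXij : X i j = 0 := h2 i (hiσ j hj)
      have hbj : b j = 0 := by simp [b, (hlt j hj).2.le.not_gt]
      have haσ : a (σ j) = 0 := by simp [a, h3 c (hlt j hj).1]
      rw [Function.update_of_ne (hlt j hj).1.symm]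
      refine ⟨?_, fun p hp => ?_, fun l hl => ?_⟩
      · rw [hY, hXij, hbj]
        simpa using h1
      · rw [hY, h2 p hp, hXij, hbj]
        simp
      · rw [hY, h3 l hl, h3 c (hlt j hj).1, haσ]
        simp
    · obtain rfl : j = c := Fin.ext hj
      rw [Function.update_self]
      refine ⟨?_, fun p hp => ?_, fun l hl => ?_⟩
      · rw [hY, hai, hbc]
        simpa using hi
      · rw [hY, hac p hp, hbc]
        simp
      · rw [hY, hai]
        rcases lt_or_gt_of_ne hl with h | h
        · have h4 : (l : ℕ) < m := hj ▸ h
          have : X i l = 0 := (hσ l h4).2.1 i (hiσ l h4)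
          simp [b, h.le.not_gt, this]
        · simp only [b, if_pos h]
          field_simp
          ring

theorem exists_isBruhat (g : GL (Fin r) F) : ∃ n t w n', IsBruhat g n t w n' := by
  obtain ⟨u, u', hu, hu', σ, hσ⟩ := exists_bruhat_aux g r le_rfl
  have hinj : Function.Injective σ := by
    intro j l hjl
    by_contra hne
    have h1 := (hσ j j.2).2.2 l (Ne.symm hne)
    rw [hjl] at h1
    exact (hσ l l.2).1 h1
  let w : Equiv.Perm (Fin r) := Equiv.ofBijective σ (Finite.injective_iff_bijective.1 hinj)
  let t : Fin r → Fˣ := fun i => Units.mk0 ((u * g * u') i (w.symm i)) (by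
    have := (hσ (w.symm i) (w.symm i).2).1
    rwa [show σ (w.symm i) = i from w.apply_symm_apply i] at this)
  refine ⟨u⁻¹, t, w, u'⁻¹, hu.inv, hu'.inv, ?_⟩
  have h1 : u * g * u' = diagGL t * permGL F w := by
    refine GeneralLinearGroup.ext fun i j => ?_
    refine Eq.trans ?_ (diagGL_mul_permGL_apply t w i j).symm
    split_ifs with h
    · simp [t, h]
    · exact (hσ j j.2).2.1 i h
  rw [mul_assoc u⁻¹, ← h1]
  group

/-- Uniqueness of the monomial part. The entry in position (w j, j) is non-zero on the left, and
triangularity of u' on the right then gives w'⁻¹ w j ≤ j for all j, which forces w = w'. The entries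
in positions (i, w⁻¹ i) then give t = t'. -/
theorem IsBruhat.eq_of_mul_eq {t t' : Fin r → Fˣ} {w w' : Equiv.Perm (Fin r)}
    {u u' : GL (Fin r) F} (hu : IsUnipotent u) (hu' : IsUnipotent u')
    (h : u * (diagGL t * permGL F w) = diagGL t' * permGL F w' * u') : t = t' ∧ w = w' := by
  have h1 (i j) : u i (w j) * t (w j) = t' i * u' (w'⁻¹ i) j := by
    have h2 := congrArg (fun g : GL (Fin r) F => (g : Matrix (Fin r) (Fin r) F) i j) h
    change ((u : Matrix (Fin r) (Fin r) F) * ((diagGL t * permGL F w : GL (Fin r) F) : Matrix (Fin r) (Fin r) F)) i j =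
      (((diagGL t' * permGL F w' : GL (Fin r) F) : Matrix (Fin r) (Fin r) F) * (u' : Matrix (Fin r) (Fin r) F)) i j at h2
    rw [mul_apply, mul_apply] at h2
    have e1 (x) : (u : Matrix (Fin r) (Fin r) F) i x *
        ((diagGL t * permGL F w : GL (Fin r) F) : Matrix (Fin r) (Fin r) F) x j =
        if x = w j then u i x * t x else 0 := by
      rw [diagGL_mul_permGL_apply, mul_ite, mul_zero]
    have e2 (x) : ((diagGL t' * permGL F w' : GL (Fin r) F) : Matrix (Fin r) (Fin r) F) i x * (u' : Matrix (Fin r) (Fin r) F) x j =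
        if x = w'⁻¹ i then t' i * u' x j else 0 := by
      rw [diagGL_mul_permGL_apply, ite_mul, zero_mul]
      simp only [Equiv.Perm.eq_inv_iff_eq, eq_comm]
    simp only [e1, e2, Finset.sum_ite_eq', Finset.mem_univ, if_true] at h2
    exact h2
  have h2 (j) : w'⁻¹ (w j) ≤ j := by
    by_contra! hlt
    have := h1 (w j) j
    rw [hu.1, hu'.2 _ _ hlt, mul_zero, one_mul] at this
    exact (t (w j)).ne_zero this
  have h3 : w'⁻¹ * w = 1 := by
    -- If the image of j were smaller than j it would be fixed by induction, and injectivity would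
    -- make it equal to j.
    have key : ∀ m : ℕ, ∀ j : Fin r, (j : ℕ) = m → (w'⁻¹ * w) j = j := by
      intro m
      induction m using Nat.strong_induction_on with
      | _ m ih =>
        intro j hj
        rcases (h2 j).lt_or_eq with hlt | heq
        · have := ih _ (by omega) (w'⁻¹ (w j)) rfl
          exact (w'⁻¹ * w).injective this
        · exact heq
    exact Equiv.ext fun j => key j j rfl
  have h4 : w = w' := by rw [← inv_mul_eq_one.1 h3]
  subst h4
  refine ⟨funext fun i => Units.ext ?_, rfl⟩
  have h5 := h1 i (w⁻¹ i)
  rwa [show w (w⁻¹ i) = i from w.apply_symm_apply i, hu.1, hu'.1, one_mul, mul_one] at h5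

end Bruhat

end

section

open Module WithZero Matrix

set_option linter.unusedSectionVars false

/-! ### The local metaplectic group and its section -/

section Geo

variable {K : Type*} [Field K] {F : Type*} [Field F] [Algebra K F] {v : Valuation F ℤᵐ⁰} {r : ℕ}
  [IntegralConstants K v]

namespace Geo

theorem mk_surjective : Function.Surjective (mk K v r) := QuotientGroup.mk'_surjective _

theorem proj_mk (p : fibre K v r) : proj K v r (mk K v r p) = p.1.1 := rfl

/-- In x ⊗ y⁻¹ a scalar on the second factor counts inversely, since the antidiagonal triples (1, b,
b) become trivial. -/
theorem mk_eq_ι_mul {p q : fibre K v r} {a b : Kˣ} (h : p.1.1 = q.1.1)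
    (ha : p.1.2.1 = Ack.scal a * q.1.2.1) (hb : p.1.2.2 = Ack.scal b * q.1.2.2) :
    mk K v r p = ι K v r (a * b⁻¹) * mk K v r q := by
  let z : fibre K v r := ⟨(1, Ack.scal b, Ack.scal b),
    by simp only [map_one]; rfl, by simp only [map_one]; rfl⟩
  have hs : fibreι K v r b * p = z * (fibreι K v r a * q) := by
    refine Subtype.ext (Prod.ext ?_ (Prod.ext ?_ ?_))
    · change 1 * p.1.1 = 1 * (1 * q.1.1)
      rw [h, one_mul, one_mul]
    · change Ack.scal b * p.1.2.1 = Ack.scal b * (Ack.scal a * q.1.2.1)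
      rw [ha]
    · change 1 * p.1.2.2 = Ack.scal b * (1 * q.1.2.2)
      rw [one_mul, one_mul, hb]
  have h1 := congrArg (mk K v r) hs
  rw [map_mul, map_mul, map_mul] at h1
  have h2 : mk K v r z = 1 :=
    (QuotientGroup.eq_one_iff _).2 ⟨b, rfl⟩
  rw [h2, one_mul] at h1
  rw [mul_comm a, map_mul, map_inv, mul_assoc, eq_inv_mul_iff_mul_eq]
  exact h1

theorem mk_eq_mk {p q : fibre K v r} {c : Kˣ} (h : p.1.1 = q.1.1)
    (ha : p.1.2.1 = Ack.scal c * q.1.2.1) (hb : p.1.2.2 = Ack.scal c * q.1.2.2) :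
    mk K v r p = mk K v r q := by
  rw [mk_eq_ι_mul h ha hb, mul_inv_cancel, map_one, one_mul]

theorem ι_injective : Function.Injective (ι K v r) := by
  rw [injective_iff_map_eq_one]
  intro c hc
  obtain ⟨d, hd⟩ := (QuotientGroup.eq_one_iff _).1 hc
  have h1 : Ack.scalHom c = (Ack.scalHom d : Ack (lat1 K v 0)) :=
    congrArg (fun p => p.2.1) hd
  have h2 : (1 : Ack (lat K v r 0)) = Ack.scalHom d := congrArg (fun p => p.2.2) hd
  rw [Ack.scal_injective h1]
  exact Ack.scal_injective (h2.symm.trans (map_one Ack.scalHom).symm)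

theorem exists_ι_mul {e e' : Geo K v r} (h : proj K v r e = proj K v r e') :
    ∃ c, e = ι K v r c * e' := by
  obtain ⟨p, rfl⟩ := mk_surjective e
  obtain ⟨q, rfl⟩ := mk_surjective e'
  have h' : p.1.1 = q.1.1 := h
  obtain ⟨a, ha⟩ := Ack.exists_scal_mul (u := q.1.2.1) (v := p.1.2.1)
    (q.2.1.trans ((congrArg _ (congrArg _ h'.symm)).trans p.2.1.symm))
  obtain ⟨b, hb⟩ := Ack.exists_scal_mul (u := q.1.2.2) (v := p.1.2.2)
    (q.2.2.trans ((congrArg _ h'.symm).trans p.2.2.symm))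
  exact ⟨_, mk_eq_ι_mul h' ha hb⟩

theorem exists_ι_eq {e : Geo K v r} (h : proj K v r e = 1) : ∃ c, e = ι K v r c := by
  obtain ⟨c, hc⟩ := exists_ι_mul (e' := 1) (h.trans (map_one _).symm)
  exact ⟨c, hc.trans (mul_one _)⟩

theorem proj_surjective [FiniteResidue K v] : Function.Surjective (proj K v r) := by
  intro g
  obtain ⟨x, hx⟩ := Ack.exists_of_commens _ (commens_act1 (K := K) (v := v) (GeneralLinearGroup.det g))
  obtain ⟨y, hy⟩ := Ack.exists_of_commens _ (commens_act (K := K) (v := v) g)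
  exact ⟨mk K v r ⟨(g, x, y), hx, hy⟩, rfl⟩

/-- A canonical element is determined by its automorphism, so it is enough that both components be
canonical. -/
theorem mk_eq_triv {p : fibre K v r} {h : GL (Fin r) v.integer} (h0 : p.1.1 = ofInt v h)
    (h1 : p.1.2.1.IsTriv) (h2 : p.1.2.2.IsTriv) : mk K v r p = triv K v r h := by
  refine congrArg (mk K v r) (Subtype.ext (Prod.ext h0 (Prod.ext ?_ ?_)))
  · refine h1.eq (Ack.isTriv_triv _ (act1_int K v (GeneralLinearGroup.det h))) (p.2.1.trans ?_)
    rw [h0]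
    exact congrArg (act1 K F) (GeneralLinearGroup.map_det v.integer.subtype h)
  · refine h2.eq (Ack.isTriv_triv _ (act_ofInt K v h)) (p.2.2.trans ?_)
    rw [h0]
    rfl

end Geo

section Unipotent

variable {n n' : GL (Fin r) F} {e e' : Geo K v r}

theorem IsUnipotentSection.proj_eq (he : IsUnipotentSection K v r n e) :
    Geo.proj K v r e = n := by
  obtain ⟨p, h1, -, -, rfl⟩ := he
  exact h1

variable [FiniteResidue K v]

theorem exists_isUnipotentSection (h : IsUnipotent n) : ∃ e, IsUnipotentSection K v r n e := by
  obtain ⟨x, hx, hx'⟩ := exists_isUnipotentLift (K := K) (v := v) h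
  refine ⟨_, ⟨(n, 1, x), ?_, hx⟩, rfl, rfl, hx', rfl⟩
  rw [h.det, map_one, map_one]

theorem IsUnipotentSection.eq (h : IsUnipotent n) (he : IsUnipotentSection K v r n e)
    (he' : IsUnipotentSection K v r n e') : e = e' := by
  obtain ⟨p, h1, h2, h3, rfl⟩ := he
  obtain ⟨p', h1', h2', h3', rfl⟩ := he'
  refine congrArg (Geo.mk K v r) (Subtype.ext (Prod.ext (h1.trans h1'.symm)
    (Prod.ext (h2.trans h2'.symm) (h3.eq h3' h (p.2.2.trans ?_) (p'.2.2.trans ?_)))))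
  · rw [h1]
  · rw [h1']

theorem IsUnipotentSection.mul (h : IsUnipotent n) (h' : IsUnipotent n')
    (he : IsUnipotentSection K v r n e) (he' : IsUnipotentSection K v r n' e') :
    IsUnipotentSection K v r (n * n') (e * e') := by
  obtain ⟨p, h1, h2, h3, rfl⟩ := he
  obtain ⟨p', h1', h2', h3', rfl⟩ := he'
  refine ⟨p * p', congrArg₂ (· * ·) h1 h1', ?_, h3.mul h3' h h' (p.2.2.trans (by rw [h1]))
    (p'.2.2.trans (by rw [h1'])), (map_mul _ _ _).symm⟩
  exact (congrArg₂ (· * ·) h2 h2').trans (one_mul _)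

theorem IsUnipotentSection.mul_comm (h : IsUnipotent n) (h' : IsUnipotent n')
    (he : IsUnipotentSection K v r n e) (he' : IsUnipotentSection K v r n' e') {g : Geo K v r}
    (hg : n' * Geo.proj K v r g = Geo.proj K v r g * n) : e' * g = g * e := by
  obtain ⟨p, h1, h2, h3, rfl⟩ := he
  obtain ⟨p', h1', h2', h3', rfl⟩ := he'
  obtain ⟨q, rfl⟩ := Geo.mk_surjective g
  rw [← map_mul, ← map_mul]
  refine congrArg (Geo.mk K v r) (Subtype.ext (Prod.ext ?_ (Prod.ext ?_ ?_)))
  · change p'.1.1 * q.1.1 = q.1.1 * p.1.1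
    rw [h1, h1']
    exact hg
  · change p'.1.2.1 * q.1.2.1 = q.1.2.1 * p.1.2.1
    rw [h2, h2', one_mul, mul_one]
  · exact h3.mul_comm h3' h h' (p.2.2.trans (by rw [h1])) (p'.2.2.trans (by rw [h1'])) q.2.2 hg

/-- For integral n the lattice 𝒪^r itself is stable, and its canonical element is the
trivialisation. -/
theorem IsUnipotentSection.eq_triv (h : IsUnipotent n) (he : IsUnipotentSection K v r n e)
    {u : GL (Fin r) v.integer} (hu : n = ofInt v u) : e = Geo.triv K v r u := by
  obtain ⟨p, h1, h2, h3, rfl⟩ := he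
  refine Geo.mk_eq_triv (h1.trans hu) (by rw [h2]; exact Ack.isTriv_one) ?_
  have h4 := Ack.isTriv_triv _ (act_ofInt K v u)
  rw [h3.eq (isUnipotentLift_of_isTriv h4) h (p.2.2.trans (by rw [h1]))
    (congrArg (act K F r) hu.symm)]
  exact h4

end Unipotent

section Monomial

variable {t : Fin r → Fˣ} {w : Equiv.Perm (Fin r)} {e e' : Geo K v r}

/-- Permutation matrices over the valuation ring. -/
def permInt (v : Valuation F ℤᵐ⁰) (w : Equiv.Perm (Fin r)) : GL (Fin r) v.integer :=
  (permMatrixHom (R := v.integer)).toHomUnits w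

theorem ofInt_permInt (w : Equiv.Perm (Fin r)) : ofInt v (permInt v w) = permGL F w := by
  refine GeneralLinearGroup.ext fun i j => ?_
  rw [permGL_apply]
  change ((Equiv.Perm.permMatrix v.integer w⁻¹ i j : v.integer) : F) = _
  simp only [PEquiv.toMatrix_apply, Equiv.toPEquiv_apply]
  simp [eq_comm, apply_ite]

variable (K v) in
theorem exists_isTriv_perm (w : Equiv.Perm (Fin r)) :
    ∃ (a : Ack (lat1 K v 0)) (b : Ack (lat K v r 0)), a.IsTriv ∧
      Ack.proj a = act1 K F (GeneralLinearGroup.det (permGL F w)) ∧ b.IsTriv ∧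
      Ack.proj b = act K F r (permGL F w) := by
  rw [← ofInt_permInt (v := v)]
  exact ⟨_, _, Ack.isTriv_triv _ (act1_int K v (GeneralLinearGroup.det (permInt v w))),
    congrArg (act1 K F) (GeneralLinearGroup.map_det v.integer.subtype _).symm,
    Ack.isTriv_triv _ (act_ofInt K v (permInt v w)), rfl⟩

theorem IsMonomialSection.proj_eq (he : IsMonomialSection K v r t w e) :
    Geo.proj K v r e = diagGL t * permGL F w := by
  obtain ⟨p, y, c, a, b, -, -, -, -, -, -, -, h, rfl⟩ := he
  rw [Geo.proj_mk, h]

theorem det_diagGL (t : Fin r → Fˣ) : GeneralLinearGroup.det (diagGL t) = ∏ i, t i := by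
  refine Units.ext ?_
  rw [Units.coe_prod]
  exact det_diagonal

theorem prod_ofFn_rev {M : Type*} [CommMonoid M] (t : Fin r → M) :
    (List.ofFn fun i : Fin r => t i.rev).prod = ∏ i, t i := by
  rw [List.prod_ofFn]
  exact Equiv.prod_comp Fin.revPerm t

theorem map_prod_ofFn {M N : Type*} [Monoid M] [Monoid N] (f : M →* N) (y : Fin r → M) :
    f (List.ofFn y).prod = (List.ofFn fun i => f (y i)).prod := by
  rw [map_list_prod, List.map_ofFn]
  rfl

theorem proj_monomial {y : Fin r → Ack (lat1 K v 0)}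
    (hy : ∀ i, Ack.proj (y i) = act1 K F (t i)) {a : Ack (lat1 K v 0)}
    (ha : Ack.proj a = act1 K F (GeneralLinearGroup.det (permGL F w))) (s : Kˣ) :
    Ack.proj (Ack.scalHom s * (List.ofFn fun i : Fin r => y i.rev).prod * a) =
      act1 K F (GeneralLinearGroup.det (diagGL t * permGL F w)) := by
  have h1 : Ack.proj (Ack.scalHom s : Ack (lat1 K v 0)) = 1 := rfl
  rw [map_mul, map_mul, h1, one_mul, ha, map_mul, map_mul, map_prod_ofFn, det_diagGL,
    ← prod_ofFn_rev t, map_prod_ofFn]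
  simp only [hy]

variable [FiniteResidue K v]

theorem exists_isMonomialSection (t : Fin r → Fˣ) (w : Equiv.Perm (Fin r)) :
    ∃ e, IsMonomialSection K v r t w e := by
  choose y hy using fun i => Ack.exists_of_commens _ (commens_act1 (K := K) (v := v) (t i))
  obtain ⟨c, hc, hc'⟩ := exists_isDiagonalLift hy
  obtain ⟨a, b, ha, ha', hb, hb'⟩ := exists_isTriv_perm K v w
  refine ⟨_, ⟨_, proj_monomial hy ha' _, ?_⟩, y, c, a, b, hy, hc, hc', ha, ha', hb, hb', rfl, rfl⟩
  change Ack.proj (c * b) = act K F r (diagGL t * permGL F w)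
  rw [map_mul, map_mul, hb']
  exact congrArg (· * _) hc

/-- Two choices of the y_i differ by scalars s_i. Both y_r ⋯ y_1 and the diagonal lift are then
multiplied by ∏ s_i, which cancels in Δ. -/
theorem IsMonomialSection.eq (he : IsMonomialSection K v r t w e)
    (he' : IsMonomialSection K v r t w e') : e = e' := by
  obtain ⟨p, y, c, a, b, hy, hc, hd, ha, ha', hb, hb', hp, rfl⟩ := he
  obtain ⟨q, z, d, a', b', hz, hc', hd', ha₁, ha₁', hb₁, hb₁', hq, rfl⟩ := he'
  obtain rfl := ha.eq ha₁ (ha'.trans ha₁'.symm)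
  obtain rfl := hb.eq hb₁ (hb'.trans hb₁'.symm)
  choose s hs using fun i => Ack.exists_scal_mul (u := z i) (v := y i) ((hz i).trans (hy i).symm)
  have hy' := hd'.scal hz hc' s
  obtain rfl : y = fun i => Ack.scal (s i) * z i := funext hs
  have h1 : c = Ack.scal (∏ i, s i) * d :=
    IsDiagonalLift.eq (y := fun i => Ack.scal (s i) * z i) hy hc ((scal_mul_f _ _).trans hc') hd hy'
  refine Geo.mk_eq_mk (c := ∏ i, s i) ?_ ?_ ?_
  · rw [hp, hq]
  · rw [hp, hq]
    change _ * (List.ofFn fun i : Fin r => Ack.scal (s i.rev) * z i.rev).prod * a = _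
    have h2 : (fun i : Fin r => Ack.scal (s i.rev) * z i.rev) =
        fun i => z i.rev * Ack.scalHom (s i.rev) := funext fun i => Ack.scal_comm _ _
    rw [h2, prod_ofFn_mul (fun i => z i.rev) (fun i : Fin r => Ack.scalHom (s i.rev))
      (fun i x => Ack.scal_comm _ _), ← map_prod_ofFn, prod_ofFn_rev]
    change _ * (_ * Ack.scal _) * a = Ack.scal _ * _
    rw [← Ack.scal_comm, ← mul_assoc, ← Ack.scal_comm, mul_assoc, mul_assoc, mul_assoc]
  · rw [hp, hq, h1]
    exact mul_assoc _ _ _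

/-- For unit entries the degrees vanish, so the sign is 1, and all lifts may be chosen canonical. -/
theorem IsMonomialSection.eq_triv (he : IsMonomialSection K v r t w e)
    (ht : ∀ i, v (t i) = 1) {u : GL (Fin r) v.integer}
    (hu : diagGL t * permGL F w = ofInt v u) : e = Geo.triv K v r u := by
  have h1 (i) : (lat1 K v 0).map (act1 K F (t i) : F →ₗ[K] F) = lat1 K v 0 := by
    rw [map_act1_lat1 (m := 0) (by rw [ht, neg_zero, exp_zero]), zero_add]
  have h2 (i) : deg K v (t i) = 0 := by
    rw [deg, h1, sub_self]
  have h3 : (lat K v r 0).map (act K F r (diagGL t) : (Fin r → F) →ₗ[K] (Fin r → F)) =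
      lat K v r 0 := by
    have e : diagGL t = ofInt v (u * (permInt v w)⁻¹) := by
      rw [map_mul, ← hu, map_inv, ofInt_permInt, mul_inv_cancel_right]
    rw [e]
    exact act_ofInt K v _
  obtain ⟨a, b, ha, ha', hb, hb'⟩ := exists_isTriv_perm K v w
  let y (i : Fin r) : Ack (lat1 K v 0) := Ack.triv _ (h1 i)
  have hy (i) : (y i).IsTriv := Ack.isTriv_triv _ _
  have hy' (i) : Ack.proj (y i) = act1 K F (t i) := rfl
  let c : Ack (lat K v r 0) := Ack.triv _ h3
  have hc : c.IsTriv := Ack.isTriv_triv _ _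
  have hc' : Ack.proj c = act K F r (diagGL t) := rfl
  let p : fibre K v r := ⟨(diagGL t * permGL F w,
    Ack.scalHom ((-1) ^ ∑ i : Fin r, ((r : ℤ) - ((i : ℤ) + 1)) * deg K v (t i)) *
      (List.ofFn fun i => y i.rev).prod * a, c * b), proj_monomial hy' ha' _, by
        rw [map_mul, map_mul, hb', hc']⟩
  have h4 : IsMonomialSection K v r t w (Geo.mk K v r p) := ⟨p, y, c, a, b, hy', hc',
    isDiagonalLift_of_isTriv hy' hc' hy hc, ha, ha', hb, hb', rfl, rfl⟩
  rw [he.eq h4]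
  refine Geo.mk_eq_triv hu ?_ (hc.mul hb)
  have h5 (l : List (Ack (lat1 K v 0))) (hl : ∀ x ∈ l, x.IsTriv) : l.prod.IsTriv := by
    induction l with
    | nil => exact Ack.isTriv_one
    | cons x l ih =>
      rw [List.prod_cons]
      exact (hl x (by simp)).mul (ih fun z hz => hl z (by simp [hz]))
  change (Ack.scalHom ((-1) ^ ∑ i : Fin r, ((r : ℤ) - ((i : ℤ) + 1)) * deg K v (t i)) *
      (List.ofFn fun i => y i.rev).prod * a).IsTriv
  simp only [h2, mul_zero, Finset.sum_const_zero, zpow_zero, map_one, one_mul]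
  refine (h5 _ fun x hx => ?_).mul ha
  obtain ⟨i, rfl⟩ := List.mem_ofFn.1 hx
  exact hy _

end Monomial

section BruhatSection

variable {g n n' m m' : GL (Fin r) F} {t s : Fin r → Fˣ} {w x : Equiv.Perm (Fin r)} {e e' : Geo K v r}

theorem IsBruhatSection.proj_eq (h : IsBruhat g n t w n') (he : IsBruhatSection K v r n t w n' e) :
    Geo.proj K v r e = g := by
  obtain ⟨e₁, e₂, e₃, h1, h2, h3, rfl⟩ := he
  rw [map_mul, map_mul, h1.proj_eq, h2.proj_eq, h3.proj_eq, h.2.2, ← mul_assoc]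

variable [FiniteResidue K v]

theorem exists_isBruhatSection (h : IsBruhat g n t w n') :
    ∃ e, IsBruhatSection K v r n t w n' e := by
  obtain ⟨e₁, h1⟩ := exists_isUnipotentSection (K := K) (v := v) h.1
  obtain ⟨e₂, h2⟩ := exists_isMonomialSection (K := K) (v := v) t w
  obtain ⟨e₃, h3⟩ := exists_isUnipotentSection (K := K) (v := v) h.2.1
  exact ⟨_, e₁, e₂, e₃, h1, h2, h3, rfl⟩

/-- The two decompositions have the same monomial part, and u = m⁻¹n, u' = m'n'⁻¹ satisfy u(tw) =
(tw)u'. Multiplicativity splits the lifts of n = mu and m' = u'n', and the conjugation rule moves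
the lift of u across the monomial lift. -/
theorem IsBruhatSection.eq (h : IsBruhat g n t w n') (h' : IsBruhat g m s x m')
    (he : IsBruhatSection K v r n t w n' e) (he' : IsBruhatSection K v r m s x m' e') :
    e = e' := by
  obtain ⟨e₁, e₂, e₃, h1, h2, h3, rfl⟩ := he
  obtain ⟨f₁, f₂, f₃, h1', h2', h3', rfl⟩ := he'
  have hu : IsUnipotent (m⁻¹ * n) := h'.1.inv.mul h.1
  have hu' : IsUnipotent (m' * n'⁻¹) := h'.2.1.mul h.2.1.inv
  have key : m⁻¹ * n * (diagGL t * permGL F w) = diagGL s * permGL F x * (m' * n'⁻¹) := by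
    have := h.2.2.symm.trans h'.2.2
    rw [mul_assoc m⁻¹, inv_mul_eq_iff_eq_mul, ← mul_assoc n, eq_comm, ← mul_assoc, ← mul_assoc,
      mul_inv_eq_iff_eq_mul, ← mul_assoc]
    exact this.symm
  obtain ⟨rfl, rfl⟩ := IsBruhat.eq_of_mul_eq hu hu' key
  obtain rfl := h2.eq h2'
  obtain ⟨a, ha⟩ := exists_isUnipotentSection (K := K) (v := v) hu
  obtain ⟨a', ha'⟩ := exists_isUnipotentSection (K := K) (v := v) hu'
  have q1 : e₁ = f₁ * a := by
    have := h1'.mul h'.1 hu ha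
    rw [mul_inv_cancel_left] at this
    exact h1.eq h.1 this
  have q2 : f₃ = a' * e₃ := by
    have := ha'.mul hu' h.2.1 h3
    rw [inv_mul_cancel_right] at this
    exact h3'.eq h'.2.1 this
  have q3 : a * e₂ = e₂ * a' := ha'.mul_comm hu' hu ha (by rw [h2.proj_eq, key])
  rw [q1, q2, mul_assoc f₁, q3]
  simp only [mul_assoc]

/-- The criterion that places the local sections of a global matrix in the restricted product. -/
theorem IsBruhatSection.mem_range_triv (h : IsBruhat g n t w n')
    (he : IsBruhatSection K v r n t w n' e) (hn : n ∈ (ofInt (r := r) v).range)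
    (hn' : n' ∈ (ofInt (r := r) v).range) (ht : diagGL t ∈ (ofInt (r := r) v).range)
    (ht' : ∀ i, v (t i) = 1) : e ∈ (Geo.triv K v r).range := by
  obtain ⟨e₁, e₂, e₃, h1, h2, h3, rfl⟩ := he
  obtain ⟨u, hu⟩ := hn
  obtain ⟨u', hu'⟩ := hn'
  obtain ⟨d, hd⟩ := ht
  rw [h1.eq_triv h.1 hu.symm, h3.eq_triv h.2.1 hu'.symm, h2.eq_triv ht' (u := d * permInt v w)
    (by rw [map_mul, hd, ofInt_permInt]), ← map_mul, ← map_mul]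
  exact ⟨_, rfl⟩

namespace Geo

theorem existsUnique_isSection (g : GL (Fin r) F) : ∃! e, IsSection K v r g e := by
  obtain ⟨n, t, w, n', h⟩ := exists_isBruhat g
  obtain ⟨e, he⟩ := exists_isBruhatSection (K := K) (v := v) h
  refine ⟨e, ⟨n, t, w, n', h, he⟩, ?_⟩
  rintro e' ⟨m, s, x, m', h', he'⟩
  exact he'.eq h' h he

theorem isSection_sect (g : GL (Fin r) F) : IsSection K v r g (sect K v r g) :=
  Classical.epsilon_spec (existsUnique_isSection g).exists

theorem proj_sect (g : GL (Fin r) F) : proj K v r (sect K v r g) = g := by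
  obtain ⟨n, t, w, n', h, he⟩ := isSection_sect (K := K) (v := v) g
  exact he.proj_eq h

theorem sect_eq (h : IsBruhat g n t w n') (he : IsBruhatSection K v r n t w n' e) :
    sect K v r g = e := by
  obtain ⟨m, s, x, m', h', he'⟩ := isSection_sect (K := K) (v := v) g
  exact he'.eq h' h he

theorem triv_eq (h : GL (Fin r) v.integer) :
    triv K v r h = ι K v r (kappa K v r h) * sect K v r (ofInt v h) :=
  Classical.epsilon_spec (p := fun c => triv K v r h = ι K v r c * sect K v r (ofInt v h))
    (exists_ι_mul (by rw [proj_triv, proj_sect]))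

end Geo

end BruhatSection

end Geo

end

section

open Module WithZero Matrix

/-! ### The norm between local metaplectic groups -/

section GeoNorm

variable (K : Type*) [Field K] (K' : Type*) [Field K'] [Algebra K K'] [FiniteDimensional K K']
  {F : Type*} [Field F] [Algebra K F] [Algebra K' F] [IsScalarTower K K' F]
  (v : Valuation F ℤᵐ⁰) (r : ℕ) [IntegralConstants K v] [IntegralConstants K' v]

/-- The norm on triples. -/
def fibreNorm : fibre K' v r →* fibre K v r where
  toFun p := ⟨(p.1.1, norm1 K K' v p.1.2.1, normr K K' v r p.1.2.2), norm1_f p.2.1, normr_f p.2.2⟩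
  map_one' := Subtype.ext (Prod.ext rfl (Prod.ext (map_one _) (map_one _)))
  map_mul' _ _ := Subtype.ext (Prod.ext rfl (Prod.ext (map_mul _ _ _) (map_mul _ _ _)))

/-- The norm from the geometric metaplectic group over `K'` to the one over `K`. -/
def Geo.norm : Geo K' v r →* Geo K v r :=
  QuotientGroup.map _ _ (fibreNorm K K' v r) (by
    rintro p ⟨c, hc⟩
    refine ⟨Units.map (Algebra.norm K) c, ?_⟩
    change (p.1.1, norm1 K K' v p.1.2.1, normr K K' v r p.1.2.2) = _
    rw [hc]
    exact Prod.ext rfl (Prod.ext (Ack.normHom_scal _ c) (Ack.normHom_scal _ c)))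

variable {K K' v r}

theorem Geo.norm_ι (c : K'ˣ) :
    norm K K' v r (ι K' v r c) = ι K v r (Units.map (Algebra.norm K) c) :=
  congrArg (mk K v r) (Subtype.ext (Prod.ext rfl (Prod.ext (Ack.normHom_scal _ c) (map_one _))))

theorem Geo.proj_norm (e : Geo K' v r) : proj K v r (norm K K' v r e) = proj K' v r e := by
  obtain ⟨p, rfl⟩ := mk_surjective e
  rfl

theorem Geo.norm_triv (h : GL (Fin r) v.integer) :
    norm K K' v r (triv K' v r h) = triv K v r h :=
  Geo.mk_eq_triv rfl ((Ack.isTriv_triv _ (act1_int K' v (GeneralLinearGroup.det h))).normHom _)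
    ((Ack.isTriv_triv _ (act_ofInt K' v h)).normHom _)

theorem IsUnipotentSection.norm {n : GL (Fin r) F} {e : Geo K' v r}
    (h : IsUnipotentSection K' v r n e) : IsUnipotentSection K v r n (Geo.norm K K' v r e) := by
  obtain ⟨p, h1, h2, h3, rfl⟩ := h
  refine ⟨fibreNorm K K' v r p, h1, ?_, h3.normr, rfl⟩
  exact (congrArg (norm1 K K' v) h2).trans (map_one _)

theorem norm_neg_one : Units.map (Algebra.norm K) (-1 : K'ˣ) = (-1) ^ finrank K K' := by
  refine Units.ext ?_
  have : Algebra.norm K (algebraMap K K' (-1)) = _ := Algebra.norm_algebraMap (-1 : K)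
  rw [map_neg, map_one] at this
  simpa using this

/-- Besides the compatibility of the lifts, the sign must match: N(-1) = (-1)^[K':K], and the degree
over K is [K':K] times the degree over K'. -/
theorem IsMonomialSection.norm [FiniteResidue K v] [FiniteResidue K' v] {t : Fin r → Fˣ}
    {w : Equiv.Perm (Fin r)} {e : Geo K' v r} (h : IsMonomialSection K' v r t w e) :
    IsMonomialSection K v r t w (Geo.norm K K' v r e) := by
  obtain ⟨p, y, c, a, b, hy, hc, hd, ha, ha', hb, hb', hp, rfl⟩ := h
  refine ⟨fibreNorm K K' v r p, fun i => norm1 K K' v (y i), normr K K' v r c, norm1 K K' v a,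
    normr K K' v r b, fun i => norm1_f (hy i), normr_f hc, hd.normr hy hc, ha.normHom _,
    norm1_f ha', hb.normHom _, normr_f hb', ?_, rfl⟩
  change (p.1.1, norm1 K K' v p.1.2.1, normr K K' v r p.1.2.2) = _
  rw [hp]
  refine Prod.ext rfl (Prod.ext ?_ (map_mul _ _ _))
  change norm1 K K' v (Ack.scalHom _ * _ * a) = _
  rw [map_mul, map_mul, map_prod_ofFn]
  congr 2
  refine (Ack.normHom_scal _ _).trans (congrArg Ack.scal ?_)
  rw [map_zpow, norm_neg_one, ← zpow_natCast, ← _root_.zpow_mul, Finset.mul_sum]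
  congr 1
  refine Finset.sum_congr rfl fun i _ => ?_
  rw [deg_restrictScalars (K := K) (K' := K')]
  ring

theorem IsBruhatSection.norm [FiniteResidue K v] [FiniteResidue K' v] {t : Fin r → Fˣ}
    {w : Equiv.Perm (Fin r)} {n n' : GL (Fin r) F} {e : Geo K' v r}
    (h : IsBruhatSection K' v r n t w n' e) :
    IsBruhatSection K v r n t w n' (Geo.norm K K' v r e) := by
  obtain ⟨e₁, e₂, e₃, h1, h2, h3, rfl⟩ := h
  exact ⟨_, _, _, h1.norm, h2.norm, h3.norm, by rw [map_mul, map_mul]⟩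

end GeoNorm

/-! ### The adelic extension -/

section AdelicRow

open RestrictedProduct

variable {I : Type*} {k : Type*} [Field k] {K : I → Type*} [∀ i, Field (K i)]
  {F : I → Type*} [∀ i, Field (F i)] [∀ i, Algebra (K i) (F i)]
  {v : ∀ i, Valuation (F i) ℤᵐ⁰} [∀ i, IntegralConstants (K i) (v i)]
  {N : ∀ i, (K i)ˣ →* kˣ} {r : ℕ}

namespace AdelicMeta

theorem mk_surjective : Function.Surjective (mk K v N r) := QuotientGroup.mk'_surjective _

/-- At almost all i the scalar lies in the image of the splitting, which meets the scalars only in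
1. Hence the finiteness condition in `pushRel` is automatic for families of scalars in the
restricted product. -/
theorem finite_ne_one_of_mem_range {x : ∀ i, (K i)ˣ} {e : AdelicGeo K v r}
    (h : ∀ i, e i = Geo.ι (K i) (v i) r (x i)) : {i | x i ≠ 1}.Finite := by
  refine Set.Finite.subset e.2 fun i hi hmem => hi ?_
  obtain ⟨u, hu⟩ := hmem
  have h1 : Geo.triv (K i) (v i) r u = Geo.ι (K i) (v i) r (x i) := hu.trans (h i)
  have h2 : ofInt (v i) u = 1 := by
    rw [← Geo.proj_triv (K i), h1, Geo.proj_ι]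
  have h3 : u = 1 := by
    refine GeneralLinearGroup.ext fun a b => Subtype.ext ?_
    have h4 := congrArg (fun g : GL (Fin r) (F i) => (g : Matrix (Fin r) (Fin r) (F i)) a b) h2
    refine h4.trans ?_
    change (1 : Matrix (Fin r) (Fin r) (F i)) a b =
      ((1 : Matrix (Fin r) (Fin r) (v i).integer) a b : F i)
    rw [Matrix.one_apply, Matrix.one_apply]
    split_ifs <;> rfl
  rw [h3, map_one] at h1
  exact Geo.ι_injective (h1.symm.trans (map_one _).symm)

theorem mk_eq_one_iff {p : kˣ × AdelicGeo K v r} : mk K v N r p = 1 ↔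
    ∃ x : ∀ i, (K i)ˣ, (∀ i, p.2 i = Geo.ι (K i) (v i) r (x i)) ∧ p.1 = (∏ᶠ i, N i (x i))⁻¹ := by
  refine (QuotientGroup.eq_one_iff p).trans ⟨?_, ?_⟩
  · rintro ⟨x, -, h1, h2⟩
    exact ⟨x, h1, h2⟩
  · rintro ⟨x, h1, h2⟩
    exact ⟨x, finite_ne_one_of_mem_range h1, h1, h2⟩

theorem mk_eq_ι {e : AdelicGeo K v r} {x : ∀ i, (K i)ˣ} (m : kˣ)
    (h : ∀ i, e i = Geo.ι (K i) (v i) r (x i)) :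
    mk K v N r (m, e) = ι K v N r (m * ∏ᶠ i, N i (x i)) := by
  have h1 : mk K v N r ((∏ᶠ i, N i (x i))⁻¹, e) = 1 := mk_eq_one_iff.2 ⟨x, h, rfl⟩
  have h2 : ((m, e) : kˣ × AdelicGeo K v r) = (m * ∏ᶠ i, N i (x i), 1) * ((∏ᶠ i, N i (x i))⁻¹, e) :=
    Prod.ext (mul_inv_cancel_right _ _).symm (one_mul _).symm
  rw [h2, map_mul, h1, mul_one]
  rfl

theorem ι_injective : Function.Injective (ι K v N r) := by
  rw [injective_iff_map_eq_one]
  intro c hc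
  obtain ⟨x, h1, h2⟩ := mk_eq_one_iff.1 hc
  have h3 (i) : x i = 1 := Geo.ι_injective ((h1 i).symm.trans (map_one _).symm)
  simp only [h3, map_one, finprod_one, inv_one] at h2
  exact h2

theorem ι_comm (c : kˣ) (e : AdelicMeta K v N r) : ι K v N r c * e = e * ι K v N r c := by
  obtain ⟨p, rfl⟩ := mk_surjective e
  change mk K v N r ((c, 1) * p) = mk K v N r (p * (c, 1))
  congr 1
  exact Prod.ext (mul_comm _ _) ((one_mul _).trans (mul_one _).symm)

theorem exists_ι_eq {e : AdelicMeta K v N r} (h : ∀ i, proj K v N r e i = 1) :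
    ∃ c, e = ι K v N r c := by
  obtain ⟨⟨m, p⟩, rfl⟩ := mk_surjective e
  choose x hx using fun i => Geo.exists_ι_eq (h i)
  exact ⟨_, mk_eq_ι m hx⟩

theorem proj_ι (c : kˣ) : proj K v N r (ι K v N r c) = 1 := rfl

theorem proj_surjective [∀ i, FiniteResidue (K i) (v i)] :
    Function.Surjective (proj K v N r) := by
  classical
  intro g
  choose e he using fun i => Geo.proj_surjective (K := K i) (v := v i) (r := r) (g i)
  -- The canonical lift is used wherever g i is integral, that is almost everywhere, so that the
  -- family of lifts is in the restricted product.
  let e' (i : I) : Geo (K i) (v i) r :=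
    if h : g i ∈ (ofInt (r := r) (v i)).range then Geo.triv (K i) (v i) r h.choose else e i
  have he' (i) : Geo.proj (K i) (v i) r (e' i) = g i := by
    by_cases h : g i ∈ (ofInt (r := r) (v i)).range
    · simp only [e', dif_pos h]
      rw [Geo.proj_triv]
      exact h.choose_spec
    · simp only [e', dif_neg h]
      exact he i
  refine ⟨mk K v N r (1, ⟨e', ?_⟩), RestrictedProduct.ext _ _ he'⟩
  refine g.2.mono fun i hi => ?_
  have hi' : g i ∈ (ofInt (r := r) (v i)).range := hi
  simp only [e', dif_pos hi']
  exact ⟨_, rfl⟩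

theorem isCentralExtension [∀ i, FiniteResidue (K i) (v i)] :
    IsCentralExtension (ι K v N r) (proj K v N r) where
  injective := ι_injective
  exact := by
    ext e
    constructor
    · rintro ⟨c, rfl⟩
      exact proj_ι c
    · intro h
      obtain ⟨c, hc⟩ := exists_ι_eq fun i => congrArg (· i) (MonoidHom.mem_ker.1 h)
      exact ⟨c, hc.symm⟩
  surjective := proj_surjective
  central := by
    rintro _ ⟨c, rfl⟩
    exact Subgroup.mem_center_iff.2 fun e => (ι_comm c e).symm

end AdelicMeta

end AdelicRow

end

section

open Module WithZero Matrix Polynomial IsDedekindDomain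

/-! ### Places of k(ϖ): residue fields and integrality almost everywhere -/

section Places

variable {k : Type*} [Field k]

theorem exists_placeVal_uniformizer (p : Place k) : ∃ f, placeVal p f = exp (-1 : ℤ) := by
  rcases p with _ | p
  · classical
    exact ⟨_, RatFunc.inftyValuation.X_inv k⟩
  · exact p.valuation_exists_uniformizer (RatFunc k)

/-- The field is dense in its completion and the translate x + 𝒪 is open. -/
theorem exists_sub_mem_integer {F : Type*} [Field F] (w : Valuation F ℤᵐ⁰) (x : w.Completion) :
    ∃ y : WithVal w, (Valued.v : Valuation w.Completion ℤᵐ⁰) (x - (y : w.Completion)) ≤ 1 := by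
  have ho : IsOpen ((fun y : w.Completion => x - y) ⁻¹'
      ((Valued.v : Valuation w.Completion ℤᵐ⁰).integer : Set w.Completion)) :=
    (Valued.isOpen_integer _).preimage (continuous_const.sub continuous_id)
  obtain ⟨y, hy⟩ := (UniformSpace.Completion.denseRange_coe (α := WithVal w)).exists_mem_open
    ho ⟨x, by simp⟩
  exact ⟨y, hy⟩

theorem exists_locVal_sub_le_one (p : Place k) (x : Loc p) :
    ∃ f, locVal p (x - toLoc p f) ≤ 1 := by
  obtain ⟨y, hy⟩ := exists_sub_mem_integer (placeVal p) x
  exact ⟨WithVal.equiv (placeVal p) y, hy⟩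

theorem exists_locVal_sub_le (p : Place k) (x : Loc p) :
    ∃ f, locVal p (x - toLoc p f) ≤ exp (-1 : ℤ) := by
  obtain ⟨π, hπ⟩ := exists_placeVal_uniformizer p
  have hπ0 : toLoc p π ≠ 0 := by
    rw [← (locVal p).ne_zero_iff, locVal_toLoc, hπ]
    exact exp_ne_zero
  -- An error in 𝒪 for x/π becomes an error in 𝔭 for x.
  obtain ⟨f, hf⟩ := exists_locVal_sub_le_one p (x / toLoc p π)
  refine ⟨f * π, ?_⟩
  have e : x - toLoc p (f * π) = (x / toLoc p π - toLoc p f) * toLoc p π := by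
    rw [map_mul, sub_mul, div_mul_cancel₀ _ hπ0]
  rw [e, map_mul, locVal_toLoc, hπ]
  exact mul_le_of_le_one_left' hf

/-- The embedding of `F` in `F_p`, as a `k`-linear map. -/
def toLocLin (p : Place k) : RatFunc k →ₗ[k] Loc p where
  toFun := toLoc p
  map_add' := map_add _
  map_smul' c f := by
    rw [Algebra.smul_def, Algebra.smul_def, map_mul]
    rfl

theorem le_exp_neg_one {x : ℤᵐ⁰} (h : x < 1) : x ≤ exp (-1 : ℤ) := by
  rcases eq_or_ne x 0 with rfl | h0
  · exact zero_le
  · rw [← exp_log h0] at h ⊢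
    rw [← exp_zero, exp_lt_exp] at h
    exact exp_le_exp.2 (by omega)

theorem exists_degree_sub_lt {a b : k[X]} (hb : b ≠ 0) (h : a.natDegree ≤ b.natDegree) :
    ∃ c : k, (a - Polynomial.C c * b).degree < b.natDegree := by
  refine ⟨a.coeff b.natDegree / b.leadingCoeff, (degree_lt_iff_coeff_zero _ _).2 fun m hm => ?_⟩
  rw [coeff_sub, coeff_C_mul]
  rcases hm.lt_or_eq with hm | rfl
  · rw [coeff_eq_zero_of_natDegree_lt hm, coeff_eq_zero_of_natDegree_lt (h.trans_lt hm), mul_zero,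
      sub_zero]
  · rw [coeff_natDegree, div_mul_cancel₀ _ (leadingCoeff_ne_zero.2 hb), sub_self]

/-- Finiteness of the residue field over k, seen inside k(ϖ). At infinity the constants represent
all classes, by matching the coefficient in the degree of the denominator; at a finite place
polynomials of bounded degree do. -/
theorem exists_finite_approx (p : Place k) : ∃ N : Submodule k (RatFunc k), N.FG ∧
    ∀ f, placeVal p f ≤ 1 → ∃ g ∈ N, placeVal p (f - g) ≤ exp (-1 : ℤ) := by
  rcases p with _ | p
  · classical
    refine ⟨Submodule.span k {1}, Submodule.fg_span_singleton 1, fun f hf => ?_⟩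
    have hpl (a : k[X]) (ha : a ≠ 0) : RatFunc.inftyValuation k (algebraMap k[X] (RatFunc k) a) =
        exp (a.natDegree : ℤ) := RatFunc.inftyValuation.polynomial k ha
    have hb0 := f.denom_ne_zero
    have hb0' : algebraMap k[X] (RatFunc k) f.denom ≠ 0 := by simpa using hb0
    have hab : algebraMap k[X] (RatFunc k) f.num = f * algebraMap k[X] (RatFunc k) f.denom :=
      (div_eq_iff hb0').1 f.num_div_denom
    have hdeg : f.num.natDegree ≤ f.denom.natDegree := by
      rcases eq_or_ne f.num 0 with h0 | h0
      · rw [h0, natDegree_zero]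
        exact Nat.zero_le _
      · have h1 : exp (f.num.natDegree : ℤ) ≤ exp (f.denom.natDegree : ℤ) := by
          rw [← hpl _ h0, ← hpl _ hb0, hab, map_mul]
          exact mul_le_of_le_one_left' hf
        exact_mod_cast exp_le_exp.1 h1
    obtain ⟨c, hc⟩ := exists_degree_sub_lt hb0 hdeg
    refine ⟨algebraMap k (RatFunc k) c, Submodule.mem_span_singleton.2
      ⟨c, (Algebra.algebraMap_eq_smul_one c).symm⟩, le_exp_neg_one ?_⟩
    have key : RatFunc.inftyValuation k (algebraMap k[X] (RatFunc k)
        (f.num - Polynomial.C c * f.denom)) < exp (f.denom.natDegree : ℤ) := by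
      rcases eq_or_ne (f.num - Polynomial.C c * f.denom) 0 with h0 | h0
      · rw [h0, map_zero, map_zero]
        exact exp_pos
      · rw [hpl _ h0, exp_lt_exp]
        rw [degree_eq_natDegree h0] at hc
        exact_mod_cast hc
    rw [map_sub, map_mul, hab, ← sub_mul, map_mul, hpl _ hb0] at key
    exact lt_of_mul_lt_mul_right' (key.trans_eq (one_mul _).symm)
  · obtain ⟨q, hq, hq0⟩ := p.asIdeal.ne_bot_iff.1 p.ne_bot
    refine ⟨(Polynomial.degreeLT k q.natDegree).map
      (IsScalarTower.toAlgHom k k[X] (RatFunc k)).toLinearMap, ?_, fun f hf => ?_⟩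
    · have : Module.Finite k (Polynomial.degreeLT k q.natDegree) :=
        Module.Finite.equiv (Polynomial.degreeLTEquiv k q.natDegree).symm
      exact (Module.Finite.iff_fg.1 this).map _
    · obtain ⟨a, ha⟩ := p.exists_valuation_sub_lt_of_integer hf 1
      refine ⟨algebraMap k[X] (RatFunc k) (a % q), ⟨a % q, ?_, rfl⟩, ?_⟩
      · rw [SetLike.mem_coe, Polynomial.mem_degreeLT, ← degree_eq_natDegree hq0]
        exact degree_mod_lt a hq0
      · change p.valuation (RatFunc k) _ ≤ _
        rw [← sub_add_sub_cancel f (algebraMap k[X] (RatFunc k) a)]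
        refine le_exp_neg_one ((Valuation.map_add_lt _ ?_ ?_))
        · rw [Valuation.map_sub_swap]
          exact ha
        · rw [← map_sub, p.valuation_lt_one_iff_mem, EuclideanDomain.mod_eq_sub_mul_div, sub_sub_cancel]
          exact p.asIdeal.mul_mem_right _ hq

instance (p : Place k) : FiniteResidue k (locVal p) where
  fin := by
    obtain ⟨N, hN, h⟩ := exists_finite_approx p
    refine fin_quo_iff.2 ⟨N.map (toLocLin p), hN.map _, fun x hx => ?_⟩
    obtain ⟨f, hf⟩ := exists_locVal_sub_le p x
    have hx' : locVal p x ≤ 1 := by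
      rwa [mem_lat1, neg_zero, exp_zero] at hx
    have hf' : placeVal p f ≤ 1 := by
      rw [← locVal_toLoc, ← sub_sub_cancel x (toLoc p f)]
      refine (Valuation.map_sub _ _ _).trans (max_le hx' (hf.trans ?_))
      rw [← exp_zero, exp_le_exp]
      norm_num
    obtain ⟨g, hg, hfg⟩ := h f hf'
    refine Submodule.mem_sup.2 ⟨x - toLoc p g, ?_, toLoc p g, ⟨g, hg, rfl⟩, sub_add_cancel _ _⟩
    rw [mem_lat1, ← sub_add_sub_cancel x (toLoc p f)]
    refine Valuation.map_add_le _ hf ?_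
    rw [← map_sub, locVal_toLoc]
    exact hfg
  exists_uniformizer := by
    obtain ⟨f, hf⟩ := exists_placeVal_uniformizer p
    exact ⟨toLoc p f, (locVal_toLoc p f).trans hf⟩

instance (p : Place k) : FiniteDimensional k (ResField p) := by
  have := FiniteResidue.fin (K := k) (v := locVal p)
  -- Constants map injectively to 𝒪/𝔭: a non-zero constant and its inverse are both integral, so it
  -- is not in 𝔭.
  let f : ResField p →ₗ[k] Quo (lat1 k (locVal p) 0) (lat1 k (locVal p) 1) :=
    LinearMap.codRestrict _ ((lat1 k (locVal p) 1).mkQ ∘ₗ (ResField p).val.toLinearMap) fun c =>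
      Submodule.mem_map_of_mem (by
        rw [mem_lat1, neg_zero, exp_zero]
        exact IntegralConstants.le_one (K := ResField p) (v := locVal p) c)
  refine FiniteDimensional.of_injective f ((injective_iff_map_eq_zero f).2 fun c hc => ?_)
  by_contra h0
  have h1 : (c : Loc p) ∈ lat1 k (locVal p) 1 :=
    (Submodule.Quotient.mk_eq_zero _).1 (congrArg Subtype.val hc)
  have h2 : locVal p ((c⁻¹ : ResField p) : Loc p) ≤ 1 :=
    IntegralConstants.le_one (K := ResField p) (v := locVal p) c⁻¹
  have h3 : locVal p (c : Loc p) * locVal p ((c⁻¹ : ResField p) : Loc p) = 1 := by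
    rw [← map_mul, ← MulMemClass.coe_mul, mul_inv_cancel₀ h0, OneMemClass.coe_one, map_one]
  have h4 : (1 : ℤᵐ⁰) ≤ exp (-1) := by
    rw [← h3]
    exact (mul_le_of_le_one_right' h2).trans h1
  rw [← exp_zero, exp_le_exp] at h4
  norm_num at h4

instance (p : Place k) : FiniteResidue (ResField p) (locVal p) where
  fin := by
    obtain ⟨N, hN, h⟩ := fin_quo_iff.1 (FiniteResidue.fin (K := k) (v := locVal p))
    obtain ⟨s, hs⟩ := hN
    refine fin_quo_iff.2 ⟨Submodule.span (ResField p) s, ⟨s, rfl⟩, fun x hx => ?_⟩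
    obtain ⟨y, hy, z, hz, rfl⟩ := Submodule.mem_sup.1 (h hx)
    refine Submodule.mem_sup.2 ⟨y, hy, z, ?_, rfl⟩
    rw [← hs] at hz
    exact Submodule.span_subset_span k (ResField p) _ hz
  exists_uniformizer := FiniteResidue.exists_uniformizer k

/-- A rational function has finitely many poles; the place at infinity is simply added to the finite
ones. -/
theorem finite_one_lt_placeVal (f : RatFunc k) : {p : Place k | 1 < placeVal p f}.Finite := by
  have h := (HeightOneSpectrum.Support.finite k[X] f).image (some : _ → Place k)
  refine (h.insert none).subset ?_
  rintro (_ | p) hp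
  · exact Or.inl rfl
  · exact Or.inr ⟨p, hp, rfl⟩

open Filter in
theorem eventually_mem_range_ofInt {r : ℕ} (g : GL (Fin r) (RatFunc k)) :
    ∀ᶠ p : Place k in cofinite, glLoc p g ∈ (ofInt (r := r) (locVal p)).range := by
  have h1 (g : GL (Fin r) (RatFunc k)) : ∀ᶠ p : Place k in cofinite, ∀ i j, placeVal p (g i j) ≤ 1 := by
    rw [eventually_all]
    intro i
    rw [eventually_all]
    intro j
    refine (finite_one_lt_placeVal (g i j)).subset fun p hp => ?_
    simpa using hp
  -- Both g and its inverse must have integral entries for g to come from GL_r of the valuation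
  -- ring.
  filter_upwards [h1 g, h1 g⁻¹] with p hg hg'
  have key (g : GL (Fin r) (RatFunc k)) (hg : ∀ i j, placeVal p (g i j) ≤ 1) :
      ∃ M : Matrix (Fin r) (Fin r) (locVal p).integer, M.map (locVal p).integer.subtype =
        (glLoc p g : Matrix (Fin r) (Fin r) (Loc p)) :=
    ⟨of fun i j => ⟨toLoc p (g i j), (locVal_toLoc p _).trans_le (hg i j)⟩, rfl⟩
  obtain ⟨M, hM⟩ := key g hg
  obtain ⟨M', hM'⟩ := key g⁻¹ hg'
  have hinj : Function.Injective fun M : Matrix (Fin r) (Fin r) (locVal p).integer =>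
      M.map (locVal p).integer.subtype := Matrix.map_injective Subtype.val_injective
  refine ⟨⟨M, M', hinj ?_, hinj ?_⟩, GeneralLinearGroup.ext fun i j => ?_⟩
  · change (M * M').map (locVal p).integer.subtype = (1 : Matrix _ _ _).map _
    rw [Matrix.map_mul, hM, hM', Matrix.map_one _ (map_zero _) (map_one _)]
    exact congrArg Units.val (show glLoc p g * glLoc p g⁻¹ = 1 by simp)
  · change (M' * M).map (locVal p).integer.subtype = (1 : Matrix _ _ _).map _
    rw [Matrix.map_mul, hM, hM', Matrix.map_one _ (map_zero _) (map_one _)]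
    exact congrArg Units.val (show glLoc p g⁻¹ * glLoc p g = 1 by simp)
  · exact congrFun (congrFun hM i) j

open Filter in
theorem eventually_val_eq_one (t : (RatFunc k)ˣ) :
    ∀ᶠ p : Place k in cofinite, locVal p (toLoc p t) = 1 := by
  have h1 (f : RatFunc k) : ∀ᶠ p : Place k in cofinite, placeVal p f ≤ 1 :=
    (finite_one_lt_placeVal f).subset fun p hp => by
      simpa using hp
  filter_upwards [h1 t, h1 (t⁻¹ : (RatFunc k)ˣ)] with p h h'
  rw [locVal_toLoc]
  refine le_antisymm h ?_
  rw [Units.val_inv_eq_inv_val, map_inv₀] at h'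
  exact (inv_le_one₀ (zero_lt_iff.2 ((Valuation.ne_zero_iff _).2 t.ne_zero))).1 h'

end Places

end

section

open Module WithZero Matrix Polynomial IsDedekindDomain RestrictedProduct

/-! ### The adelic norm is an isomorphism -/

section AdelicNorm

variable {I : Type*} {k : Type*} [Field k] (K : I → Type*) [∀ i, Field (K i)]
  [∀ i, Algebra k (K i)] [∀ i, FiniteDimensional k (K i)]
  {F : I → Type*} [∀ i, Field (F i)] [∀ i, Algebra k (F i)] [∀ i, Algebra (K i) (F i)]
  [∀ i, IsScalarTower k (K i) (F i)]
  (v : ∀ i, Valuation (F i) ℤᵐ⁰) [∀ i, IntegralConstants k (v i)]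
  [∀ i, IntegralConstants (K i) (v i)] (r : ℕ)

/-- The norms on all factors of the restricted product. -/
def AdelicGeo.norm : AdelicGeo K v r →* AdelicGeo (fun _ => k) v r :=
  let N (i : I) : Geo (K i) (v i) r →* Geo k (v i) r := Geo.norm k (K i) (v i) r
  mapAlongMonoidHom (fun i => Geo (K i) (v i) r) (fun i => Geo k (v i) r) id Filter.tendsto_id
    N (Filter.Eventually.of_forall (by
      rintro i _ ⟨h, rfl⟩
      exact ⟨h, (Geo.norm_triv (K := k) (K' := K i) (F := F i) (v := v i) h).symm⟩))

namespace AdelicMeta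

/-- The morphism of extensions given by the norms on all factors. -/
def norm : AdelicMeta K v (fun i => Units.map (Algebra.norm k : K i →* k)) r →*
    AdelicMeta (fun _ => k) v (fun _ => MonoidHom.id kˣ) r :=
  QuotientGroup.map _ _ ((MonoidHom.id kˣ).prodMap (AdelicGeo.norm K v r)) (by
    rintro p ⟨x, hx, h1, h2⟩
    refine ⟨fun i => Units.map (Algebra.norm k) (x i), hx.subset fun i hi h0 => hi ?_,
      fun i => ?_, h2⟩
    · change Units.map (Algebra.norm k) (x i) = 1
      rw [h0, map_one]
    · change Geo.norm k (K i) (v i) r (p.2 i) = _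
      rw [h1, Geo.norm_ι])

variable {K v r}

theorem norm_mk (m : kˣ) (e : AdelicGeo K v r) :
    norm K v r (mk K v _ r (m, e)) = mk (fun _ => k) v (fun _ => MonoidHom.id kˣ) r (m, AdelicGeo.norm K v r e) := rfl

theorem norm_ι (c : kˣ) : norm K v r (ι K v _ r c) = ι (fun _ => k) v (fun _ => MonoidHom.id kˣ) r c := by
  refine (norm_mk c 1).trans ?_
  rw [map_one]
  rfl

theorem norm_triv (h : ∀ i, GL (Fin r) (v i).integer) :
    norm K v r (triv K v _ r h) = triv (fun _ => k) v (fun _ => MonoidHom.id kˣ) r h := by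
  refine congrArg (mk (fun _ => k) v (fun _ => MonoidHom.id kˣ) r) (Prod.ext rfl (RestrictedProduct.ext _ _ fun i => ?_))
  exact Geo.norm_triv (h i)

theorem proj_norm (e : AdelicMeta K v (fun i => Units.map (Algebra.norm k : K i →* k)) r) (i : I) :
    proj (fun _ => k) v (fun _ => MonoidHom.id kˣ) r (norm K v r e) i = proj K v _ r e i := by
  obtain ⟨p, rfl⟩ := mk_surjective e
  exact Geo.proj_norm (p.2 i)

/-- The short five lemma: the norm is the identity on kˣ and on the restricted product of the GL_r.
The local norms need not be bijective; the push-out along the norms of scalars makes this true. -/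
theorem norm_bijective [∀ i, FiniteResidue (K i) (v i)] : Function.Bijective (norm (k := k) K v r) := by
  constructor
  · rw [injective_iff_map_eq_one]
    intro e he
    obtain ⟨c, rfl⟩ := exists_ι_eq (e := e) fun i => by
      rw [← proj_norm, he, map_one]
      rfl
    rw [norm_ι, ← map_one (ι (fun _ => k) v (fun _ => MonoidHom.id kˣ) r)] at he
    rw [ι_injective he, map_one]
  · intro y
    obtain ⟨x, hx⟩ := proj_surjective (K := K) (v := v)
      (N := fun i => Units.map (Algebra.norm k : K i →* k)) (proj (fun _ => k) v (fun _ => MonoidHom.id kˣ) r y)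
    obtain ⟨c, hc⟩ := exists_ι_eq (e := y * (norm K v r x)⁻¹) fun i => by
      rw [map_mul, map_inv, mul_apply, inv_apply, proj_norm, hx, mul_inv_cancel]
    refine ⟨ι K v _ r c * x, ?_⟩
    rw [map_mul, norm_ι, ← hc, inv_mul_cancel_right]

end AdelicMeta

end AdelicNorm

section BruhatMap

theorem IsBruhat.map {F F' : Type*} [Field F] [Field F'] (f : F →+* F') {r : ℕ}
    {g n n' : GL (Fin r) F} {t : Fin r → Fˣ} {w : Equiv.Perm (Fin r)} (h : IsBruhat g n t w n') :
    IsBruhat (GeneralLinearGroup.map f g) (GeneralLinearGroup.map f n)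
      (fun i => Units.map f.toMonoidHom (t i)) w (GeneralLinearGroup.map f n') := by
  have hu {n : GL (Fin r) F} (h : IsUnipotent n) : IsUnipotent (GeneralLinearGroup.map f n) :=
    ⟨fun i => (congrArg f (h.1 i)).trans (map_one f),
      fun i j hij => (congrArg f (h.2 i j hij)).trans (map_zero f)⟩
  refine ⟨hu h.1, hu h.2.1, ?_⟩
  have h1 : GeneralLinearGroup.map f (diagGL t * permGL F w) =
      diagGL (fun i => Units.map f.toMonoidHom (t i)) * permGL F' w := by
    refine GeneralLinearGroup.ext fun i j => ?_
    rw [diagGL_mul_permGL_apply]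
    refine (congrArg f (diagGL_mul_permGL_apply t w i j)).trans ?_
    rw [apply_ite f, map_zero]
    rfl
  rw [h.2.2, map_mul, mul_assoc n, map_mul, h1]
  simp only [mul_assoc]

end BruhatMap

/-! ### The global extension, the morphism Φ and the product formula -/

section Global

variable {k : Type*} [Field k] {S : Set (Place k)} {r : ℕ}

open Filter in
theorem eventually_outside {P : Place k → Prop} (h : ∀ᶠ p in cofinite, P p) :
    ∀ᶠ p : {p : Place k // p ∉ S} in cofinite, P p.1 :=
  Subtype.val_injective.tendsto_cofinite.eventually h

/-- The `p`-adic Bruhat sections attached to a global Bruhat decomposition form an element of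
the restricted product. -/
theorem exists_adelic_bruhatSection (K : {p : Place k // p ∉ S} → Type*) [∀ p, Field (K p)]
    [∀ p, Algebra (K p) (Loc p.1)] [∀ p, IntegralConstants (K p) (locVal p.1)]
    [∀ p, FiniteResidue (K p) (locVal p.1)] {g n n' : GL (Fin r) (RatFunc k)}
    {t : Fin r → (RatFunc k)ˣ} {w : Equiv.Perm (Fin r)} (h : IsBruhat g n t w n') :
    ∃ e : AdelicGeo K (fun p => locVal p.1) r, ∀ p,
      IsBruhatSection (K p) (locVal p.1) r (glLoc p.1 n)
        (fun i => Units.map (toLoc p.1).toMonoidHom (t i)) w (glLoc p.1 n') (e p) := by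
  choose e he using fun p : {p : Place k // p ∉ S} =>
    exists_isBruhatSection (K := K p) (v := locVal p.1) (h.map (toLoc p.1))
  refine ⟨⟨e, ?_⟩, he⟩
  -- Outside finitely many places all four of n, n', t and the valuations of the t_i satisfy the
  -- hypotheses of `IsBruhatSection.mem_range_triv`.
  have h1 : ∀ᶠ p : Place k in Filter.cofinite, ∀ i, locVal p (toLoc p (t i)) = 1 :=
    Filter.eventually_all.2 fun i => eventually_val_eq_one (t i)
  filter_upwards [eventually_outside (eventually_mem_range_ofInt n),
    eventually_outside (eventually_mem_range_ofInt n'),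
    eventually_outside (eventually_mem_range_ofInt (diagGL t)),
    eventually_outside h1] with p h2 h3 h4 h5
  refine (he p).mem_range_triv (h.map (toLoc p.1)) h2 h3 ?_ h5
  have e1 : glLoc p.1 (diagGL t) = diagGL fun i => Units.map (toLoc p.1).toMonoidHom (t i) := by
    refine GeneralLinearGroup.ext fun i j => ?_
    change toLoc p.1 (diagonal (fun i => (t i : RatFunc k)) i j) =
      diagonal (fun i => toLoc p.1 (t i)) i j
    rw [diagonal_apply, diagonal_apply, apply_ite (toLoc p.1), map_zero]
  rwa [e1] at h4

namespace GlobalMeta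

theorem exists_ι_mul {x y : GlobalMeta S r} (h : proj S r x = proj S r y) :
    ∃ c, x = ι S r c * y := by
  obtain ⟨c, hc⟩ := AdelicMeta.exists_ι_eq (e := x.1.2 * y.1.2⁻¹) fun p => by
    have h' : x.1.1 = y.1.1 := h
    rw [map_mul, map_inv, mul_apply, inv_apply, x.2, y.2, h', mul_inv_cancel]
  refine ⟨c, Subtype.ext (Prod.ext (h.trans (one_mul _).symm) ?_)⟩
  change x.1.2 = AdelicMeta.ι _ _ _ r c * y.1.2
  rw [← hc, inv_mul_cancel_right]

theorem isCentralExtension : IsCentralExtension (ι S r) (proj S r) where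
  injective := fun c d h => AdelicMeta.ι_injective (congrArg (fun x => x.1.2) h)
  exact := by
    ext x
    constructor
    · rintro ⟨c, rfl⟩
      rfl
    · intro h
      obtain ⟨c, hc⟩ := exists_ι_mul (y := 1) ((MonoidHom.mem_ker.1 h).trans (map_one _).symm)
      exact ⟨c, by rw [hc, mul_one]⟩
  surjective := by
    intro g
    obtain ⟨y, hy⟩ := AdelicMeta.proj_surjective (K := fun _ : {p : Place k // p ∉ S} => k)
      (v := fun p => locVal p.1) (N := fun _ => MonoidHom.id kˣ) (r := r)
      ⟨fun p => glLoc p.1 g, eventually_outside (eventually_mem_range_ofInt g)⟩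
    exact ⟨⟨(g, y), fun p => congrArg (· p) hy⟩, rfl⟩
  central := by
    rintro _ ⟨c, rfl⟩
    refine Subgroup.mem_center_iff.2 fun x => Subtype.ext (Prod.ext ?_ ?_)
    · exact (mul_one x.1.1).trans (one_mul x.1.1).symm
    · exact (AdelicMeta.ι_comm c x.1.2).symm

theorem existsUnique_isSection (g : GL (Fin r) (RatFunc k)) : ∃! x, IsSection S r g x := by
  obtain ⟨n, t, w, n', h⟩ := exists_isBruhat g
  obtain ⟨e, he⟩ := exists_adelic_bruhatSection (S := S) (fun _ => k) h
  refine ⟨⟨(g, AdelicMeta.mk _ _ _ r (1, e)), fun p => ?_⟩, ⟨n, t, w, n', h, e, he, rfl⟩, ?_⟩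
  · exact (he p).proj_eq (h.map (toLoc p.1))
  · rintro x ⟨m, s, x, m', h', e', he', hx⟩
    refine Subtype.ext (hx.trans ?_)
    -- Independence from the global decomposition follows from the local independence at each p.
    have : e' = e := RestrictedProduct.ext _ _ fun p =>
      (he' p).eq (h'.map (toLoc p.1)) (h.map (toLoc p.1)) (he p)
    rw [this]

theorem isSection_sect (g : GL (Fin r) (RatFunc k)) : IsSection S r g (sect S r g) :=
  Classical.epsilon_spec (existsUnique_isSection g).exists

theorem proj_sect (g : GL (Fin r) (RatFunc k)) : proj S r (sect S r g) = g := by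
  obtain ⟨n, t, w, n', -, e, -, h⟩ := isSection_sect (S := S) g
  exact congrArg Prod.fst h

theorem triv_eq (h : GL (Fin r) (sInt S)) : triv S r h = ι S r (kappa S r h) *
    sect S r (GeneralLinearGroup.map (sInt S).subtype h) :=
  Classical.epsilon_spec (p := fun c => triv S r h = ι S r c *
    sect S r (GeneralLinearGroup.map (sInt S).subtype h)) (exists_ι_mul (by rw [proj_sect]; rfl))

variable (S r) in
/-- The isomorphism between the adelic metaplectic group and the group of pairs `(g, δ)` with
`δ` in the tensor product of the local `k`-lines. -/
def normEquiv : MetaA S r ≃* TensorMeta S r :=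
  MulEquiv.ofBijective _ AdelicMeta.norm_bijective

variable (S r) in
/-- The morphism from the global to the adelic metaplectic group. -/
def toAdelic : GlobalMeta S r →* MetaA S r :=
  (normEquiv S r).symm.toMonoidHom.comp ((MonoidHom.snd _ _).comp (GlobalMeta S r).subtype)

theorem toAdelic_eq_iff {x : GlobalMeta S r} {y : MetaA S r} :
    toAdelic S r x = y ↔ x.1.2 = normEquiv S r y :=
  (normEquiv S r).symm_apply_eq

theorem toAdelic_ι (c : kˣ) : toAdelic S r (ι S r c) = AdelicMeta.ι _ _ _ r c :=
  toAdelic_eq_iff.2 (AdelicMeta.norm_ι c).symm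

theorem toAdelic_triv (h : GL (Fin r) (sInt S)) :
    toAdelic S r (triv S r h) = AdelicMeta.triv _ _ _ r fun p => glIntLoc p h :=
  toAdelic_eq_iff.2 (AdelicMeta.norm_triv _).symm

theorem proj_toAdelic (x : GlobalMeta S r) (p : {p : Place k // p ∉ S}) :
    AdelicMeta.proj _ _ _ r (toAdelic S r x) p = glLoc p.1 (proj S r x) := by
  rw [← AdelicMeta.proj_norm]
  exact (congrArg (fun y => AdelicMeta.proj _ _ _ r y p) (toAdelic_eq_iff.1 rfl).symm).trans (x.2 p)

/-- The global group consists of the pairs in GL_r(F) × `TensorMeta` with matching images, so x can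
only be the pair formed by g and the norm of y. -/
theorem existsUnique_toAdelic_eq (g : GL (Fin r) (RatFunc k)) (y : MetaA S r)
    (h : ∀ p, AdelicMeta.proj _ _ _ r y p = glLoc p.1 g) :
    ∃! x, proj S r x = g ∧ toAdelic S r x = y := by
  refine ⟨⟨(g, normEquiv S r y), fun p => (AdelicMeta.proj_norm y p).trans (h p)⟩,
    ⟨rfl, toAdelic_eq_iff.2 rfl⟩, ?_⟩
  rintro x ⟨h1, h2⟩
  exact Subtype.ext (Prod.ext h1 (toAdelic_eq_iff.1 h2))

/-- One global Bruhat decomposition is used at every place, over k and over k_p alike; the norm of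
the lift over k_p is then the lift over k. -/
theorem toAdelic_sect (g : GL (Fin r) (RatFunc k)) :
    ∃ e : AdelicGeo (fun p : {p : Place k // p ∉ S} => ResField p.1) (fun p => locVal p.1) r,
      (∀ p, e p = Geo.sect (ResField p.1) (locVal p.1) r (glLoc p.1 g)) ∧
        toAdelic S r (sect S r g) = AdelicMeta.mk _ _ _ r (1, e) := by
  obtain ⟨n, t, w, n', h, e, he, hx⟩ := isSection_sect (S := S) g
  obtain ⟨e', he'⟩ := exists_adelic_bruhatSection (S := S) (fun p => ResField p.1) h
  refine ⟨e', fun p => (Geo.sect_eq (h.map (toLoc p.1)) (he' p)).symm, toAdelic_eq_iff.2 ?_⟩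
  refine (congrArg Prod.snd hx).trans (congrArg (fun e => AdelicMeta.mk _ _ _ r (1, e))
    (RestrictedProduct.ext _ _ fun p => ?_))
  exact (he p).eq (h.map (toLoc p.1)) (h.map (toLoc p.1)) (he' p).norm

/-- The image under Φ of κ_S^*(h) s(h)⁻¹ is, on one side, the scalar κ_S(h); on the other, the class
of the family of local scalars κ'_p(h), which the push-out turns into the product of their norms. -/
theorem kappa_eq (h : GL (Fin r) (sInt S)) :
    (Function.mulSupport fun p : {p : Place k // p ∉ S} => kappaLoc p.1 (glIntLoc p h)).Finite ∧
      kappa S r h = ∏ᶠ p : {p : Place k // p ∉ S}, kappaLoc p.1 (glIntLoc p h) := by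
  obtain ⟨e, he, hx⟩ := toAdelic_sect (S := S) (GeneralLinearGroup.map (sInt S).subtype h)
  have h1 := congrArg (toAdelic S r) (triv_eq h)
  rw [map_mul, toAdelic_ι, toAdelic_triv, hx, ← mul_inv_eq_iff_eq_mul, ← map_inv] at h1
  let d : AdelicGeo (fun p : {p : Place k // p ∉ S} => ResField p.1) (fun p => locVal p.1) r :=
    ⟨fun p => Geo.triv _ (locVal p.1) r (glIntLoc p h),
      Filter.Eventually.of_forall fun p => ⟨_, rfl⟩⟩
  have h2 (p) : (d * e⁻¹) p = Geo.ι (ResField p.1) (locVal p.1) r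
      (Geo.kappa (ResField p.1) (locVal p.1) r (glIntLoc p h)) := by
    rw [mul_apply, inv_apply, he, mul_inv_eq_iff_eq_mul]
    exact Geo.triv_eq (glIntLoc p h)
  have h3 : (AdelicMeta.mk _ _ _ r (1, d * e⁻¹) : MetaA S r) =
      AdelicMeta.ι _ _ _ r (kappa S r h) := by
    rw [← h1]
    refine Eq.trans (congrArg (AdelicMeta.mk _ _ _ r) ?_) (map_mul _ (1, d) (1, e)⁻¹)
    exact Prod.ext (by simp) rfl
  rw [AdelicMeta.mk_eq_ι 1 h2, one_mul] at h3
  -- The family of the κ'_p(h) lies in the restricted product, so almost all of its members are 1,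
  -- and hence so are their norms.
  refine ⟨(AdelicMeta.finite_ne_one_of_mem_range h2).subset fun p hp h0 => hp ?_,
    (AdelicMeta.ι_injective h3).symm⟩
  change Units.map (Algebra.norm k) _ = 1
  rw [h0, map_one]

end GlobalMeta

end Global

end

end Metaplectic

end

open Metaplectic Matrix in
theorem mainTheorem9 {k : Type*} [Field k] [Finite k] (hk : ringChar k ≠ 2) (r : ℕ)
    (S : Set (Place k)) (hS : S.Finite) :
    -- the two rows are central extensions by `kˣ`
    (IsCentralExtension (GlobalMeta.ι S r) (GlobalMeta.proj S r) ∧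
      IsCentralExtension (AdelicMeta.ι _ _ _ r : kˣ →* MetaA S r) (AdelicMeta.proj _ _ _ r)) ∧
    -- the sections `g ↦ (g, δ_g)` are well defined, and `κ` compares them to the splittings
    ((∀ p : Place k, p ∉ S →
        (∀ g, ∃! e, Geo.IsSection (ResField p) (locVal p) r g e) ∧
        ∀ h, Geo.triv (ResField p) (locVal p) r h =
          Geo.ι (ResField p) (locVal p) r (Geo.kappa (ResField p) (locVal p) r h) *
            Geo.sect (ResField p) (locVal p) r (ofInt (locVal p) h)) ∧
      (∀ g, ∃! x, GlobalMeta.IsSection S r g x) ∧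
      ∀ h, GlobalMeta.triv S r h = GlobalMeta.ι S r (GlobalMeta.kappa S r h) *
        GlobalMeta.sect S r (GeneralLinearGroup.map (sInt S).subtype h)) ∧
    -- the morphism of extensions, whose right-hand square is cartesian
    (∃ Φ : GlobalMeta S r →* MetaA S r,
      (∀ c, Φ (GlobalMeta.ι S r c) = AdelicMeta.ι _ _ _ r c) ∧
      (∀ x p, AdelicMeta.proj _ _ _ r (Φ x) p = glLoc p.1 (GlobalMeta.proj S r x)) ∧
      (∀ (g : GL (Fin r) (RatFunc k)) (y : MetaA S r),
        (∀ p, AdelicMeta.proj _ _ _ r y p = glLoc p.1 g) →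
          ∃! x, GlobalMeta.proj S r x = g ∧ Φ x = y) ∧
      -- it is compatible with the sections and with the splittings
      (∀ g, ∃ e : AdelicGeo (fun p : {p : Place k // p ∉ S} => ResField p.1)
          (fun p => locVal p.1) r,
        (∀ p, e p = Geo.sect (ResField p.1) (locVal p.1) r (glLoc p.1 g)) ∧
          Φ (GlobalMeta.sect S r g) = AdelicMeta.mk _ _ _ r (1, e)) ∧
      (∀ h, Φ (GlobalMeta.triv S r h) = AdelicMeta.triv _ _ _ r fun p => glIntLoc p h)) ∧
    -- the product formula for `κ`
    (∀ h : GL (Fin r) (sInt S),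
      (Function.mulSupport fun p : {p : Place k // p ∉ S} =>
        kappaLoc p.1 (glIntLoc p h)).Finite ∧
      GlobalMeta.kappa S r h =
        ∏ᶠ p : {p : Place k // p ∉ S}, kappaLoc p.1 (glIntLoc p h)) := by

  refine ⟨⟨GlobalMeta.isCentralExtension, AdelicMeta.isCentralExtension⟩,
    ⟨fun p _ => ⟨Geo.existsUnique_isSection, Geo.triv_eq⟩, GlobalMeta.existsUnique_isSection,
      GlobalMeta.triv_eq⟩,
    ⟨GlobalMeta.toAdelic S r, GlobalMeta.toAdelic_ι, GlobalMeta.proj_toAdelic,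
      GlobalMeta.existsUnique_toAdelic_eq, GlobalMeta.toAdelic_sect, GlobalMeta.toAdelic_triv⟩,
    GlobalMeta.kappa_eq⟩
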